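/- All graphs are finite and simple. A graph is planar if it can be drawn in the plane so that the vertices are distinct points, every edge is a polygonal arc joining its two ends and containing no other vertex, and two different edges meet at most in common ends. A graph is $C_6$-free (triangle-free) if it has no cycle of length $6$ (of length $3$) as a subgraph, not necessarily induced; $\delta(G)$ denotes the minimum degree. Let $G$ be a $C_6$-free, triangle-free planar graph with $\delta(G)\ge 3$ on $n$ vertices. Then the number $e_G$ of edges of $G$ satisfies $$ e_G \le \left\lfloor \frac{9}{5}n-4 \right\rfloor . $$ Moreover, equality holds for infinitely many integers $n$: there are infinitely many $n$ for which some $C_6$-free, triangle-free planar graph $G$ on $n$ vertices with $\delta(G)\ge 3$ has exactly $\left\lfloor \frac{9}{5}n-4 \right\rfloor$ edges. -/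

import Mathlib

/-- The point set of the polygonal curve through the listed points of the plane: the union of the
straight segments between consecutive points. -/
def polyline : List (ℝ × ℝ) → Set (ℝ × ℝ)
  | [] => ∅
  | [a] => {a}
  | a :: b :: l => segment ℝ a b ∪ polyline (b :: l)

/-- The polygonal curve through the listed points does not meet itself: each of its segments is
non-degenerate and meets the part of the curve that comes after it only in its own end point.
With at least two points listed, such a curve is a polygonal arc, a homeomorphic image
of `[0, 1]`. -/
def IsSimplePolyline : List (ℝ × ℝ) → Prop
  | [] => True
  | [_] => True
  | a :: b :: l =>
      a ≠ b ∧ segment ℝ a b ∩ polyline (b :: l) = {b} ∧ IsSimplePolyline (b :: l)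

/-- A drawing of the graph `G` in the plane without crossings: the vertices are distinct points,
every edge is a polygonal arc joining its two end vertices and passing through no other vertex,
and two different edges meet at most in common end vertices. (The value of `arc` at a pair that is
not an edge is irrelevant.) -/
structure PlaneDrawing {V : Type*} (G : SimpleGraph V) where
  point : V → ℝ × ℝ
  arc : Sym2 V → List (ℝ × ℝ)
  point_injective : Function.Injective point
  arc_simple : ∀ e ∈ G.edgeSet, IsSimplePolyline (arc e)
  arc_ends : ∀ e ∈ G.edgeSet, ∃ u v : V, e = s(u, v) ∧
    (arc e).head? = some (point u) ∧ (arc e).getLast? = some (point v)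
  vertex_on_arc : ∀ e ∈ G.edgeSet, ∀ v : V, point v ∈ polyline (arc e) → v ∈ e
  arc_inter_arc : ∀ e ∈ G.edgeSet, ∀ f ∈ G.edgeSet, e ≠ f →
    ∀ x ∈ polyline (arc e) ∩ polyline (arc f), ∃ v : V, v ∈ e ∧ v ∈ f ∧ x = point v

/-- A graph is planar if it can be drawn in the plane without crossings. -/
def SimpleGraph.IsPlanar {V : Type*} (G : SimpleGraph V) : Prop :=
  Nonempty (PlaneDrawing G)

/-! Upper bound. Write e, n, f for the numbers of edges, vertices and faces. Going around a vertex
of a drawing gives a rotation `σ` of the darts, and the orbits of `facePerm σ` play the role of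
faces. Two inequalities are combined.

Euler: e + 2 ≤ n + f. The cycle space mod 2 has dimension at least e - n + 1. Every cycle is the
coboundary of a function on faces, and constants have coboundary zero, so that dimension is at most
f - 1 (`card_edges_add_two_le_of_coboundary`). The face function of a cycle is the parity of
crossings of a vertical ray with the cycle. It is locally constant off the drawing
(`locallyConstantOff_parity`) and changes across exactly the edges of the cycle
(`isLeftValue_add_isLeftValue`). Its value on the left of a dart persists along the arc and around
the corner to the next dart of the face (`isLeftValue_last`, `isLeftValue_eq_of_sector`). No Jordan
curve theorem and no connectedness is involved.

Charging: n + 10f ≤ 5e. Faces have length at least 4, and two quadrilaterals sharing an edge would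
produce a 6-cycle, so quadrilaterals are not consecutive around a vertex. Hence a vertex of degree d
≥ 3 has at most d/2, so at most d - 2, quadrilateral corners, and there are at most 2e - 2n of them
in all. A face of length l gives 10/l to each corner, which is at most 5/2 at a quadrilateral and at
most 2 elsewhere (`card_add_ten_mul_card_faces_le`). Eliminating f yields 5e + 20 ≤ 9n.

Sharpness. Nested rings of three kinds form a graph with n = 10(K + 4) and degree sum at least
2(9n/5 - 4). It is self-similar: a 6-cycle lives in four consecutive rings, and the drawing repeats
under rotation and scaling by three. So the excluded cycles and the planarity reduce to finite
checks (`windowNoSixCycle_true`, `frameEdges_meet`, `frameEdges_meet_next`). The upper bound itself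
then forces equality. -/

/-! ### Euler's inequality from the cycle space mod 2 -/

open Finset in
/-- A linear-algebraic form of Euler's inequality: if every element of the cycle space over `ZMod 2`
is the coboundary of a `φ`-invariant function on the darts, then `φ` has many orbits. -/
theorem card_edges_add_two_le_of_coboundary {V : Type*} [Fintype V] [DecidableEq V]
    (G : SimpleGraph V) [Nonempty G.Dart] (φ : Equiv.Perm G.Dart)
    [Fintype G.edgeSet] [Fintype (Quotient (Equiv.Perm.SameCycle.setoid φ))]
    (h : ∀ c : G.edgeSet → ZMod 2, (∀ v, ∑ e : G.edgeSet, (if v ∈ (e : Sym2 V) then c e else 0) = 0) →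
      ∃ w : G.Dart → ZMod 2, (∀ d, w (φ d) = w d) ∧
        ∀ d, w d + w d.symm = c ⟨d.edge, d.edge_mem⟩) :
    Fintype.card G.edgeSet + 2 ≤
      Fintype.card V + Fintype.card (Quotient (Equiv.Perm.SameCycle.setoid φ)) := by
  classical
  obtain ⟨d₀⟩ := ‹Nonempty G.Dart›
  let Q := Quotient (Equiv.Perm.SameCycle.setoid φ)
  let bd : (G.edgeSet → ZMod 2) →ₗ[ZMod 2] (V → ZMod 2) :=
    { toFun := fun c v => ∑ e : G.edgeSet, if v ∈ (e : Sym2 V) then c e else 0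
      map_add' := by
        intro x y; funext v
        simp only [Pi.add_apply, ← sum_add_distrib]
        exact sum_congr rfl fun e _ => by split_ifs <;> simp
      map_smul' := by
        intro r x; funext v
        simp [mul_sum] }
  let tot : (V → ZMod 2) →ₗ[ZMod 2] ZMod 2 := ∑ v, LinearMap.proj v
  have htot : ∀ f, tot f = ∑ v, f v := fun f => by simp [tot, LinearMap.sum_apply]
  -- An edge contributes at both of its ends, so boundaries have total zero and `bd` has rank at
  -- most n - 1.
  have hrange : LinearMap.range bd ≤ LinearMap.ker tot := by
    rintro _ ⟨c, rfl⟩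
    rw [LinearMap.mem_ker, htot]
    change ∑ v, ∑ e : G.edgeSet, (if v ∈ (e : Sym2 V) then c e else 0) = 0
    rw [sum_comm]
    refine sum_eq_zero fun e _ => ?_
    obtain ⟨e, he⟩ := e
    induction e using Sym2.ind with
    | _ a b =>
      have hab : a ≠ b := G.ne_of_adj he
      rw [← sum_filter]
      have : (univ.filter fun v => v ∈ s(a, b)) = {a, b} := by ext v; simp
      rw [this, sum_pair hab]
      exact CharTwo.add_self_eq_zero _
  have htotsurj : LinearMap.range tot = ⊤ := by
    rw [LinearMap.range_eq_top]
    intro z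
    refine ⟨Pi.single d₀.fst z, ?_⟩
    rw [htot, sum_pi_single']
    simp
  have h1 := LinearMap.finrank_range_add_finrank_ker tot
  have h2 := LinearMap.finrank_range_add_finrank_ker bd
  have h3 := Submodule.finrank_mono hrange
  rw [htotsurj] at h1
  simp only [finrank_top, Module.finrank_self, Module.finrank_fintype_fun_eq_card] at h1 h2
  have hrep : ∀ e : G.edgeSet, ∃ d : G.Dart, d.edge = e := by
    rintro ⟨e, he⟩
    induction e using Sym2.ind with
    | _ a b => exact ⟨⟨(a, b), he⟩, rfl⟩
  choose rep hrep using hrep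
  let mk : G.Dart → Q := fun d => Quotient.mk _ d
  let cob : (Q → ZMod 2) →ₗ[ZMod 2] (G.edgeSet → ZMod 2) :=
    { toFun := fun f e => f (mk (rep e)) + f (mk (rep e).symm)
      map_add' := by intro x y; funext e; simp only [Pi.add_apply]; ring
      map_smul' := by intro r x; funext e; simp [mul_add] }
  -- An invariant `w` is constant on orbits of `φ`, hence descends to `Q`.
  have hcob : LinearMap.ker bd ≤ LinearMap.range cob := by
    intro c hc
    obtain ⟨w, hw1, hw2⟩ := h c (fun v => congrFun (LinearMap.mem_ker.1 hc) v)
    have hpow : ∀ (n : ℤ) d, w ((φ ^ n) d) = w d := by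
      intro n d
      induction n using Int.induction_on with
      | zero => simp
      | succ n ih => rw [add_comm, zpow_add, zpow_one, Equiv.Perm.mul_apply, hw1, ih]
      | pred n ih =>
        rw [← hw1, ← Equiv.Perm.mul_apply, ← zpow_one_add]
        simpa using ih
    refine ⟨fun q => Quotient.liftOn q w ?_, ?_⟩
    · rintro a b ⟨n, hn⟩
      rw [← hn, hpow]
    · funext e
      have := hw2 (rep e)
      change w (rep e) + w (rep e).symm = _
      rw [this]
      congr 1
      exact Subtype.ext (hrep e)
  have h4 := LinearMap.finrank_range_add_finrank_ker cob
  have h5 := Submodule.finrank_mono hcob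
  -- Constants lie in the kernel of `cob`. This supplies one unit of the 2 in Euler's inequality;
  -- the total-zero condition on boundaries supplies the other.
  have h6 : 0 < Module.finrank (ZMod 2) (LinearMap.ker cob) := by
    rw [Module.finrank_pos_iff_exists_ne_zero]
    refine ⟨⟨fun _ => 1, ?_⟩, ?_⟩
    · rw [LinearMap.mem_ker]
      funext e
      exact CharTwo.add_self_eq_zero _
    · intro hz
      have := congrFun (congrArg Subtype.val hz) (mk d₀)
      exact one_ne_zero this
  simp only [Module.finrank_fintype_fun_eq_card] at h4
  change _ ≤ _ + Fintype.card Q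
  omega

/-! ### Excluded cycles as explicit sequences of vertices -/

theorem cycleGraph_six_isContained_iff {V : Type*} {G : SimpleGraph V} :
    (SimpleGraph.cycleGraph 6).IsContained G ↔
      ∃ p : Fin 6 → V, Function.Injective p ∧ ∀ i, G.Adj (p i) (p (i + 1)) := by
  constructor
  · rintro ⟨f⟩
    refine ⟨f, f.injective', fun i => f.toHom.map_adj ?_⟩
    rw [SimpleGraph.cycleGraph_adj]
    right; exact add_sub_cancel_left i 1
  · rintro ⟨p, hp, ha⟩
    refine ⟨⟨⟨p, ?_⟩, hp⟩⟩
    intro a b hab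
    rcases SimpleGraph.cycleGraph_adj.1 hab with h | h
    · have : a = b + 1 := by rw [← h]; exact (add_sub_cancel b a).symm
      rw [this]; exact (ha b).symm
    · have : b = a + 1 := by rw [← h]; exact (add_sub_cancel a b).symm
      rw [this]; exact ha a

theorem cycleGraph_six_isContained_of_adj {V : Type*} {G : SimpleGraph V} {a b c d e f : V}
    (hab : G.Adj a b) (hbc : G.Adj b c) (hcd : G.Adj c d) (hde : G.Adj d e) (hef : G.Adj e f)
    (hfa : G.Adj f a) (hac : a ≠ c) (had : a ≠ d) (hae : a ≠ e) (hbd : b ≠ d) (hbe : b ≠ e)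
    (hbf : b ≠ f) (hce : c ≠ e) (hcf : c ≠ f) (hdf : d ≠ f) :
    (SimpleGraph.cycleGraph 6).IsContained G := by
  rw [cycleGraph_six_isContained_iff]
  refine ⟨![a, b, c, d, e, f], ?_, ?_⟩
  · have := hab.ne; have := hbc.ne; have := hcd.ne; have := hde.ne; have := hef.ne; have := hfa.ne
    intro i j hij
    fin_cases i <;> fin_cases j <;> first | rfl | (exfalso; simp at hij; simp_all)
  · intro i
    fin_cases i <;> assumption

theorem SimpleGraph.CliqueFree.not_adj_of_adj_of_adj {V : Type*} {G : SimpleGraph V}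
    (h : G.CliqueFree 3) {a b c : V} (hab : G.Adj a b) (hbc : G.Adj b c) : ¬ G.Adj c a := by
  classical
  intro hca
  exact h {a, b, c} (SimpleGraph.is3Clique_iff.2 ⟨a, b, c, hab, hca.symm, hbc, rfl⟩)

/-! ### Rotation systems and the charge count for faces -/

/-- The face permutation of a rotation system `σ`. -/
def facePerm {V : Type*} {G : SimpleGraph V} (σ : Equiv.Perm G.Dart) : Equiv.Perm G.Dart :=
  (Function.Involutive.toPerm SimpleGraph.Dart.symm SimpleGraph.Dart.symm_involutive).trans σ⁻¹

section Rotation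

variable {V : Type*} {G : SimpleGraph V} {σ : Equiv.Perm G.Dart}

theorem facePerm_apply (d : G.Dart) : facePerm σ d = σ⁻¹ d.symm := rfl

theorem apply_facePerm (d : G.Dart) : σ (facePerm σ d) = d.symm := by
  simp [facePerm_apply]

theorem fst_facePerm (hσ : ∀ d, (σ d).fst = d.fst) (d : G.Dart) :
    (facePerm σ d).fst = d.snd := by
  rw [← hσ, apply_facePerm]; rfl

theorem facePerm_ne_symm (h1 : ∀ d, σ d ≠ d) (d : G.Dart) : facePerm σ d ≠ d.symm := by
  intro h
  exact h1 d.symm (by rw [← h, apply_facePerm, h])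

theorem facePerm_ne (hσ : ∀ d, (σ d).fst = d.fst) (d : G.Dart) : facePerm σ d ≠ d := by
  intro h
  have := fst_facePerm hσ d
  rw [h] at this
  exact d.adj.ne this

theorem snd_facePerm_ne (hσ : ∀ d, (σ d).fst = d.fst) (h1 : ∀ d, σ d ≠ d) (d : G.Dart) :
    (facePerm σ d).snd ≠ d.fst := by
  intro h
  refine facePerm_ne_symm h1 d ?_
  exact SimpleGraph.Dart.ext _ _ (Prod.ext (fst_facePerm hσ d) h)

theorem facePerm_facePerm_ne (hσ : ∀ d, (σ d).fst = d.fst) (h1 : ∀ d, σ d ≠ d) (d : G.Dart) :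
    facePerm σ (facePerm σ d) ≠ d := by
  intro h
  refine snd_facePerm_ne hσ h1 d ?_
  rw [← fst_facePerm hσ, h]

theorem facePerm_facePerm_facePerm_ne (hσ : ∀ d, (σ d).fst = d.fst)
    (hG : G.CliqueFree 3) (d : G.Dart) :
    facePerm σ (facePerm σ (facePerm σ d)) ≠ d := by
  intro h
  have e1 := fst_facePerm hσ d
  have e2 := fst_facePerm hσ (facePerm σ d)
  have e3 := fst_facePerm hσ (facePerm σ (facePerm σ d))
  rw [h] at e3
  have a1 := d.adj
  have a2 := (facePerm σ d).adj
  have a3 := (facePerm σ (facePerm σ d)).adj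
  rw [e1, ← e2] at a2
  rw [← e3] at a3
  exact hG.not_adj_of_adj_of_adj a1 a2 a3

/-- In a `C₆`-free triangle-free graph two quadrilateral faces do not share an edge. -/
theorem not_quadrilateral_of_quadrilateral (hσ : ∀ d, (σ d).fst = d.fst) (h1 : ∀ d, σ d ≠ d)
    (h2 : ∀ d, σ (σ d) ≠ d) (hG : G.CliqueFree 3) (hC : (SimpleGraph.cycleGraph 6).Free G)
    (d : G.Dart)
    (hd : facePerm σ (facePerm σ (facePerm σ (facePerm σ d))) = d)
    (hd' : facePerm σ (facePerm σ (facePerm σ (facePerm σ (σ d)))) = σ d) : False := by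
  set x := σ d with hx
  -- The faces of `d` and of `x.symm` coincide, so the hypotheses say that both sides of the edge of
  -- `x` are quadrilaterals.
  have hy : facePerm σ x.symm = d := by
    rw [facePerm_apply, SimpleGraph.Dart.symm_symm, hx]; simp
  have hy3 : facePerm σ (facePerm σ (facePerm σ d)) = x.symm := by
    apply (facePerm σ).injective; rw [hd, hy]
  have ea : d.fst = x.fst := (hσ d).symm
  have e1 := fst_facePerm hσ x
  have e2 := fst_facePerm hσ (facePerm σ x)
  have e3 := fst_facePerm hσ (facePerm σ (facePerm σ x))
  have e4 := fst_facePerm hσ (facePerm σ (facePerm σ (facePerm σ x)))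
  rw [hd'] at e4
  have f1 := fst_facePerm hσ d
  have f2 := fst_facePerm hσ (facePerm σ d)
  have f3 := fst_facePerm hσ (facePerm σ (facePerm σ d))
  rw [hy3] at f3
  have f3' : x.snd = (facePerm σ (facePerm σ d)).snd := f3
  have n1 := snd_facePerm_ne hσ h1 x
  have n2 := snd_facePerm_ne hσ h1 (facePerm σ x)
  have n3 := snd_facePerm_ne hσ h1 d
  have n4 := snd_facePerm_ne hσ h1 (facePerm σ d)
  -- the face vertices `a b c g` and `a e f b`
  set a := x.fst with ha
  set b := x.snd with hb
  set c := (facePerm σ x).snd with hc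
  set g := (facePerm σ (facePerm σ x)).snd with hg
  set e := d.snd with he
  set f := (facePerm σ d).snd with hf
  have Aab : G.Adj a b := x.adj
  have Abc : G.Adj b c := by have := (facePerm σ x).adj; rwa [e1] at this
  have Acg : G.Adj c g := by have := (facePerm σ (facePerm σ x)).adj; rwa [e2] at this
  have Aga : G.Adj g a := by
    have := (facePerm σ (facePerm σ (facePerm σ x))).adj; rwa [e3, ← e4] at this
  have Aae : G.Adj a e := by have := d.adj; rwa [ea] at this
  have Aef : G.Adj e f := by have := (facePerm σ d).adj; rwa [f1] at this
  have Afb : G.Adj f b := by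
    have := (facePerm σ (facePerm σ d)).adj; rwa [f2, ← f3'] at this
  rw [e1] at n2
  rw [ea] at n3
  -- If `c = f`, the two faces share a further edge at `b`, and `σ` has an orbit of length two
  -- there.
  have ncf : c ≠ f := by
    intro h
    have k1 : facePerm σ x = (facePerm σ (facePerm σ d)).symm := by
      refine SimpleGraph.Dart.ext _ _ (Prod.ext ?_ ?_)
      · exact e1.trans f3'
      · exact h.trans f2.symm
    have k2 : σ (facePerm σ x) = x.symm := apply_facePerm x
    have k3 : σ (σ (facePerm σ x)) = facePerm σ x := by
      rw [k2, ← hy3, apply_facePerm, k1]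
    exact h2 _ k3
  -- The same argument at `a`.
  have nge : g ≠ e := by
    intro h
    have k0 : facePerm σ (facePerm σ (facePerm σ x)) = d.symm := by
      refine SimpleGraph.Dart.ext _ _ (Prod.ext ?_ ?_)
      · exact e3.trans h
      · exact e4.symm.trans ea.symm
    have k1 : σ x = d := by
      have := apply_facePerm (σ := σ) (facePerm σ (facePerm σ (facePerm σ x)))
      rw [hd', k0] at this
      simpa using this
    exact h2 d (by rw [← hx, k1])
  -- The hexagon is the outer boundary of the two quadrilaterals. The remaining coincidences `c = e`
  -- and `g = f` would create triangles.
  refine hC (cycleGraph_six_isContained_of_adj Abc Acg Aga Aae Aef Afb ?_ ?_ ?_ ?_ ?_ ?_ ?_ ?_ ?_)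
  · exact n2.symm
  · exact Aab.ne'
  · intro h
    exact h1 d (SimpleGraph.Dart.ext _ _ (Prod.ext ea.symm h))
  · exact n1
  · rintro h
    rw [← h] at Aae
    exact hG.not_adj_of_adj_of_adj Aab Abc Aae.symm
  · exact ncf
  · exact nge
  · rintro h
    rw [← h] at Afb
    exact hG.not_adj_of_adj_of_adj Aab Afb.symm Aga
  · exact n3.symm

open Finset in
/-- The charge count: with a rotation system in which consecutive faces around a vertex are not both
quadrilaterals, there are few faces. -/
theorem card_add_ten_mul_card_faces_le [Fintype V] [DecidableEq V] [DecidableRel G.Adj]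
    [Fintype (Quotient (Equiv.Perm.SameCycle.setoid (facePerm σ)))]
    (hσ : ∀ d, (σ d).fst = d.fst) (h1 : ∀ d, σ d ≠ d)
    (h2 : ∀ d, σ (σ d) ≠ d) (hG : G.CliqueFree 3) (hC : (SimpleGraph.cycleGraph 6).Free G)
    (hδ : ∀ v, 3 ≤ G.degree v) :
    Fintype.card V + 10 * Fintype.card (Quotient (Equiv.Perm.SameCycle.setoid (facePerm σ))) ≤
      5 * G.edgeFinset.card := by
  classical
  let φ := facePerm σ
  let Q := Quotient (Equiv.Perm.SameCycle.setoid φ)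
  let mk : G.Dart → Q := fun d => Quotient.mk _ d
  let fib : Q → Finset G.Dart := fun q => univ.filter fun d => mk d = q
  let bad : G.Dart → Prop := fun d => φ (φ (φ (φ d))) = d
  have hmk : ∀ d, mk (φ d) = mk d := fun d =>
    Quotient.sound (show Equiv.Perm.SameCycle φ (φ d) d from ⟨-1, by simp⟩)
  have n1 : ∀ d, φ d ≠ d := facePerm_ne hσ
  have n2 : ∀ d, φ (φ d) ≠ d := facePerm_facePerm_ne hσ h1
  have n3 : ∀ d, φ (φ (φ d)) ≠ d := facePerm_facePerm_facePerm_ne hσ hG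
  have c4 : ∀ d, 4 ≤ (fib (mk d)).card := by
    intro d
    have hsub : ({d, φ d, φ (φ d), φ (φ (φ d))} : Finset G.Dart) ⊆ fib (mk d) := by
      intro x hx
      simp only [mem_insert, mem_singleton] at hx
      rcases hx with rfl | rfl | rfl | rfl <;> simp [fib, hmk]
    refine le_trans (le_of_eq ?_) (card_le_card hsub)
    rw [card_insert_of_notMem, card_insert_of_notMem, card_insert_of_notMem, card_singleton]
    · simpa using (n1 _).symm
    · simpa using ⟨(n1 _).symm, (n2 _).symm⟩
    · simpa using ⟨(n1 _).symm, (n2 _).symm, (n3 _).symm⟩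
  have c5 : ∀ d, ¬ bad d → 5 ≤ (fib (mk d)).card := by
    intro d hd
    have hsub : ({d, φ d, φ (φ d), φ (φ (φ d)), φ (φ (φ (φ d)))} : Finset G.Dart) ⊆
        fib (mk d) := by
      intro x hx
      simp only [mem_insert, mem_singleton] at hx
      rcases hx with rfl | rfl | rfl | rfl | rfl <;> simp [fib, hmk]
    refine le_trans (le_of_eq ?_) (card_le_card hsub)
    rw [card_insert_of_notMem, card_insert_of_notMem, card_insert_of_notMem,
      card_insert_of_notMem, card_singleton]
    · simpa using (n1 _).symm
    · simpa using ⟨(n1 _).symm, (n2 _).symm⟩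
    · simpa using ⟨(n1 _).symm, (n2 _).symm, (n3 _).symm⟩
    · simpa using ⟨(n1 _).symm, (n2 _).symm, (n3 _).symm, Ne.symm hd⟩
  -- the total charge of the faces
  have hface : (10 * Fintype.card Q : ℚ) = ∑ d : G.Dart, 10 / ((fib (mk d)).card : ℚ) := by
    rw [← sum_fiberwise (s := univ) (g := mk)]
    have : ∀ q : Q, ∑ d ∈ univ.filter (fun d => mk d = q), 10 / ((fib (mk d)).card : ℚ) = 10 := by
      intro q
      have h : ∀ d ∈ univ.filter (fun d => mk d = q),
          10 / ((fib (mk d)).card : ℚ) = 10 / ((fib q).card : ℚ) := by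
        intro d hd
        rw [(mem_filter.1 hd).2]
      rw [sum_congr rfl h, sum_const, nsmul_eq_mul]
      have : (fib q).card ≠ 0 := by
        obtain ⟨d, hd⟩ := Quotient.exists_rep q
        have := c4 d
        rw [show mk d = q from hd] at this
        omega
      change ((fib q).card : ℚ) * _ = _
      field_simp
    rw [sum_congr rfl fun q _ => this q]
    simp [mul_comm, Q]
  -- The bounds are 10/4 = 2 + 1/2 and 10/5 = 2.
  have hcharge : ∀ d : G.Dart, 10 / ((fib (mk d)).card : ℚ) ≤ 2 + if bad d then 1 / 2 else 0 := by
    intro d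
    split_ifs with hd
    · have : (4 : ℚ) ≤ (fib (mk d)).card := by exact_mod_cast c4 d
      rw [div_le_iff₀ (by linarith)]
      linarith
    · have : (5 : ℚ) ≤ (fib (mk d)).card := by exact_mod_cast c5 d hd
      rw [div_le_iff₀ (by linarith)]
      linarith
  -- quadrilateral corners at a vertex
  have hbad : ∀ v, (univ.filter fun d : G.Dart => d.fst = v ∧ bad d).card + 2 ≤ G.degree v := by
    intro v
    -- `σ` injects the quadrilateral corners at `v` into the other corners, so they are at most half
    -- of the degree; with degree at least 3 this leaves at least two others.
    have hinj : ((univ.filter fun d : G.Dart => d.fst = v ∧ bad d).image σ) ⊆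
        univ.filter fun d : G.Dart => d.fst = v ∧ ¬ bad d := by
      intro x hx
      obtain ⟨d, hd, rfl⟩ := mem_image.1 hx
      simp only [mem_filter, mem_univ, true_and] at hd ⊢
      exact ⟨(hσ d).trans hd.1, fun hb =>
        not_quadrilateral_of_quadrilateral hσ h1 h2 hG hC d hd.2 hb⟩
    have hle := card_le_card hinj
    rw [card_image_of_injective _ σ.injective] at hle
    have hdeg := G.dart_fst_fiber_card_eq_degree v
    have hsplit := card_filter_add_card_filter_not
      (s := univ.filter fun d : G.Dart => d.fst = v) (p := bad)
    rw [filter_filter, filter_filter, hdeg] at hsplit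
    have := hδ v
    omega
  have hsum : (∑ d : G.Dart, if bad d then (1 : ℚ) else 0) + 2 * Fintype.card V ≤
      2 * G.edgeFinset.card := by
    have e1 : (∑ d : G.Dart, if bad d then (1 : ℕ) else 0) =
        ∑ v, (univ.filter fun d : G.Dart => d.fst = v ∧ bad d).card := by
      rw [← sum_fiberwise (s := univ) (g := fun d : G.Dart => d.fst)]
      refine sum_congr rfl fun v _ => ?_
      rw [← sum_filter, filter_filter, sum_const, smul_eq_mul, mul_one]
    have e2 : (∑ d : G.Dart, if bad d then (1 : ℕ) else 0) + 2 * Fintype.card V ≤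
        2 * G.edgeFinset.card := by
      rw [e1, ← G.sum_degrees_eq_twice_card_edges]
      calc _ = ∑ v, ((univ.filter fun d : G.Dart => d.fst = v ∧ bad d).card + 2) := by
            rw [sum_add_distrib]; simp [mul_comm]
        _ ≤ _ := sum_le_sum fun v _ => hbad v
    exact_mod_cast e2
  have hcard : (Fintype.card G.Dart : ℚ) = 2 * G.edgeFinset.card := by
    exact_mod_cast G.dart_card_eq_twice_card_edges
  have hfin : (10 * Fintype.card Q : ℚ) ≤
      2 * Fintype.card G.Dart + (∑ d : G.Dart, if bad d then (1 : ℚ) else 0) / 2 := by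
    rw [hface]
    refine (sum_le_sum fun d _ => hcharge d).trans (le_of_eq ?_)
    rw [sum_add_distrib, sum_div]
    congr 1
    · simp [mul_comm]
    · exact sum_congr rfl fun d _ => by split_ifs <;> simp
  have : (Fintype.card V + 10 * Fintype.card Q : ℚ) ≤ 5 * G.edgeFinset.card := by
    rw [hcard] at hfin
    linarith
  exact_mod_cast this

end Rotation

open Finset in
theorem five_mul_card_edgeFinset_add_twenty_le {V : Type*} [Fintype V] [DecidableEq V]
    {G : SimpleGraph V} [DecidableRel G.Adj] [Nonempty V]
    (hG : G.CliqueFree 3) (hC : (SimpleGraph.cycleGraph 6).Free G)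
    (hδ : ∀ v, 3 ≤ G.degree v)
    (h : ∃ σ : Equiv.Perm G.Dart, (∀ d, (σ d).fst = d.fst) ∧ (∀ d, σ d ≠ d) ∧
      (∀ d, σ (σ d) ≠ d) ∧ ∀ c : G.edgeSet → ZMod 2,
        (∀ v, ∑ e : G.edgeSet, (if v ∈ (e : Sym2 V) then c e else 0) = 0) →
          ∃ w : G.Dart → ZMod 2, (∀ d, w (facePerm σ d) = w d) ∧
            ∀ d, w d + w d.symm = c ⟨d.edge, d.edge_mem⟩) :
    5 * G.edgeFinset.card + 20 ≤ 9 * Fintype.card V := by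
  classical
  obtain ⟨σ, hσ, h1, h2, h⟩ := h
  obtain ⟨v⟩ := ‹Nonempty V›
  obtain ⟨u, hu⟩ := (G.degree_pos_iff_exists_adj v).1 (by have := hδ v; omega)
  have : Nonempty G.Dart := ⟨⟨(v, u), hu⟩⟩
  have k1 := card_edges_add_two_le_of_coboundary G (facePerm σ) h
  have k2 := card_add_ten_mul_card_faces_le hσ h1 h2 hG hC hδ
  rw [← SimpleGraph.edgeFinset_card] at k1
  -- Ten times `k1` added to `k2` eliminates the number of faces.
  omega

/-! ### Thin strips along the left side of a segment -/

/-- Twice the signed area of the triangle `a b x`. -/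
def areaForm (a b x : ℝ × ℝ) : ℝ := (b.1 - a.1) * (x.2 - a.2) - (b.2 - a.2) * (x.1 - a.1)

/-- The inner product of `b - a` and `x - a`. -/
def dotForm (a b x : ℝ × ℝ) : ℝ := (b.1 - a.1) * (x.1 - a.1) + (b.2 - a.2) * (x.2 - a.2)

/-- A thin open triangle on the left of the segment from `a` to `b`. -/
def leftStrip (a b : ℝ × ℝ) (δ : ℝ) : Set (ℝ × ℝ) :=
  {x | 0 < areaForm a b x ∧ areaForm a b x < δ * dotForm a b x ∧
    areaForm a b x < δ * dotForm b a x}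

open Set Filter Topology

theorem mem_segment_iff_exists_coord {a b x : ℝ × ℝ} :
    x ∈ segment ℝ a b ↔
      ∃ t : ℝ, 0 ≤ t ∧ t ≤ 1 ∧ x.1 = a.1 + t * (b.1 - a.1) ∧ x.2 = a.2 + t * (b.2 - a.2) := by
  rw [segment_eq_image']
  constructor
  · rintro ⟨t, ⟨h0, h1⟩, rfl⟩
    exact ⟨t, h0, h1, by simp, by simp⟩
  · rintro ⟨t, h0, h1, e1, e2⟩
    exact ⟨t, ⟨h0, h1⟩, Prod.ext (by simp [e1]) (by simp [e2])⟩

theorem sq_dist_pos {a b : ℝ × ℝ} (hab : a ≠ b) : 0 < (b.1 - a.1) ^ 2 + (b.2 - a.2) ^ 2 := by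
  by_contra h
  have h1 : b.1 - a.1 = 0 := by nlinarith [sq_nonneg (b.1 - a.1), sq_nonneg (b.2 - a.2)]
  have h2 : b.2 - a.2 = 0 := by nlinarith [sq_nonneg (b.1 - a.1), sq_nonneg (b.2 - a.2)]
  exact hab (Prod.ext (by linarith) (by linarith))

/-- A positive area forces both inner products to be positive, so the right-hand sides grow with
`δ`. -/
theorem leftStrip_mono {a b : ℝ × ℝ} {δ δ' : ℝ} (hδ : 0 < δ) (h : δ ≤ δ') :
    leftStrip a b δ ⊆ leftStrip a b δ' := by
  rintro x ⟨h0, h1, h2⟩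
  have p1 : 0 < dotForm a b x := by
    by_contra hc
    nlinarith
  have p2 : 0 < dotForm b a x := by
    by_contra hc
    nlinarith
  exact ⟨h0, by nlinarith, by nlinarith⟩

theorem convex_leftStrip (a b : ℝ × ℝ) (δ : ℝ) : Convex ℝ (leftStrip a b δ) := by
  rintro x ⟨x0, x1, x2⟩ y ⟨y0, y1, y2⟩ s t hs ht hst
  have e : s = 1 - t := by linarith
  have A : areaForm a b (s • x + t • y) = s * areaForm a b x + t * areaForm a b y := by
    simp only [areaForm, Prod.fst_add, Prod.snd_add, Prod.smul_fst, Prod.smul_snd, smul_eq_mul, e]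
    ring
  have B : dotForm a b (s • x + t • y) = s * dotForm a b x + t * dotForm a b y := by
    simp only [dotForm, Prod.fst_add, Prod.snd_add, Prod.smul_fst, Prod.smul_snd, smul_eq_mul, e]
    ring
  have C : dotForm b a (s • x + t • y) = s * dotForm b a x + t * dotForm b a y := by
    simp only [dotForm, Prod.fst_add, Prod.snd_add, Prod.smul_fst, Prod.smul_snd, smul_eq_mul, e]
    ring
  have key : ∀ u v : ℝ, 0 < u → 0 < v → 0 < s * u + t * v := by
    intro u v hu hv
    rcases hs.eq_or_lt with h | h
    · have : t = 1 := by linarith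
      rw [← h, this]; linarith
    · have := mul_pos h hu
      have := mul_nonneg ht hv.le
      linarith
  refine ⟨?_, ?_, ?_⟩
  · rw [A]; exact key _ _ x0 y0
  · rw [A, B]
    have := key _ _ (sub_pos.2 x1) (sub_pos.2 y1)
    linarith
  · rw [A, C]
    have := key _ _ (sub_pos.2 x2) (sub_pos.2 y2)
    linarith

theorem leftStrip_nonempty {a b : ℝ × ℝ} (hab : a ≠ b) {δ : ℝ} (hδ : 0 < δ) :
    (leftStrip a b δ).Nonempty := by
  have h := sq_dist_pos hab
  refine ⟨((a.1 + b.1) / 2 - δ / 4 * (b.2 - a.2), (a.2 + b.2) / 2 + δ / 4 * (b.1 - a.1)), ?_⟩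
  have A : areaForm a b ((a.1 + b.1) / 2 - δ / 4 * (b.2 - a.2),
      (a.2 + b.2) / 2 + δ / 4 * (b.1 - a.1)) =
      δ / 4 * ((b.1 - a.1) ^ 2 + (b.2 - a.2) ^ 2) := by simp only [areaForm]; ring
  have B : dotForm a b ((a.1 + b.1) / 2 - δ / 4 * (b.2 - a.2),
      (a.2 + b.2) / 2 + δ / 4 * (b.1 - a.1)) =
      ((b.1 - a.1) ^ 2 + (b.2 - a.2) ^ 2) / 2 := by simp only [dotForm]; ring
  have C : dotForm b a ((a.1 + b.1) / 2 - δ / 4 * (b.2 - a.2),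
      (a.2 + b.2) / 2 + δ / 4 * (b.1 - a.1)) =
      ((b.1 - a.1) ^ 2 + (b.2 - a.2) ^ 2) / 2 := by simp only [dotForm]; ring
  have := mul_pos hδ h
  exact ⟨by rw [A]; positivity, by rw [A, B]; linarith, by rw [A, C]; linarith⟩

theorem areaForm_eq_zero_of_mem_segment {a b x : ℝ × ℝ} (h : x ∈ segment ℝ a b) :
    areaForm a b x = 0 := by
  obtain ⟨t, -, -, e1, e2⟩ := mem_segment_iff_exists_coord.1 h
  simp only [areaForm, e1, e2]; ring

/-- Along a ray from `a` both forms scale by the same factor, so their ratio is constant. That ratio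
serves as `δ` when the ray points forward and to the left; otherwise every `δ` works. -/
theorem exists_disjoint_leftStrip_of_left (a b e : ℝ × ℝ) :
    ∃ δ > 0, ∀ x ∈ segment ℝ a e, x ∉ leftStrip a b δ := by
  have A : ∀ (x : ℝ × ℝ) (t : ℝ), x.1 = a.1 + t * (e.1 - a.1) → x.2 = a.2 + t * (e.2 - a.2) →
      areaForm a b x = t * areaForm a b e ∧ dotForm a b x = t * dotForm a b e := by
    intro x t h1 h2
    simp only [areaForm, dotForm, h1, h2]
    constructor <;> ring
  by_cases hc : 0 < areaForm a b e ∧ 0 < dotForm a b e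
  · refine ⟨areaForm a b e / dotForm a b e, div_pos hc.1 hc.2, ?_⟩
    rintro x hx ⟨h0, h1, -⟩
    obtain ⟨t, t0, t1, e1, e2⟩ := mem_segment_iff_exists_coord.1 hx
    obtain ⟨A1, A2⟩ := A x t e1 e2
    rw [A1, A2] at h1
    have : areaForm a b e / dotForm a b e * (t * dotForm a b e) = t * areaForm a b e := by
      have := hc.2.ne'
      field_simp
    linarith
  · refine ⟨1, one_pos, ?_⟩
    rintro x hx ⟨h0, h1, -⟩
    obtain ⟨t, t0, t1, e1, e2⟩ := mem_segment_iff_exists_coord.1 hx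
    obtain ⟨A1, A2⟩ := A x t e1 e2
    rw [A1] at h0
    rw [A1, A2, one_mul] at h1
    exact hc ⟨pos_of_mul_pos_right h0 t0, pos_of_mul_pos_right (h0.trans h1) t0⟩

theorem exists_disjoint_leftStrip_of_right (a b e : ℝ × ℝ) :
    ∃ δ > 0, ∀ x ∈ segment ℝ b e, x ∉ leftStrip a b δ := by
  have A : ∀ (x : ℝ × ℝ) (t : ℝ), x.1 = b.1 + t * (e.1 - b.1) → x.2 = b.2 + t * (e.2 - b.2) →
      areaForm a b x = t * areaForm a b e ∧ dotForm b a x = t * dotForm b a e := by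
    intro x t h1 h2
    simp only [areaForm, dotForm, h1, h2]
    constructor <;> ring
  by_cases hc : 0 < areaForm a b e ∧ 0 < dotForm b a e
  · refine ⟨areaForm a b e / dotForm b a e, div_pos hc.1 hc.2, ?_⟩
    rintro x hx ⟨h0, -, h1⟩
    obtain ⟨t, t0, t1, e1, e2⟩ := mem_segment_iff_exists_coord.1 hx
    obtain ⟨A1, A2⟩ := A x t e1 e2
    rw [A1, A2] at h1
    have : areaForm a b e / dotForm b a e * (t * dotForm b a e) = t * areaForm a b e := by
      have := hc.2.ne'
      field_simp
    linarith
  · refine ⟨1, one_pos, ?_⟩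
    rintro x hx ⟨h0, -, h1⟩
    obtain ⟨t, t0, t1, e1, e2⟩ := mem_segment_iff_exists_coord.1 hx
    obtain ⟨A1, A2⟩ := A x t e1 e2
    rw [A1] at h0
    rw [A1, A2, one_mul] at h1
    exact hc ⟨pos_of_mul_pos_right h0 t0, pos_of_mul_pos_right (h0.trans h1) t0⟩

theorem continuous_areaForm (a b : ℝ × ℝ) : Continuous (areaForm a b) := by
  unfold areaForm; fun_prop

theorem continuous_dotForm (a b : ℝ × ℝ) : Continuous (dotForm a b) := by
  unfold dotForm; fun_prop

theorem exists_disjoint_leftStrip_of_notMem {a b x : ℝ × ℝ} (hab : a ≠ b)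
    (hx : x ∉ segment ℝ a b) : ∃ t ∈ 𝓝 x, ∃ δ > 0, ∀ y ∈ t, y ∉ leftStrip a b δ := by
  have hA := continuous_areaForm a b
  have hP := continuous_dotForm a b
  have hQ := continuous_dotForm b a
  rcases lt_trichotomy (areaForm a b x) 0 with h | h | h
  · refine ⟨{y | areaForm a b y < 0}, (isOpen_lt hA continuous_const).mem_nhds h, 1, one_pos, ?_⟩
    rintro y hy ⟨h0, -, -⟩
    exact lt_asymm hy h0
  · by_cases h1 : dotForm a b x < 0
    · refine ⟨{y | dotForm a b y < 0}, (isOpen_lt hP continuous_const).mem_nhds h1, 1, one_pos, ?_⟩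
      rintro y hy ⟨h0, h2, -⟩
      have hy : dotForm a b y < 0 := hy
      linarith
    by_cases h2 : dotForm b a x < 0
    · refine ⟨{y | dotForm b a y < 0}, (isOpen_lt hQ continuous_const).mem_nhds h2, 1, one_pos, ?_⟩
      rintro y hy ⟨h0, -, h2⟩
      have hy : dotForm b a y < 0 := hy
      linarith
    -- A point on the line with both inner products nonnegative lies on the segment.
    exfalso
    have hd := sq_dist_pos hab
    set N := (b.1 - a.1) ^ 2 + (b.2 - a.2) ^ 2 with hN
    have hsum : dotForm a b x + dotForm b a x = N := by simp only [dotForm, hN]; ring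
    refine hx (mem_segment_iff_exists_coord.2 ⟨dotForm a b x / N, ?_, ?_, ?_, ?_⟩)
    · exact div_nonneg (not_lt.1 h1) hd.le
    · rw [div_le_one hd]; linarith
    · have : x.1 - a.1 = dotForm a b x / N * (b.1 - a.1) := by
        rw [div_mul_eq_mul_div, eq_div_iff hd.ne']
        simp only [areaForm, dotForm, hN] at *
        linear_combination (-(b.2 - a.2)) * h
      linarith
    · have : x.2 - a.2 = dotForm a b x / N * (b.2 - a.2) := by
        rw [div_mul_eq_mul_div, eq_div_iff hd.ne']
        simp only [areaForm, dotForm, hN] at *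
        linear_combination (b.1 - a.1) * h
      linarith
  -- Near `x` the area stays above half its value and the inner product stays bounded, so the strip
  -- of that ratio is missed.
  · have hM : 0 < |dotForm a b x| + 1 := by positivity
    refine ⟨{y | areaForm a b x / 2 < areaForm a b y} ∩ {y | dotForm a b y < |dotForm a b x| + 1},
      inter_mem ((isOpen_lt continuous_const hA).mem_nhds (half_lt_self h))
        ((isOpen_lt hP continuous_const).mem_nhds ?_),
      areaForm a b x / 2 / (|dotForm a b x| + 1), by positivity, ?_⟩
    · change dotForm a b x < _
      linarith [le_abs_self (dotForm a b x)]
    · rintro y ⟨hy1, hy2⟩ ⟨h0, h1, -⟩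
      have hy1 : areaForm a b x / 2 < areaForm a b y := hy1
      have hy2 : dotForm a b y < |dotForm a b x| + 1 := hy2
      have h3 : areaForm a b x / 2 / (|dotForm a b x| + 1) * dotForm a b y ≤
          areaForm a b x / 2 / (|dotForm a b x| + 1) * (|dotForm a b x| + 1) :=
        mul_le_mul_of_nonneg_left hy2.le (by positivity)
      rw [div_mul_cancel₀ _ hM.ne'] at h3
      linarith

/-- If an end of `a b` lies on `c e`, it is an end of both segments and their directions there
decide. Otherwise the segments are disjoint, and compactness of `c e` makes the local choices of `δ`
uniform. -/
theorem eventually_disjoint_leftStrip {a b c e : ℝ × ℝ} (hab : a ≠ b)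
    (h : ∀ x ∈ segment ℝ a b, x ∈ segment ℝ c e → (x = a ∨ x = b) ∧ (x = c ∨ x = e)) :
    ∀ᶠ δ in 𝓝[>] (0 : ℝ), ∀ x ∈ segment ℝ c e, x ∉ leftStrip a b δ := by
  suffices H : ∃ δ > 0, ∀ x ∈ segment ℝ c e, x ∉ leftStrip a b δ by
    obtain ⟨δ, hδ, H⟩ := H
    filter_upwards [Ioo_mem_nhdsGT hδ] with δ' hδ' x hx hx'
    exact H x hx (leftStrip_mono hδ'.1 hδ'.2.le hx')
  by_cases ha : a ∈ segment ℝ c e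
  · rcases (h a (left_mem_segment ..) ha).2 with rfl | rfl
    · exact exists_disjoint_leftStrip_of_left _ _ _
    · rw [segment_symm]; exact exists_disjoint_leftStrip_of_left _ _ _
  by_cases hb : b ∈ segment ℝ c e
  · rcases (h b (right_mem_segment ..) hb).2 with rfl | rfl
    · exact exists_disjoint_leftStrip_of_right _ _ _
    · rw [segment_symm]; exact exists_disjoint_leftStrip_of_right _ _ _
  have hcomp : IsCompact (segment ℝ c e) := by
    rw [segment_eq_image']
    exact isCompact_Icc.image (by fun_prop)
  refine hcomp.induction_on (p := fun s => ∃ δ > 0, ∀ x ∈ s, x ∉ leftStrip a b δ)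
    ⟨1, one_pos, by simp⟩ ?_ ?_ ?_
  · rintro s t hst ⟨δ, hδ, H⟩
    exact ⟨δ, hδ, fun x hx => H x (hst hx)⟩
  · rintro s t ⟨δ, hδ, H⟩ ⟨δ', hδ', H'⟩
    refine ⟨min δ δ', lt_min hδ hδ', ?_⟩
    rintro x (hx | hx) hx'
    · exact H x hx (leftStrip_mono (lt_min hδ hδ') (min_le_left _ _) hx')
    · exact H' x hx (leftStrip_mono (lt_min hδ hδ') (min_le_right _ _) hx')
  · intro x hx
    have hxab : x ∉ segment ℝ a b := fun hx' => by
      rcases (h x hx' hx).1 with rfl | rfl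
      · exact ha hx
      · exact hb hx
    obtain ⟨t, ht, δ, hδ, H⟩ := exists_disjoint_leftStrip_of_notMem hab hxab
    exact ⟨t, mem_nhdsWithin_of_mem_nhds ht, δ, hδ, H⟩

/-! ### Arrangements of segments and locally constant functions -/

/-- A finite set of directed non-vertical segments, closed under reversal, any two of which meet at
most in common end points. -/
structure PlaneSegments (S : Set ((ℝ × ℝ) × (ℝ × ℝ))) : Prop where
  finite : S.Finite
  symm : ∀ a b, (a, b) ∈ S → (b, a) ∈ S
  ne : ∀ a b, (a, b) ∈ S → a.1 ≠ b.1
  meet : ∀ a b c e, (a, b) ∈ S → (c, e) ∈ S → ∀ x ∈ segment ℝ a b, x ∈ segment ℝ c e →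
    (c = a ∧ e = b) ∨ (c = b ∧ e = a) ∨ ((x = a ∨ x = b) ∧ (x = c ∨ x = e))

/-- The function `w` takes the value `z` near the left side of the segment from `a` to `b`. -/
def IsLeftValue (w : ℝ × ℝ → ZMod 2) (a b : ℝ × ℝ) (z : ZMod 2) : Prop :=
  ∃ δ > 0, ∀ x ∈ leftStrip a b δ, w x = z

/-- The function `w` is locally constant off the segments in `S`. -/
def LocallyConstantOff (w : ℝ × ℝ → ZMod 2) (S : Set ((ℝ × ℝ) × (ℝ × ℝ))) : Prop :=
  ∀ x₀, (∀ a b, (a, b) ∈ S → x₀ ∉ segment ℝ a b) → ∀ᶠ x in 𝓝 x₀, w x = w x₀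

theorem LocallyConstantOff.eq_of_isPreconnected {w : ℝ × ℝ → ZMod 2}
    {S : Set ((ℝ × ℝ) × (ℝ × ℝ))} (hw : LocallyConstantOff w S) {U : Set (ℝ × ℝ)}
    (hU : IsPreconnected U) (hUS : ∀ x ∈ U, ∀ a b, (a, b) ∈ S → x ∉ segment ℝ a b)
    {x y : ℝ × ℝ} (hx : x ∈ U) (hy : y ∈ U) : w x = w y := by
  refine hU.constant_of_mapsTo (T := univ) ⟨inferInstance⟩ (f := w) ?_ (mapsTo_univ _ _) hx hy
  intro z hz
  refine ContinuousAt.continuousWithinAt ?_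
  exact continuousAt_const.congr (EventuallyEq.symm (hw z (hUS z hz)))

theorem PlaneSegments.eventually_leftStrip {S : Set ((ℝ × ℝ) × (ℝ × ℝ))} (hS : PlaneSegments S)
    {a b : ℝ × ℝ} (hab : (a, b) ∈ S) :
    ∀ᶠ δ in 𝓝[>] (0 : ℝ), ∀ x ∈ leftStrip a b δ, ∀ c e, (c, e) ∈ S → x ∉ segment ℝ c e := by
  have hne : a ≠ b := fun h => hS.ne a b hab (by rw [h])
  have : ∀ s ∈ S, ∀ᶠ δ in 𝓝[>] (0 : ℝ), ∀ x ∈ segment ℝ s.1 s.2, x ∉ leftStrip a b δ := by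
    rintro ⟨c, e⟩ hce
    by_cases h1 : c = a ∧ e = b
    · refine Eventually.of_forall ?_
      rintro δ x hx ⟨h0, -, -⟩
      obtain ⟨rfl, rfl⟩ := h1
      exact h0.ne' (areaForm_eq_zero_of_mem_segment hx)
    by_cases h2 : c = b ∧ e = a
    · refine Eventually.of_forall ?_
      rintro δ x hx ⟨h0, -, -⟩
      obtain ⟨rfl, rfl⟩ := h2
      exact h0.ne' (areaForm_eq_zero_of_mem_segment (segment_symm ℝ c e ▸ hx))
    refine eventually_disjoint_leftStrip hne fun x hx hx' => ?_
    rcases hS.meet a b c e hab hce x hx hx' with h | h | h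
    · exact absurd h h1
    · exact absurd h h2
    · exact h
  have := (eventually_all_finite hS.finite).2 this
  filter_upwards [this] with δ hδ x hx c e hce hx'
  exact hδ (c, e) hce x hx' hx

/-- A thin enough strip is convex and meets no segment of `S`, so `w` is constant on it. -/
theorem PlaneSegments.exists_isLeftValue {S : Set ((ℝ × ℝ) × (ℝ × ℝ))} (hS : PlaneSegments S)
    {w : ℝ × ℝ → ZMod 2} (hw : LocallyConstantOff w S) {a b : ℝ × ℝ} (hab : (a, b) ∈ S) :
    ∃ z, IsLeftValue w a b z := by
  have hne : a ≠ b := fun h => hS.ne a b hab (by rw [h])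
  obtain ⟨δ, h, hδ⟩ := ((hS.eventually_leftStrip hab).and self_mem_nhdsWithin).exists
  obtain ⟨x, hx⟩ := leftStrip_nonempty hne hδ
  exact ⟨w x, δ, hδ, fun y hy =>
    hw.eq_of_isPreconnected (convex_leftStrip a b δ).isPreconnected h hy hx⟩

/-- The point with polar coordinates `r`, `θ` around `p`. -/
noncomputable def polarPoint (p : ℝ × ℝ) (θ r : ℝ) : ℝ × ℝ :=
  (p.1 + r * Real.cos θ, p.2 + r * Real.sin θ)

theorem polarPoint_add_two_pi (p : ℝ × ℝ) (θ r : ℝ) (k : ℤ) :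
    polarPoint p (θ + 2 * Real.pi * k) r = polarPoint p θ r := by
  have : θ + 2 * Real.pi * k = θ + k * (2 * Real.pi) := by ring
  simp only [polarPoint, this, Real.cos_add_int_mul_two_pi, Real.sin_add_int_mul_two_pi]

/-- The three final inequalities are the strip conditions in polar coordinates around an end of a
segment of length `ρ`; they find a point of the strip inside a given sector, arbitrarily close to
its apex. -/
theorem exists_mem_leftStrip_aux {α β ρ δ ε : ℝ} (hαβ : α < β) (hρ : 0 < ρ) (hδ : 0 < δ)
    (hε : 0 < ε) :
    ∃ η r : ℝ, 0 < η ∧ η < β - α ∧ 0 < r ∧ r < ε ∧ 0 < ρ * r * Real.sin η ∧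
      ρ * r * Real.sin η < δ * (ρ * r * Real.cos η) ∧
      ρ * r * Real.sin η < δ * (ρ ^ 2 - ρ * r * Real.cos η) := by
  have h1 : ∀ᶠ η in 𝓝[>] (0 : ℝ), Real.sin η < δ * Real.cos η := by
    refine nhdsWithin_le_nhds ?_
    refine (isOpen_lt (f := Real.sin) (g := fun η => δ * Real.cos η)
      (by fun_prop) (by fun_prop)).mem_nhds ?_
    simpa using hδ
  obtain ⟨η, ⟨h1, hη, hη'⟩⟩ := (h1.and (Ioo_mem_nhdsGT
    (show (0 : ℝ) < min (β - α) Real.pi from lt_min (sub_pos.2 hαβ) Real.pi_pos))).exists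
  have hsin : 0 < Real.sin η := Real.sin_pos_of_pos_of_lt_pi hη (hη'.trans_le (min_le_right _ _))
  have h2 : ∀ᶠ r in 𝓝[>] (0 : ℝ), ρ * r * Real.sin η < δ * (ρ ^ 2 - ρ * r * Real.cos η) := by
    refine nhdsWithin_le_nhds ?_
    refine (isOpen_lt (f := fun r => ρ * r * Real.sin η)
      (g := fun r => δ * (ρ ^ 2 - ρ * r * Real.cos η)) (by fun_prop) (by fun_prop)).mem_nhds ?_
    simp only [mem_ofPred_eq, mul_zero, zero_mul, sub_zero]
    positivity
  obtain ⟨r, h2, hr, hr'⟩ := (h2.and (Ioo_mem_nhdsGT hε)).exists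
  have hρr : 0 < ρ * r := mul_pos hρ hr
  refine ⟨η, r, hη, hη'.trans_le (min_le_left _ _), hr, hr', mul_pos hρr hsin, ?_, h2⟩
  have := mul_lt_mul_of_pos_left h1 hρr
  linarith

/-- A small open sector at `p`, counterclockwise from the ray to `c` up to the ray to `a`, is
connected and free of segments. It meets the left strip of `p c` near its first ray and that of `a
p` near its last. -/
theorem PlaneSegments.isLeftValue_eq_of_sector {S : Set ((ℝ × ℝ) × (ℝ × ℝ))}
    (hS : PlaneSegments S) {w : ℝ × ℝ → ZMod 2} (hw : LocallyConstantOff w S)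
    {p a c : ℝ × ℝ} {α β ρ ρ' : ℝ} {z z' : ZMod 2} (hpc : (p, c) ∈ S)
    (hρ : 0 < ρ) (hρ' : 0 < ρ') (hαβ : α < β) (hc : c = polarPoint p α ρ)
    (ha : a = polarPoint p β ρ')
    (hfree : ∀ q, (p, q) ∈ S → ∀ θ, α < θ → θ < β → ∀ r > 0, q ≠ polarPoint p θ r)
    (hz : IsLeftValue w a p z) (hz' : IsLeftValue w p c z') : z = z' := by
  -- Near `p` only the segments through `p` matter.
  have hev : ∀ᶠ x in 𝓝 p, ∀ s ∈ S, p ∉ segment ℝ s.1 s.2 → x ∉ segment ℝ s.1 s.2 := by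
    refine (eventually_all_finite hS.finite).2 fun s _ => ?_
    by_cases hp : p ∈ segment ℝ s.1 s.2
    · exact Eventually.of_forall fun x h => absurd hp h
    · have hcl : IsClosed (segment ℝ s.1 s.2) := by
        rw [segment_eq_image']
        exact (isCompact_Icc.image (by fun_prop)).isClosed
      filter_upwards [hcl.isOpen_compl.mem_nhds hp] with x hx _ using hx
  obtain ⟨ε, hε, hball⟩ := Metric.eventually_nhds_iff.1 hev
  let U : Set (ℝ × ℝ) := (fun q : ℝ × ℝ => polarPoint p q.2 q.1) '' (Ioo 0 ε ×ˢ Ioo α β)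
  have hU : IsPreconnected U := by
    refine ((convex_Ioo 0 ε).prod (convex_Ioo α β)).isPreconnected.image _ ?_
    unfold polarPoint
    fun_prop
  have hUS : ∀ x ∈ U, ∀ q q', (q, q') ∈ S → x ∉ segment ℝ q q' := by
    rintro _ ⟨⟨r, θ⟩, ⟨⟨hr0, hrε⟩, hθα, hθβ⟩, rfl⟩ q q' hqq
    have hray : ∀ q, (p, q) ∈ S → polarPoint p θ r ∉ segment ℝ p q := by
      intro q hq hmem
      obtain ⟨t, t0, t1, e1, e2⟩ := mem_segment_iff_exists_coord.1 hmem
      have ht : t ≠ 0 := by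
        rintro rfl
        simp only [polarPoint, zero_mul, add_zero, add_eq_left, mul_eq_zero] at e1 e2
        have h1 := e1.resolve_left hr0.ne'
        have h2 := e2.resolve_left hr0.ne'
        have := Real.sin_sq_add_cos_sq θ
        rw [h1, h2] at this
        norm_num at this
      have ht' : 0 < t := lt_of_le_of_ne t0 ht.symm
      refine hfree q hq θ hθα hθβ (r / t) (div_pos hr0 ht') (Prod.ext ?_ ?_)
      · simp only [polarPoint] at e1 ⊢
        field_simp
        linarith
      · simp only [polarPoint] at e2 ⊢
        field_simp
        linarith
    by_cases hp : p ∈ segment ℝ q q'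
    -- By `hS.meet` with `p c`, a segment through `p` has `p` as an end, so it runs along a ray
    -- excluded by `hfree`.
    · have : p = q ∨ p = q' := by
        rcases hS.meet p c q q' hpc hqq p (left_mem_segment ..) hp with h | h | h
        · exact Or.inl h.1.symm
        · exact Or.inr h.2.symm
        · exact h.2
      rcases this with rfl | rfl
      · exact hray _ hqq
      · rw [segment_symm]
        exact hray _ (hS.symm _ _ hqq)
    · refine hball ?_ (q, q') hqq hp
      refine lt_of_le_of_lt ?_ hrε
      rw [Prod.dist_eq]
      simp only [polarPoint, Real.dist_eq, add_sub_cancel_left, abs_mul, abs_of_pos hr0]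
      refine max_le ?_ ?_
      · nlinarith [Real.abs_cos_le_one θ]
      · nlinarith [Real.abs_sin_le_one θ]
  obtain ⟨δ, hδ, H⟩ := hz
  obtain ⟨δ', hδ', H'⟩ := hz'
  obtain ⟨η, r, hη, hηβ, hr, hrε, k0, k1, k2⟩ := exists_mem_leftStrip_aux hαβ hρ' hδ hε
  obtain ⟨η', r', hη', hηβ', hr', hrε', k0', k1', k2'⟩ := exists_mem_leftStrip_aux hαβ hρ hδ' hε
  have hx : polarPoint p (β - η) r ∈ U :=
    ⟨(r, β - η), ⟨⟨hr, hrε⟩, by linarith, by linarith⟩, rfl⟩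
  have hx' : polarPoint p (α + η') r' ∈ U :=
    ⟨(r', α + η'), ⟨⟨hr', hrε'⟩, by linarith, by linarith⟩, rfl⟩
  have hxs : polarPoint p (β - η) r ∈ leftStrip a p δ := by
    have t := Real.sin_sq_add_cos_sq β
    have A : areaForm a p (polarPoint p (β - η) r) = ρ' * r * Real.sin η := by
      simp only [areaForm, polarPoint, ha, Real.sin_sub, Real.cos_sub]
      linear_combination (ρ' * r * Real.sin η) * t
    have B : dotForm p a (polarPoint p (β - η) r) = ρ' * r * Real.cos η := by
      simp only [dotForm, polarPoint, ha, Real.sin_sub, Real.cos_sub]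
      linear_combination (ρ' * r * Real.cos η) * t
    have C : dotForm a p (polarPoint p (β - η) r) = ρ' ^ 2 - ρ' * r * Real.cos η := by
      simp only [dotForm, polarPoint, ha, Real.sin_sub, Real.cos_sub]
      linear_combination (ρ' ^ 2 - ρ' * r * Real.cos η) * t
    exact ⟨by rw [A]; exact k0, by rw [A, C]; exact k2, by rw [A, B]; exact k1⟩
  have hxs' : polarPoint p (α + η') r' ∈ leftStrip p c δ' := by
    have t := Real.sin_sq_add_cos_sq α
    have A : areaForm p c (polarPoint p (α + η') r') = ρ * r' * Real.sin η' := by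
      simp only [areaForm, polarPoint, hc, Real.sin_add, Real.cos_add]
      linear_combination (ρ * r' * Real.sin η') * t
    have B : dotForm p c (polarPoint p (α + η') r') = ρ * r' * Real.cos η' := by
      simp only [dotForm, polarPoint, hc, Real.sin_add, Real.cos_add]
      linear_combination (ρ * r' * Real.cos η') * t
    have C : dotForm c p (polarPoint p (α + η') r') = ρ ^ 2 - ρ * r' * Real.cos η' := by
      simp only [dotForm, polarPoint, hc, Real.sin_add, Real.cos_add]
      linear_combination (ρ ^ 2 - ρ * r' * Real.cos η') * t
    exact ⟨by rw [A]; exact k0', by rw [A, B]; exact k1', by rw [A, C]; exact k2'⟩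
  rw [← H _ hxs, ← H' _ hxs']
  exact hw.eq_of_isPreconnected (hx := hx) (hy := hx') hU hUS

/-- The cyclic successor for finitely many angles. -/
theorem exists_cyclic_successor {X : Type*} [Finite X] (θ : X → ℝ) (hθ : Function.Injective θ)
    {τ : ℝ} (hτ : ∀ x y, θ x < θ y + τ) :
    ∃ σ : Equiv.Perm X,
      (∀ x y, y ≠ x → σ x ≠ x) ∧
      (∀ x y z, y ≠ x → z ≠ x → z ≠ y → σ (σ x) ≠ x) ∧
      ∀ x, ∃ k : ℤ, θ x < θ (σ x) + τ * k ∧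
        ∀ y, ∀ j : ℤ, θ x < θ y + τ * j → θ (σ x) + τ * k ≤ θ y + τ * j := by
  classical
  have := Fintype.ofFinite X
  -- The next larger value, or the minimum when `x` is already the maximum.
  let R : X → X → Prop := fun x z =>
    (θ x < θ z ∧ ∀ y, θ x < θ y → θ z ≤ θ y) ∨ ((∀ y, θ y ≤ θ x) ∧ ∀ y, θ z ≤ θ y)
  have hex : ∀ x, ∃ z, R x z := by
    intro x
    by_cases h : ∃ y, θ x < θ y
    · obtain ⟨z, hz, hmin⟩ := Finset.exists_min_image (Finset.univ.filter fun y => θ x < θ y) θ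
        (by obtain ⟨y, hy⟩ := h; exact ⟨y, by simpa using hy⟩)
      exact ⟨z, Or.inl ⟨by simpa using hz, fun y hy => hmin y (by simpa using hy)⟩⟩
    · push Not at h
      obtain ⟨z, -, hmin⟩ := Finset.exists_min_image (Finset.univ : Finset X) θ ⟨x, by simp⟩
      exact ⟨z, Or.inr ⟨h, fun y => hmin y (by simp)⟩⟩
  choose f hf using hex
  have hinj : Function.Injective f := by
    intro x y hxy
    have h1 := hf x
    have h2 := hf y
    rw [← hxy] at h2
    apply hθ
    rcases h1 with ⟨a, b⟩ | ⟨a, b⟩ <;> rcases h2 with ⟨c, e⟩ | ⟨c, e⟩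
    · rcases lt_trichotomy (θ x) (θ y) with h | h | h
      · exact absurd (b y h) (not_le.2 c)
      · exact h
      · exact absurd (e x h) (not_le.2 a)
    · exact absurd (e x) (not_le.2 a)
    · exact absurd (b y) (not_le.2 c)
    · exact le_antisymm (c x) (a y)
  let σ : Equiv.Perm X := Equiv.ofBijective f (Finite.injective_iff_bijective.1 hinj)
  have hτ0 : ∀ x : X, 0 < τ := fun x => by have := hτ x x; linarith
  refine ⟨σ, ?_, ?_, ?_⟩
  · intro x y hyx h
    change f x = x at h
    have h1 := hf x
    rw [h] at h1
    rcases h1 with ⟨a, -⟩ | ⟨a, b⟩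
    · exact lt_irrefl _ a
    · exact hyx (hθ (le_antisymm (a y) (b y)))
  · intro x y z hyx hzx hzy h
    change f (f x) = x at h
    have h1 := hf x
    have h2 := hf (f x)
    rw [h] at h2
    set u := f x
    -- An orbit of length two of the successor leaves no room for a third angle.
    have key : ∀ v, v = x ∨ v = u := by
      intro v
      rcases h1 with ⟨a, b⟩ | ⟨a, b⟩ <;> rcases h2 with ⟨c, e⟩ | ⟨c, e⟩
      · exact absurd a (not_lt.2 c.le)
      · rcases (e v).lt_or_eq with h | h
        · exact Or.inr (hθ (le_antisymm (c v) (b v h)))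
        · exact Or.inl (hθ h.symm)
      · rcases (b v).lt_or_eq with h | h
        · exact Or.inl (hθ (le_antisymm (a v) (e v h)))
        · exact Or.inr (hθ h.symm)
      · exact Or.inl (hθ (le_antisymm (a v) (e v)))
    rcases key y with rfl | rfl
    · exact hyx rfl
    · rcases key z with rfl | rfl
      · exact hzx rfl
      · exact hzy rfl
  · intro x
    have hσ : σ x = f x := rfl
    rw [hσ]
    have h0 := hτ0 x
    have cast1 : ∀ j : ℤ, 1 ≤ j → τ ≤ τ * j := by
      intro j hj
      have : (1 : ℝ) ≤ j := by exact_mod_cast hj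
      nlinarith
    have cast2 : ∀ j : ℤ, j ≤ -1 → τ * j ≤ -τ := by
      intro j hj
      have : (j : ℝ) ≤ -1 := by exact_mod_cast hj
      nlinarith
    rcases hf x with ⟨a, b⟩ | ⟨a, b⟩
    · refine ⟨0, by simpa using a, fun y j hj => ?_⟩
      rcases lt_trichotomy j 0 with h | rfl | h
      · have := cast2 j (by omega)
        have := hτ y x
        linarith
      · simp only [Int.cast_zero, mul_zero, add_zero] at hj ⊢
        exact b y hj
      · have := cast1 j (by omega)
        have := hτ (f x) y
        push_cast
        linarith
    -- From the maximum the successor is reached after one full period.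
    · refine ⟨1, by have := hτ x (f x); push_cast; linarith, fun y j hj => ?_⟩
      rcases le_or_gt j 0 with h | h
      · have : τ * j ≤ 0 := by
          have : (j : ℝ) ≤ 0 := by exact_mod_cast h
          nlinarith
        have := a y
        linarith
      · have := cast1 j (by omega)
        have := b y
        push_cast
        linarith

/-- The angle at which `q` is seen from `p`. -/
noncomputable def angleFrom (p q : ℝ × ℝ) : ℝ := Complex.arg ⟨q.1 - p.1, q.2 - p.2⟩

theorem exists_eq_polarPoint {p q : ℝ × ℝ} (h : p ≠ q) :
    ∃ ρ > 0, q = polarPoint p (angleFrom p q) ρ := by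
  refine ⟨‖(⟨q.1 - p.1, q.2 - p.2⟩ : ℂ)‖, ?_, ?_⟩
  · rw [gt_iff_lt, norm_pos_iff]
    intro h0
    have h1 := congrArg Complex.re h0
    have h2 := congrArg Complex.im h0
    simp only [Complex.zero_re, Complex.zero_im] at h1 h2
    exact h (Prod.ext (by linarith) (by linarith))
  · refine Prod.ext ?_ ?_
    · simp [polarPoint, angleFrom, Complex.norm_mul_cos_arg]
    · simp [polarPoint, angleFrom, Complex.norm_mul_sin_arg]

theorem exists_angle_eq_of_polarPoint_eq {p : ℝ × ℝ} {θ θ' r r' : ℝ} (hr : 0 < r) (hr' : 0 < r')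
    (h : polarPoint p θ r = polarPoint p θ' r') : ∃ k : ℤ, θ = θ' + 2 * Real.pi * k := by
  have h1 : r * Real.cos θ = r' * Real.cos θ' := by
    have := congrArg Prod.fst h; simpa [polarPoint] using this
  have h2 : r * Real.sin θ = r' * Real.sin θ' := by
    have := congrArg Prod.snd h; simpa [polarPoint] using this
  have e : r ^ 2 = r' ^ 2 := by
    have t := Real.sin_sq_add_cos_sq θ
    have t' := Real.sin_sq_add_cos_sq θ'
    calc r ^ 2 = (r * Real.sin θ) ^ 2 + (r * Real.cos θ) ^ 2 := by
          linear_combination (-r ^ 2) * t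
      _ = r' ^ 2 := by rw [h1, h2]; linear_combination (r' ^ 2) * t'
  have e' : r = r' := by nlinarith
  subst e'
  have h1 := mul_left_cancel₀ hr.ne' h1
  have h2 := mul_left_cancel₀ hr.ne' h2
  have := (Real.Angle.angle_eq_iff_two_pi_dvd_sub).1 (Real.Angle.cos_sin_inj h1 h2)
  obtain ⟨k, hk⟩ := this
  exact ⟨k, by linarith⟩

/-- Of two segments leaving `p` in the same direction the shorter is contained in the longer, so its
far end would be an interior point of the other. -/
theorem PlaneSegments.angleFrom_injective {S : Set ((ℝ × ℝ) × (ℝ × ℝ))} (hS : PlaneSegments S)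
    {p q q' : ℝ × ℝ} (hq : (p, q) ∈ S) (hq' : (p, q') ∈ S)
    (h : angleFrom p q = angleFrom p q') : q = q' := by
  have main : ∀ q q' : ℝ × ℝ, (p, q) ∈ S → (p, q') ∈ S → ∀ θ ρ ρ' : ℝ, 0 < ρ → ρ ≤ ρ' →
      q = polarPoint p θ ρ → q' = polarPoint p θ ρ' → q = q' := by
    intro q q' hq hq' θ ρ ρ' hρ hρρ e e'
    have hmem : q ∈ segment ℝ p q' := by
      have hρ' : 0 < ρ' := hρ.trans_le hρρ
      refine mem_segment_iff_exists_coord.2 ⟨ρ / ρ', by positivity, (div_le_one hρ').2 hρρ, ?_, ?_⟩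
      · simp only [e, e', polarPoint]; field_simp; ring
      · simp only [e, e', polarPoint]; field_simp; ring
    have hne : ∀ {q}, (p, q) ∈ S → p ≠ q := fun hq h0 => hS.ne _ _ hq (by rw [h0])
    rcases hS.meet p q p q' hq hq' q (right_mem_segment ..) hmem with h | h | h
    · exact h.2.symm
    · exact absurd h.1 (hne hq)
    · exact h.2.resolve_left (hne hq).symm
  have hne : ∀ {q}, (p, q) ∈ S → p ≠ q := fun hq h0 => hS.ne _ _ hq (by rw [h0])
  obtain ⟨ρ, hρ, e⟩ := exists_eq_polarPoint (hne hq)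
  obtain ⟨ρ', hρ', e'⟩ := exists_eq_polarPoint (hne hq')
  rw [← h] at e'
  rcases le_total ρ ρ' with hl | hl
  · exact main q q' hq hq' _ _ _ hρ hl e e'
  · exact (main q' q hq' hq _ _ _ hρ' hl e' e).symm

/-- The rotation at a point of a plane straight-line drawing. -/
theorem PlaneSegments.exists_rotation {S : Set ((ℝ × ℝ) × (ℝ × ℝ))} (hS : PlaneSegments S)
    (p : ℝ × ℝ) :
    ∃ σ : Equiv.Perm {q // (p, q) ∈ S},
      (∀ x y, y ≠ x → σ x ≠ x) ∧
      (∀ x y z, y ≠ x → z ≠ x → z ≠ y → σ (σ x) ≠ x) ∧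
      ∀ w, LocallyConstantOff w S → ∀ x z z', IsLeftValue w (σ x).1 p z →
        IsLeftValue w p x.1 z' → z = z' := by
  have : Finite {q // (p, q) ∈ S} :=
    (hS.finite.preimage (f := fun q => (p, q)) (by intro a _ b _ h; simpa using h)).to_subtype
  obtain ⟨σ, h1, h2, h3⟩ := exists_cyclic_successor
    (fun q : {q // (p, q) ∈ S} => angleFrom p q.1)
    (fun x y h => Subtype.ext (hS.angleFrom_injective x.2 y.2 h)) (τ := 2 * Real.pi) (by
      intro x y
      have := Complex.arg_le_pi ⟨x.1.1 - p.1, x.1.2 - p.2⟩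
      have := Complex.neg_pi_lt_arg ⟨y.1.1 - p.1, y.1.2 - p.2⟩
      simp only [angleFrom]
      linarith)
  refine ⟨σ, h1, h2, ?_⟩
  intro w hw x z z' hz hz'
  have hne : ∀ {q}, (p, q) ∈ S → p ≠ q := fun hq h0 => hS.ne _ _ hq (by rw [h0])
  obtain ⟨k, hk, hmin⟩ := h3 x
  obtain ⟨ρ, hρ, e⟩ := exists_eq_polarPoint (hne x.2)
  obtain ⟨ρ', hρ', e'⟩ := exists_eq_polarPoint (hne (σ x).2)
  -- The angle of the successor is lifted by `k` turns so that it exceeds the angle of `x`;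
  -- minimality over all lifts makes the sector between them empty.
  rw [← polarPoint_add_two_pi _ _ _ k] at e'
  refine hS.isLeftValue_eq_of_sector hw x.2 hρ hρ' hk e e' ?_ hz hz'
  intro q hq θ hθ hθ' r hr hqr
  obtain ⟨s, hs, e''⟩ := exists_eq_polarPoint (hne hq)
  obtain ⟨j, hj⟩ := exists_angle_eq_of_polarPoint_eq hr hs (hqr.symm.trans e'')
  rw [hj] at hθ hθ'
  exact hθ'.not_ge (hmin ⟨q, hq⟩ j hθ)

/-! ### Parity of crossings with a vertical ray -/

/-- The number, modulo two, of crossings of the upward ray from `x` with the segment `a b`. -/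
noncomputable def crossing (a b x : ℝ × ℝ) : ZMod 2 :=
  open Classical in
  -- The left end counts and the right end does not, so that rays through a common end of two
  -- segments are treated consistently.
  if (a.1 ≤ x.1 ∧ x.1 < b.1 ∧ areaForm a b x < 0) ∨
    (b.1 ≤ x.1 ∧ x.1 < a.1 ∧ areaForm b a x < 0) then 1 else 0

/-- The indicator of `p` lying straight above `x`. -/
noncomputable def isAbove (x p : ℝ × ℝ) : ZMod 2 :=
  open Classical in if p.1 = x.1 ∧ x.2 < p.2 then 1 else 0

theorem crossing_comm (a b x : ℝ × ℝ) : crossing a b x = crossing b a x := by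
  unfold crossing
  exact if_congr or_comm rfl rfl

theorem crossing_of_lt {a b : ℝ × ℝ} (h : a.1 < b.1) (x : ℝ × ℝ) :
    crossing a b x = open Classical in
      if a.1 ≤ x.1 ∧ x.1 < b.1 ∧ areaForm a b x < 0 then 1 else 0 := by
  unfold crossing
  have : ¬ (b.1 ≤ x.1 ∧ x.1 < a.1 ∧ areaForm b a x < 0) := fun h' => by linarith [h'.1, h'.2.1]
  simp only [this, or_false]

theorem mem_segment_of_areaForm_eq_zero {a b x : ℝ × ℝ} (h : a.1 < b.1) (h1 : a.1 ≤ x.1)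
    (h2 : x.1 ≤ b.1) (h0 : areaForm a b x = 0) : x ∈ segment ℝ a b := by
  have hd : 0 < b.1 - a.1 := sub_pos.2 h
  refine mem_segment_iff_exists_coord.2 ⟨(x.1 - a.1) / (b.1 - a.1), ?_, ?_, ?_, ?_⟩
  · exact div_nonneg (by linarith) hd.le
  · rw [div_le_one hd]; linarith
  · field_simp; ring
  · simp only [areaForm] at h0
    field_simp
    linarith

/-- Off the segment, the count can jump only where an end lies straight above `x₀`. By the half-open
convention it is unchanged on the vertical line and to its right, so the correction appears only to
the left. -/
theorem eventually_crossing_of_lt {a b x₀ : ℝ × ℝ} (h : a.1 < b.1) (hx : x₀ ∉ segment ℝ a b) :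
    ∀ᶠ x in 𝓝 x₀, crossing a b x =
      crossing a b x₀ + if x.1 < x₀.1 then isAbove x₀ a + isAbove x₀ b else 0 := by
  have hA := continuous_areaForm a b
  have hf : Continuous (fun x : ℝ × ℝ => x.1) := continuous_fst
  simp only [crossing_of_lt h, isAbove]
  have hd : 0 < b.1 - a.1 := sub_pos.2 h
  rcases lt_trichotomy x₀.1 a.1 with h1 | h1 | h1
  · filter_upwards [(isOpen_lt hf continuous_const).mem_nhds h1] with x hx
    have hx : x.1 < a.1 := hx
    have ha : ¬ (a.1 = x₀.1 ∧ x₀.2 < a.2) := fun hc => by linarith [hc.1]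
    have hb : ¬ (b.1 = x₀.1 ∧ x₀.2 < b.2) := fun hc => by linarith [hc.1]
    rw [if_neg ha, if_neg hb, if_neg (fun hc => by linarith [hc.1]),
      if_neg (fun hc => by linarith [hc.1])]
    simp
  · have h2 : x₀.1 < b.1 := by linarith
    have e : areaForm a b x₀ = (b.1 - a.1) * (x₀.2 - a.2) := by
      simp only [areaForm, h1]; ring
    have h0 : areaForm a b x₀ ≠ 0 := fun h0 =>
      hx (mem_segment_of_areaForm_eq_zero h h1.ge h2.le h0)
    have hb : ¬ (b.1 = x₀.1 ∧ x₀.2 < b.2) := fun hc => by linarith [hc.1]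
    rcases lt_or_gt_of_ne h0 with h0 | h0
    · have ha : a.1 = x₀.1 ∧ x₀.2 < a.2 := ⟨h1.symm, by nlinarith⟩
      filter_upwards [(isOpen_lt hf continuous_const).mem_nhds h2,
        (isOpen_lt hA continuous_const).mem_nhds h0] with x hx2 hx0
      have hx2 : x.1 < b.1 := hx2
      have hx0 : areaForm a b x < 0 := hx0
      rw [if_neg hb, if_pos ha, if_pos (⟨h1.ge, h2, h0⟩ : a.1 ≤ x₀.1 ∧ _)]
      by_cases hx1 : x.1 < x₀.1
      · rw [if_pos hx1, if_neg (fun hc => by linarith [hc.1])]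
        decide
      · rw [if_neg hx1, if_pos ⟨by linarith, hx2, hx0⟩]
        decide
    · have ha : ¬ (a.1 = x₀.1 ∧ x₀.2 < a.2) := fun hc => by nlinarith [hc.2]
      filter_upwards [(isOpen_lt continuous_const hA).mem_nhds h0] with x hx0
      have hx0 : 0 < areaForm a b x := hx0
      rw [if_neg hb, if_neg ha, if_neg (fun hc => by linarith [hc.2.2]),
        if_neg (fun hc => by linarith [hc.2.2])]
      simp
  · have ha : ¬ (a.1 = x₀.1 ∧ x₀.2 < a.2) := fun hc => by linarith [hc.1]
    rcases lt_trichotomy x₀.1 b.1 with h2 | h2 | h2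
    · have h0 : areaForm a b x₀ ≠ 0 := fun h0 =>
        hx (mem_segment_of_areaForm_eq_zero h h1.le h2.le h0)
      have hb : ¬ (b.1 = x₀.1 ∧ x₀.2 < b.2) := fun hc => by linarith [hc.1]
      rcases lt_or_gt_of_ne h0 with h0 | h0
      · filter_upwards [(isOpen_lt continuous_const hf).mem_nhds h1,
          (isOpen_lt hf continuous_const).mem_nhds h2,
          (isOpen_lt hA continuous_const).mem_nhds h0] with x hx1 hx2 hx0
        have hx1 : a.1 < x.1 := hx1
        rw [if_neg ha, if_neg hb, if_pos ⟨hx1.le, hx2, hx0⟩, if_pos ⟨h1.le, h2, h0⟩]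
        simp
      · filter_upwards [(isOpen_lt continuous_const hA).mem_nhds h0] with x hx0
        have hx0 : 0 < areaForm a b x := hx0
        rw [if_neg ha, if_neg hb, if_neg (fun hc => by linarith [hc.2.2]),
          if_neg (fun hc => by linarith [hc.2.2])]
        simp
    · have e : areaForm a b x₀ = (b.1 - a.1) * (x₀.2 - b.2) := by
        simp only [areaForm, h2]; ring
      have h0 : areaForm a b x₀ ≠ 0 := fun h0 =>
        hx (mem_segment_of_areaForm_eq_zero h h1.le h2.le h0)
      rw [if_neg (fun hc => by linarith [hc.2.1] :
        ¬ (a.1 ≤ x₀.1 ∧ x₀.1 < b.1 ∧ areaForm a b x₀ < 0))]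
      rcases lt_or_gt_of_ne h0 with h0 | h0
      · have hb : b.1 = x₀.1 ∧ x₀.2 < b.2 := ⟨h2.symm, by nlinarith⟩
        filter_upwards [(isOpen_lt continuous_const hf).mem_nhds h1,
          (isOpen_lt hA continuous_const).mem_nhds h0] with x hx1 hx0
        have hx1 : a.1 < x.1 := hx1
        rw [if_neg ha, if_pos hb]
        by_cases hx2 : x.1 < x₀.1
        · rw [if_pos hx2, if_pos ⟨hx1.le, by linarith, hx0⟩]
          decide
        · rw [if_neg hx2, if_neg (fun hc => by linarith [hc.2.1])]
          decide
      · have hb : ¬ (b.1 = x₀.1 ∧ x₀.2 < b.2) := fun hc => by nlinarith [hc.2]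
        filter_upwards [(isOpen_lt continuous_const hA).mem_nhds h0] with x hx0
        have hx0 : 0 < areaForm a b x := hx0
        rw [if_neg ha, if_neg hb, if_neg (fun hc => by linarith [hc.2.2])]
        simp
    · have hb : ¬ (b.1 = x₀.1 ∧ x₀.2 < b.2) := fun hc => by linarith [hc.1]
      filter_upwards [(isOpen_lt continuous_const hf).mem_nhds h2] with x hx2
      have hx2 : b.1 < x.1 := hx2
      rw [if_neg ha, if_neg hb, if_neg (fun hc => by linarith [hc.2.1]),
        if_neg (fun hc => by linarith [hc.2.1])]
      simp

theorem eventually_crossing {a b x₀ : ℝ × ℝ} (h : a.1 ≠ b.1) (hx : x₀ ∉ segment ℝ a b) :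
    ∀ᶠ x in 𝓝 x₀, crossing a b x =
      crossing a b x₀ + if x.1 < x₀.1 then isAbove x₀ a + isAbove x₀ b else 0 := by
  rcases lt_or_gt_of_ne h with h | h
  · exact eventually_crossing_of_lt h hx
  · rw [segment_symm] at hx
    filter_upwards [eventually_crossing_of_lt h hx] with x hx
    rw [crossing_comm, hx, crossing_comm, add_comm (isAbove x₀ b)]

/-- The directed segments of the polygonal curve through the listed points. -/
def polySteps : List (ℝ × ℝ) → List ((ℝ × ℝ) × (ℝ × ℝ))
  | a :: b :: l => (a, b) :: polySteps (b :: l)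
  | _ => []

/-- The number, modulo two, of crossings of the upward ray from `x` with a polygonal curve. -/
noncomputable def crossings (l : List (ℝ × ℝ)) (x : ℝ × ℝ) : ZMod 2 :=
  ((polySteps l).map fun s => crossing s.1 s.2 x).sum

/-- Corrections at an inner point of the list come from both adjacent segments and cancel mod 2;
only those of the two extreme points survive. -/
theorem eventually_crossings (x₀ : ℝ × ℝ) : ∀ (l : List (ℝ × ℝ)),
    (∀ s ∈ polySteps l, s.1.1 ≠ s.2.1 ∧ x₀ ∉ segment ℝ s.1 s.2) → ∀ p q : ℝ × ℝ,
    l.head? = some p → l.getLast? = some q →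
    ∀ᶠ x in 𝓝 x₀, crossings l x =
      crossings l x₀ + if x.1 < x₀.1 then isAbove x₀ p + isAbove x₀ q else 0
  | [], _, p, q, hp, _ => by simp at hp
  | [a], _, p, q, hp, hq => by
    simp only [List.head?_cons, Option.some.injEq, List.getLast?_singleton] at hp hq
    subst hp hq
    refine Eventually.of_forall fun x => ?_
    simp [CharTwo.add_self_eq_zero]
    rfl
  | a :: b :: l, h, p, q, hp, hq => by
    have h1 := h (a, b) (by simp [polySteps])
    have ih := eventually_crossings x₀ (b :: l)
      (fun s hs => h s (by simp only [polySteps, List.mem_cons]; exact Or.inr hs)) b q rfl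
      (by rwa [List.getLast?_cons_cons] at hq)
    simp only [List.head?_cons, Option.some.injEq] at hp
    subst hp
    filter_upwards [eventually_crossing h1.1 h1.2, ih] with x e1 e2
    have ec : ∀ y, crossings (a :: b :: l) y = crossing a b y + crossings (b :: l) y := by
      intro y; simp [crossings, polySteps]
    rw [ec, ec, e1, e2]
    split_ifs
    · have := CharTwo.add_self_eq_zero (isAbove x₀ b)
      linear_combination this
    · ring

theorem eventually_add_snd {p : ℝ × ℝ → Prop} {x₀ : ℝ × ℝ} (h : ∀ᶠ x in 𝓝 x₀, p x) :
    ∀ᶠ t in 𝓝[>] (0 : ℝ), p (x₀.1, x₀.2 + t) ∧ p (x₀.1, x₀.2 - t) := by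
  refine nhdsWithin_le_nhds ?_
  have h1 : Tendsto (fun t : ℝ => (x₀.1, x₀.2 + t)) (𝓝 0) (𝓝 x₀) := by
    have : Continuous (fun t : ℝ => (x₀.1, x₀.2 + t)) := by fun_prop
    simpa using this.tendsto 0
  have h2 : Tendsto (fun t : ℝ => (x₀.1, x₀.2 - t)) (𝓝 0) (𝓝 x₀) := by
    have : Continuous (fun t : ℝ => (x₀.1, x₀.2 - t)) := by fun_prop
    simpa using this.tendsto 0
  exact (h1.eventually h).and (h2.eventually h)

theorem eventually_crossing_add_crossing {a b x : ℝ × ℝ} (h : a.1 ≠ b.1)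
    (hx : x ∉ segment ℝ a b) :
    ∀ᶠ t in 𝓝[>] (0 : ℝ), crossing a b (x.1, x.2 + t) + crossing a b (x.1, x.2 - t) = 0 := by
  filter_upwards [eventually_add_snd (eventually_crossing h hx)] with t ht
  rw [ht.1, ht.2]
  simp only [lt_irrefl, if_false, add_zero]
  exact CharTwo.add_self_eq_zero _

theorem crossing_add_crossing_midpoint {a b : ℝ × ℝ} (h : a.1 ≠ b.1) {t : ℝ} (ht : 0 < t) :
    crossing a b ((a.1 + b.1) / 2, (a.2 + b.2) / 2 + t) +
      crossing a b ((a.1 + b.1) / 2, (a.2 + b.2) / 2 - t) = 1 := by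
  wlog hab : a.1 < b.1 generalizing a b
  · have := this h.symm (lt_of_le_of_ne (not_lt.1 hab) h.symm)
    rw [crossing_comm a b, crossing_comm a b, add_comm a.1, add_comm a.2]
    exact this
  have hd : 0 < (b.1 - a.1) * t := mul_pos (sub_pos.2 hab) ht
  rw [crossing_of_lt hab, crossing_of_lt hab, if_neg, if_pos, zero_add]
  · refine ⟨by simp only; linarith, by simp only; linarith, ?_⟩
    simp only [areaForm]; nlinarith
  · rintro ⟨-, -, h3⟩
    simp only [areaForm] at h3; nlinarith

theorem eventually_mem_leftStrip_midpoint {a b : ℝ × ℝ} (h : a.1 < b.1) {δ : ℝ} (hδ : 0 < δ) :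
    ∀ᶠ t in 𝓝[>] (0 : ℝ), ((a.1 + b.1) / 2, (a.2 + b.2) / 2 + t) ∈ leftStrip a b δ ∧
      ((a.1 + b.1) / 2, (a.2 + b.2) / 2 - t) ∈ leftStrip b a δ := by
  have hd := sq_dist_pos (a := a) (b := b) (fun h0 => by rw [h0] at h; exact lt_irrefl _ h)
  set N := (b.1 - a.1) ^ 2 + (b.2 - a.2) ^ 2 with hN
  have e1 : ∀ᶠ t in 𝓝[>] (0 : ℝ), (b.1 - a.1) * t < δ * (N / 2 + (b.2 - a.2) * t) := by
    refine nhdsWithin_le_nhds ((isOpen_lt (by fun_prop) (by fun_prop)).mem_nhds ?_)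
    change (b.1 - a.1) * 0 < δ * (N / 2 + (b.2 - a.2) * 0)
    simp only [mul_zero, add_zero]
    positivity
  have e2 : ∀ᶠ t in 𝓝[>] (0 : ℝ), (b.1 - a.1) * t < δ * (N / 2 - (b.2 - a.2) * t) := by
    refine nhdsWithin_le_nhds ((isOpen_lt (by fun_prop) (by fun_prop)).mem_nhds ?_)
    change (b.1 - a.1) * 0 < δ * (N / 2 - (b.2 - a.2) * 0)
    simp only [mul_zero, sub_zero]
    positivity
  filter_upwards [e1, e2, self_mem_nhdsWithin] with t h1 h2 ht
  have h0 : 0 < (b.1 - a.1) * t := mul_pos (sub_pos.2 h) ht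
  refine ⟨⟨?_, ?_, ?_⟩, ⟨?_, ?_, ?_⟩⟩ <;> simp only [areaForm, dotForm] <;>
    simp only [hN] at h1 h2 <;> nlinarith

/-! ### Consecutive points of simple polygonal arcs -/

theorem mem_polySteps_iff {a b : ℝ × ℝ} : ∀ {l : List (ℝ × ℝ)},
    (a, b) ∈ polySteps l ↔ [a, b] <:+: l
  | [] => by simp [polySteps]
  | [x] => by
    simp only [polySteps, List.not_mem_nil, false_iff]
    intro h
    have := h.length_le
    simp at this
  | x :: y :: l => by
    rw [polySteps, List.mem_cons, mem_polySteps_iff, List.infix_cons_iff (l₂ := y :: l)]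
    simp [List.cons_prefix_cons]

theorem segment_subset_polyline {s : (ℝ × ℝ) × (ℝ × ℝ)} : ∀ {l : List (ℝ × ℝ)},
    s ∈ polySteps l → segment ℝ s.1 s.2 ⊆ polyline l
  | [], h => by simp [polySteps] at h
  | [_], h => by simp [polySteps] at h
  | a :: b :: l, h => by
    rw [polySteps, List.mem_cons] at h
    rcases h with rfl | h
    · exact subset_union_left
    · exact (segment_subset_polyline h).trans subset_union_right

theorem mem_polyline_of_mem {x : ℝ × ℝ} : ∀ {l : List (ℝ × ℝ)}, x ∈ l → x ∈ polyline l
  | [], h => by simp at h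
  | [a], h => by simpa [polyline] using h
  | a :: b :: l, h => by
    rcases List.mem_cons.1 h with rfl | h
    · exact Or.inl (left_mem_segment ..)
    · exact Or.inr (mem_polyline_of_mem h)

theorem IsSimplePolyline.nodup : ∀ {l : List (ℝ × ℝ)}, IsSimplePolyline l → l.Nodup
  | [], _ => List.nodup_nil
  | [a], _ => List.nodup_singleton a
  | a :: b :: l, h => by
    refine List.nodup_cons.2 ⟨fun ha => h.1 ?_, IsSimplePolyline.nodup h.2.2⟩
    have : a ∈ segment ℝ a b ∩ polyline (b :: l) :=
      ⟨left_mem_segment .., mem_polyline_of_mem ha⟩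
    rw [h.2.1] at this
    exact this

theorem IsSimplePolyline.eq_of_mem_segment {x : ℝ × ℝ} {s : (ℝ × ℝ) × (ℝ × ℝ)} :
    ∀ {l : List (ℝ × ℝ)}, IsSimplePolyline l → x ∈ l → s ∈ polySteps l →
      x ∈ segment ℝ s.1 s.2 → x = s.1 ∨ x = s.2
  | [], _, h, _, _ => by simp at h
  | [_], _, _, h, _ => by simp [polySteps] at h
  | a :: b :: l, h, hx, hs, hxs => by
    rw [polySteps, List.mem_cons] at hs
    rcases List.mem_cons.1 hx with rfl | hx
    · rcases hs with rfl | hs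
      · exact Or.inl rfl
      · have : x ∈ segment ℝ x b ∩ polyline (b :: l) :=
          ⟨left_mem_segment .., segment_subset_polyline hs hxs⟩
        rw [h.2.1] at this
        exact absurd this h.1
    · rcases hs with rfl | hs
      · have : x ∈ segment ℝ a b ∩ polyline (b :: l) := ⟨hxs, mem_polyline_of_mem hx⟩
        rw [h.2.1] at this
        exact Or.inr this
      · exact IsSimplePolyline.eq_of_mem_segment h.2.2 hx hs hxs

theorem IsSimplePolyline.eq_or_eq_of_mem_segment {x : ℝ × ℝ} {s s' : (ℝ × ℝ) × (ℝ × ℝ)} :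
    ∀ {l : List (ℝ × ℝ)}, IsSimplePolyline l → s ∈ polySteps l → s' ∈ polySteps l →
      x ∈ segment ℝ s.1 s.2 → x ∈ segment ℝ s'.1 s'.2 →
      s' = s ∨ ((x = s.1 ∨ x = s.2) ∧ (x = s'.1 ∨ x = s'.2))
  | [], _, h, _, _, _ => by simp [polySteps] at h
  | [_], _, h, _, _, _ => by simp [polySteps] at h
  | a :: b :: l, h, hs, hs', hx, hx' => by
    rw [polySteps, List.mem_cons] at hs hs'
    have key : ∀ {s}, x ∈ segment ℝ a b → s ∈ polySteps (b :: l) → x ∈ segment ℝ s.1 s.2 →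
        x = b ∧ (x = s.1 ∨ x = s.2) := by
      intro s h1 h2 h3
      have : x ∈ segment ℝ a b ∩ polyline (b :: l) := ⟨h1, segment_subset_polyline h2 h3⟩
      rw [h.2.1] at this
      have hxb : x = b := this
      exact ⟨hxb, h.2.2.eq_of_mem_segment (by rw [hxb]; simp) h2 h3⟩
    rcases hs with rfl | hs <;> rcases hs' with rfl | hs'
    · exact Or.inl rfl
    · obtain ⟨h1, h2⟩ := key hx hs' hx'
      exact Or.inr ⟨Or.inr h1, h2⟩
    · obtain ⟨h1, h2⟩ := key hx' hs hx
      exact Or.inr ⟨h2, Or.inr h1⟩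
    · exact IsSimplePolyline.eq_or_eq_of_mem_segment h.2.2 hs hs' hx hx'

theorem List.Nodup.eq_of_pair_infix {α : Type*} {b c q : α} : ∀ {l : List α}, l.Nodup →
    [b, q] <:+: l → [b, c] <:+: l → q = c
  | [], _, h, _ => by simp at h
  | x :: l, hl, hq, hc => by
    rw [List.infix_cons_iff] at hq hc
    have hx := (List.nodup_cons.1 hl).1
    rcases hq with hq | hq <;> rcases hc with hc | hc
    · obtain ⟨t, ht⟩ := (List.cons_prefix_cons.1 hq).2
      obtain ⟨t', ht'⟩ := (List.cons_prefix_cons.1 hc).2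
      rw [← ht] at ht'
      simpa using (List.cons.inj ht').1.symm
    · exact absurd (hc.subset (by simp : b ∈ [b, c])) ((List.cons_prefix_cons.1 hq).1 ▸ hx)
    · exact absurd (hq.subset (by simp : b ∈ [b, q])) ((List.cons_prefix_cons.1 hc).1 ▸ hx)
    · exact List.Nodup.eq_of_pair_infix (List.nodup_cons.1 hl).2 hq hc

theorem List.pair_infix_reverse {α : Type*} {a b : α} {l : List α} :
    [a, b] <:+: l.reverse ↔ [b, a] <:+: l := by
  rw [← List.reverse_infix (l₂ := l)]
  simp

theorem List.Nodup.eq_of_pair_infix' {α : Type*} {a b q : α} {l : List α} (hl : l.Nodup)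
    (hq : [q, b] <:+: l) (ha : [a, b] <:+: l) : q = a :=
  (List.nodup_reverse.2 hl).eq_of_pair_infix (List.pair_infix_reverse.2 hq)
    (List.pair_infix_reverse.2 ha)

theorem List.Nodup.head?_ne_of_pair_infix {α : Type*} {a b : α} {l : List α} (hl : l.Nodup)
    (h : [a, b] <:+: l) : l.head? ≠ some b := by
  intro hb
  cases l with
  | nil => simp at hb
  | cons x l =>
    simp only [List.head?_cons, Option.some.injEq] at hb
    subst hb
    refine (List.nodup_cons.1 hl).1 ?_
    rcases List.infix_cons_iff.1 h with h | h
    · exact (List.cons_prefix_cons.1 h).2.subset (by simp)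
    · exact h.subset (by simp)

theorem List.Nodup.getLast?_ne_of_pair_infix {α : Type*} {a b : α} {l : List α} (hl : l.Nodup)
    (h : [b, a] <:+: l) : l.getLast? ≠ some b := by
  rw [← List.head?_reverse]
  exact (List.nodup_reverse.2 hl).head?_ne_of_pair_infix (List.pair_infix_reverse.2 h)

/-! ### The arcs of a drawing as an arrangement of segments -/

namespace PlaneDrawing

variable {V : Type*} {G : SimpleGraph V} (D : PlaneDrawing G)

open Classical in
/-- The list of points of the arc of a dart, from its first to its second vertex. -/
noncomputable def path (d : G.Dart) : List (ℝ × ℝ) :=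
  if (D.arc d.edge).head? = some (D.point d.fst) then D.arc d.edge else (D.arc d.edge).reverse

theorem path_eq_or (d : G.Dart) :
    D.path d = D.arc d.edge ∨ D.path d = (D.arc d.edge).reverse := by
  unfold path
  split_ifs
  · exact Or.inl rfl
  · exact Or.inr rfl

theorem arc_ends_dart (d : G.Dart) :
    ((D.arc d.edge).head? = some (D.point d.fst) ∧
      (D.arc d.edge).getLast? = some (D.point d.snd)) ∨
    ((D.arc d.edge).head? = some (D.point d.snd) ∧
      (D.arc d.edge).getLast? = some (D.point d.fst)) := by
  obtain ⟨u, v, he, h1, h2⟩ := D.arc_ends d.edge d.edge_mem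
  have : s(d.fst, d.snd) = s(u, v) := he
  rcases Sym2.eq_iff.1 this with ⟨e1, e2⟩ | ⟨e1, e2⟩
  · rw [e1, e2]; exact Or.inl ⟨h1, h2⟩
  · rw [e1, e2]; exact Or.inr ⟨h1, h2⟩

theorem head?_path (d : G.Dart) : (D.path d).head? = some (D.point d.fst) := by
  unfold path
  split_ifs with h
  · exact h
  · rw [List.head?_reverse]
    exact ((D.arc_ends_dart d).resolve_left fun h' => h h'.1).2

theorem path_symm (d : G.Dart) : D.path d.symm = (D.path d).reverse := by
  have hne : D.point d.fst ≠ D.point d.snd := fun h => d.adj.ne (D.point_injective h)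
  unfold path
  rw [SimpleGraph.Dart.edge_symm]
  have e : (d.symm).fst = d.snd := rfl
  rw [e]
  rcases D.arc_ends_dart d with h | h
  · rw [if_pos h.1, if_neg]
    rw [h.1]
    simpa using hne
  · rw [if_pos h.1, if_neg, List.reverse_reverse]
    rw [h.1]
    simpa using hne.symm

theorem getLast?_path (d : G.Dart) : (D.path d).getLast? = some (D.point d.snd) := by
  rw [← List.head?_reverse, ← path_symm, head?_path]
  rfl

theorem nodup_path (d : G.Dart) : (D.path d).Nodup := by
  have := (D.arc_simple d.edge d.edge_mem).nodup
  rcases D.path_eq_or d with h | h <;> rw [h]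
  · exact this
  · exact List.nodup_reverse.2 this

theorem mem_path_of_mem_edge {d : G.Dart} {v : V} (h : v ∈ d.edge) : D.point v ∈ D.path d := by
  have : v = d.fst ∨ v = d.snd := Sym2.mem_iff.1 h
  rcases this with rfl | rfl
  · exact List.mem_of_head? (D.head?_path d)
  · exact List.mem_of_getLast? (D.getLast?_path d)

theorem pair_infix_arc {d : G.Dart} {a b : ℝ × ℝ} (h : [a, b] <:+: D.path d) :
    (a, b) ∈ polySteps (D.arc d.edge) ∨ (b, a) ∈ polySteps (D.arc d.edge) := by
  rw [mem_polySteps_iff, mem_polySteps_iff]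
  rcases D.path_eq_or d with e | e <;> rw [e] at h
  · exact Or.inl h
  · exact Or.inr (List.pair_infix_reverse.1 h)

theorem segment_subset_arc {d : G.Dart} {a b : ℝ × ℝ} (h : [a, b] <:+: D.path d) :
    segment ℝ a b ⊆ polyline (D.arc d.edge) := by
  rcases D.pair_infix_arc h with h | h
  · exact segment_subset_polyline h
  · rw [segment_symm]
    exact segment_subset_polyline h

theorem mem_arc_iff {d : G.Dart} {x : ℝ × ℝ} : x ∈ D.path d ↔ x ∈ D.arc d.edge := by
  rcases D.path_eq_or d with e | e <;> rw [e]
  exact List.mem_reverse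

theorem eq_of_mem_segment {d : G.Dart} {a b x : ℝ × ℝ} (h : [a, b] <:+: D.path d)
    (hx : x ∈ D.path d) (hxs : x ∈ segment ℝ a b) : x = a ∨ x = b := by
  have hs := D.arc_simple d.edge d.edge_mem
  rw [mem_arc_iff] at hx
  rcases D.pair_infix_arc h with h | h
  · exact hs.eq_of_mem_segment hx h hxs
  · rw [segment_symm] at hxs
    exact (hs.eq_of_mem_segment hx h hxs).symm

theorem eq_or_eq_of_mem_segment {d : G.Dart} {a b c e x : ℝ × ℝ} (h : [a, b] <:+: D.path d)
    (h' : [c, e] <:+: D.path d) (hx : x ∈ segment ℝ a b) (hx' : x ∈ segment ℝ c e) :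
    (c = a ∧ e = b) ∨ (c = b ∧ e = a) ∨ ((x = a ∨ x = b) ∧ (x = c ∨ x = e)) := by
  have hs := D.arc_simple d.edge d.edge_mem
  have hx2 := hx
  have hx2' := hx'
  rw [segment_symm] at hx2 hx2'
  rcases D.pair_infix_arc h with h | h <;> rcases D.pair_infix_arc h' with h' | h'
  · have := hs.eq_or_eq_of_mem_segment h h' hx hx'
    simp only [Prod.mk.injEq] at this
    tauto
  · have := hs.eq_or_eq_of_mem_segment h h' hx hx2'
    simp only [Prod.mk.injEq] at this
    tauto
  · have := hs.eq_or_eq_of_mem_segment h h' hx2 hx'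
    simp only [Prod.mk.injEq] at this
    tauto
  · have := hs.eq_or_eq_of_mem_segment h h' hx2 hx2'
    simp only [Prod.mk.injEq] at this
    tauto

/-- The directed segments of all arcs of a drawing. -/
def steps : Set ((ℝ × ℝ) × (ℝ × ℝ)) := {s | ∃ d : G.Dart, [s.1, s.2] <:+: D.path d}

theorem eq_or_eq_symm_of_edge_eq {d d' : G.Dart} (h : d'.edge = d.edge) :
    D.path d' = D.path d ∨ D.path d' = (D.path d).reverse := by
  rcases SimpleGraph.dart_edge_eq_iff d' d |>.1 h with rfl | rfl
  · exact Or.inl rfl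
  · exact Or.inr (D.path_symm d)

theorem finite_steps [Finite V] : D.steps.Finite := by
  have hfin : Finite G.Dart :=
    Finite.of_injective (fun d : G.Dart => d.toProd) SimpleGraph.Dart.toProd_injective
  have : D.steps ⊆ ⋃ d : G.Dart, {s | s ∈ (D.path d) ×ˢ (D.path d)} := by
    rintro ⟨a, b⟩ ⟨d, hd⟩
    refine mem_iUnion.2 ⟨d, ?_⟩
    exact List.mem_product.2 ⟨hd.subset (by simp), hd.subset (by simp)⟩
  exact (finite_iUnion fun d => List.finite_toSet _).subset this

/-- Within one arc this is simplicity. Different arcs meet only in the point of a common vertex,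
which is an end of every step of these arcs containing it. -/
theorem planeSegments [Finite V] (hv : ∀ a b, (a, b) ∈ D.steps → a.1 ≠ b.1) :
    PlaneSegments D.steps := by
  classical
  have hsymm : ∀ a b, (a, b) ∈ D.steps → (b, a) ∈ D.steps := by
    rintro a b ⟨d, hd⟩
    exact ⟨d.symm, by rw [path_symm]; exact List.pair_infix_reverse.2 hd⟩
  refine ⟨?_, hsymm, hv, ?_⟩
  · exact D.finite_steps
  · rintro a b c e ⟨d, hd⟩ ⟨d', hd'⟩ x hx hx'
    by_cases hdd : d'.edge = d.edge
    · rcases D.eq_or_eq_symm_of_edge_eq hdd with h | h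
      · rw [h] at hd'
        exact D.eq_or_eq_of_mem_segment hd hd' hx hx'
      · rw [h] at hd'
        rw [segment_symm] at hx'
        have := D.eq_or_eq_of_mem_segment hd (List.pair_infix_reverse.1 hd') hx hx'
        tauto
    · obtain ⟨v, hv1, hv2, rfl⟩ := D.arc_inter_arc d.edge d.edge_mem d'.edge d'.edge_mem
        (Ne.symm hdd) x ⟨D.segment_subset_arc hd hx, D.segment_subset_arc hd' hx'⟩
      have hx₂ := D.eq_of_mem_segment hd' (D.mem_path_of_mem_edge hv2) hx'
      exact Or.inr (Or.inr ⟨D.eq_of_mem_segment hd (D.mem_path_of_mem_edge hv1) hx, hx₂⟩)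

/-- The second point on the arc of a dart. -/
noncomputable def first (d : G.Dart) : ℝ × ℝ := ((D.path d).tail.head?).getD 0

/-- The two end points differ, so the path has a second point and the default value in `first` is
never taken. -/
theorem exists_path_eq (d : G.Dart) : ∃ t, D.path d = D.point d.fst :: D.first d :: t := by
  have h1 := D.head?_path d
  have h2 := D.getLast?_path d
  have hne : D.point d.fst ≠ D.point d.snd := fun h => d.adj.ne (D.point_injective h)
  unfold first
  rcases hp : D.path d with _ | ⟨x, _ | ⟨y, t⟩⟩
  · simp [hp] at h1
  · rw [hp] at h1 h2
    simp only [List.head?_cons, Option.some.injEq, List.getLast?_singleton] at h1 h2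
    exact absurd (h1.symm.trans h2) hne
  · rw [hp] at h1
    simp only [List.head?_cons, Option.some.injEq] at h1
    exact ⟨t, by simp [h1]⟩

theorem first_infix (d : G.Dart) : [D.point d.fst, D.first d] <:+: D.path d := by
  obtain ⟨t, ht⟩ := D.exists_path_eq d
  rw [ht]
  exact ⟨[], t, by simp⟩

theorem first_mem_steps (d : G.Dart) : (D.point d.fst, D.first d) ∈ D.steps := ⟨d, D.first_infix d⟩

/-- If the edges differed, the common second point would be a vertex on both arcs, hence the far end
of both, and the edges would agree after all. -/
theorem first_injective {d d' : G.Dart} (h : d.fst = d'.fst) (hf : D.first d = D.first d') :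
    d = d' := by
  by_cases he : d'.edge = d.edge
  · rcases SimpleGraph.dart_edge_eq_iff d' d |>.1 he with rfl | rfl
    · rfl
    · exact absurd h d.adj.ne
  · exfalso
    have h1 := D.first_infix d
    have h2 := D.first_infix d'
    obtain ⟨v, hv1, hv2, hv⟩ := D.arc_inter_arc d.edge d.edge_mem d'.edge d'.edge_mem
        (Ne.symm he) (D.first d) ⟨D.segment_subset_arc h1 (right_mem_segment ..),
          D.segment_subset_arc h2 (by rw [hf]; exact right_mem_segment ..)⟩
    have hne : D.point d.fst ≠ D.first d := by
      intro h0
      have := (D.nodup_path d).sublist h1.sublist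
      simp [h0] at this
    have hvd : v ≠ d.fst := by
      rintro rfl
      exact hne hv.symm
    have e1 : v = d.snd := (Sym2.mem_iff.1 hv1 : v = d.fst ∨ v = d.snd).resolve_left hvd
    have e2 : v = d'.snd :=
      (Sym2.mem_iff.1 hv2 : v = d'.fst ∨ v = d'.snd).resolve_left (h ▸ hvd)
    refine he ?_
    change s(d'.fst, d'.snd) = s(d.fst, d.snd)
    rw [← e1, ← e2, h]

theorem exists_dart_of_mem_steps {v : V} {q : ℝ × ℝ} (h : (D.point v, q) ∈ D.steps) :
    ∃ d : G.Dart, d.fst = v ∧ D.first d = q := by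
  obtain ⟨d, hd⟩ := h
  have hv : v ∈ d.edge := D.vertex_on_arc d.edge d.edge_mem v
    (D.segment_subset_arc hd (left_mem_segment ..))
  rcases (Sym2.mem_iff.1 hv : v = d.fst ∨ v = d.snd) with rfl | rfl
  · exact ⟨d, rfl, (D.nodup_path d).eq_of_pair_infix (D.first_infix d) hd⟩
  · exact absurd (D.getLast?_path d) ((D.nodup_path d).getLast?_ne_of_pair_infix hd)

/-- An inner point of a path is not a vertex, so no other arc passes through it. -/
theorem neighbor_of_bend {d : G.Dart} {a b c q : ℝ × ℝ} (h : [a, b, c] <:+: D.path d)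
    (hq : (b, q) ∈ D.steps) : q = a ∨ q = c := by
  have hab : [a, b] <:+: D.path d := List.IsInfix.trans ⟨[], [c], by simp⟩ h
  have hbc : [b, c] <:+: D.path d := List.IsInfix.trans ⟨[a], [], by simp⟩ h
  have hn := D.nodup_path d
  obtain ⟨d', hd'⟩ := hq
  by_cases he : d'.edge = d.edge
  · rcases D.eq_or_eq_symm_of_edge_eq he with e | e <;> rw [e] at hd'
    · exact Or.inr (hn.eq_of_pair_infix hd' hbc)
    · exact Or.inl (hn.eq_of_pair_infix' (List.pair_infix_reverse.1 hd') hab)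
  · exfalso
    obtain ⟨v, hv1, -, rfl⟩ := D.arc_inter_arc d.edge d.edge_mem d'.edge d'.edge_mem
        (Ne.symm he) b ⟨D.segment_subset_arc hab (right_mem_segment ..),
          D.segment_subset_arc hd' (left_mem_segment ..)⟩
    rcases (Sym2.mem_iff.1 hv1 : v = d.fst ∨ v = d.snd) with rfl | rfl
    · exact hn.head?_ne_of_pair_infix hab (D.head?_path d)
    · exact hn.getLast?_ne_of_pair_infix hbc (D.getLast?_path d)

end PlaneDrawing

/-! ### From crossing parity to a rotation system -/

/-- The correction in `eventually_crossings` is absent on the vertical line through `m`. -/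
theorem crossings_add_crossings_eq_zero {l : List (ℝ × ℝ)} {m : ℝ × ℝ}
    (h : ∀ s ∈ polySteps l, s.1.1 ≠ s.2.1 ∧ m ∉ segment ℝ s.1 s.2) :
    ∀ᶠ t in 𝓝[>] (0 : ℝ), crossings l (m.1, m.2 + t) + crossings l (m.1, m.2 - t) = 0 := by
  rcases hl : l with _ | ⟨a, l'⟩
  · simp [crossings, polySteps]
  · rw [← hl]
    have := eventually_crossings m l h a ((a :: l').getLast (by simp)) (by simp [hl])
      (by rw [hl]; exact List.getLast?_eq_getLast_of_ne_nil _)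
    filter_upwards [eventually_add_snd this] with t ht
    rw [ht.1, ht.2]
    simp only [lt_irrefl, if_false, add_zero]
    exact CharTwo.add_self_eq_zero _

/-- Since `m` is interior to one step, simplicity keeps it off all others, and only that step
changes its count. -/
theorem IsSimplePolyline.crossings_add_crossings_eq_one {a b m : ℝ × ℝ}
    (hm : m ∈ segment ℝ a b) (hma : m ≠ a) (hmb : m ≠ b)
    (hcr : ∀ᶠ t in 𝓝[>] (0 : ℝ), crossing a b (m.1, m.2 + t) + crossing a b (m.1, m.2 - t) = 1) :
    ∀ {l : List (ℝ × ℝ)}, IsSimplePolyline l → (a, b) ∈ polySteps l →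
      (∀ s ∈ polySteps l, s.1.1 ≠ s.2.1) →
      ∀ᶠ t in 𝓝[>] (0 : ℝ), crossings l (m.1, m.2 + t) + crossings l (m.1, m.2 - t) = 1
  | [], _, h, _ => by simp [polySteps] at h
  | [_], _, h, _ => by simp [polySteps] at h
  | x :: y :: l, hs, h, hv => by
    have ec : ∀ z, crossings (x :: y :: l) z = crossing x y z + crossings (y :: l) z := by
      intro z; simp [crossings, polySteps]
    have hv' : ∀ s ∈ polySteps (y :: l), s.1.1 ≠ s.2.1 := fun s hs =>
      hv s (by rw [polySteps]; exact List.mem_cons_of_mem _ hs)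
    rw [polySteps, List.mem_cons] at h
    rcases h with h | h
    · obtain ⟨rfl, rfl⟩ := Prod.mk.inj h
      have h0 : m ∉ polyline (b :: l) := fun h0 => by
        have : m ∈ segment ℝ a b ∩ polyline (b :: l) := ⟨hm, h0⟩
        rw [hs.2.1] at this
        exact hmb this
      have hz := crossings_add_crossings_eq_zero (l := b :: l) (m := m) fun s hs =>
        ⟨hv' s hs, fun hms => h0 (segment_subset_polyline hs hms)⟩
      filter_upwards [hcr, hz] with t h1 h2
      rw [ec, ec]
      linear_combination h1 + h2
    · have h0 : m ∉ segment ℝ x y := fun h0 => by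
        have : m ∈ segment ℝ x y ∩ polyline (y :: l) := ⟨h0, segment_subset_polyline h hm⟩
        rw [hs.2.1] at this
        have hmy : m = y := this
        rcases hs.2.2.eq_of_mem_segment (by rw [hmy]; simp) h hm with h | h
        · exact hma h
        · exact hmb h
      have hz := eventually_crossing_add_crossing (hv (x, y) (by simp [polySteps])) h0
      filter_upwards [hz, crossings_add_crossings_eq_one hm hma hmb hcr hs.2.2 h hv'] with t h1 h2
      rw [ec, ec]
      linear_combination h1 + h2

theorem isLeftValue_of_suffix {w : ℝ × ℝ → ZMod 2} {ζ : ZMod 2} :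
    ∀ (l : List (ℝ × ℝ)) (a b : ℝ × ℝ),
      (∀ x y z, [x, y, z] <:+: a :: b :: l → IsLeftValue w x y ζ → IsLeftValue w y z ζ) →
      IsLeftValue w a b ζ → ∀ p q, [p, q] <:+ a :: b :: l → IsLeftValue w p q ζ
  | [], a, b, _, hab, p, q, hpq => by
    have := hpq.eq_of_length (by simp)
    simp only [List.cons.injEq, and_true] at this
    rw [this.1, this.2]
    exact hab
  | c :: l, a, b, h, hab, p, q, hpq => by
    rcases List.suffix_cons_iff.1 hpq with h' | h'
    · have := congrArg List.length h'
      simp at this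
    · exact isLeftValue_of_suffix l b c
        (fun x y z hxyz => h x y z (hxyz.trans (List.infix_cons (List.infix_refl _))))
        (h a b c ⟨[], l, by simp⟩ hab) p q h'

namespace PlaneDrawing

variable {V : Type*} {G : SimpleGraph V} (D : PlaneDrawing G)

theorem mem_steps_of_mem_polySteps {e : Sym2 V} (he : e ∈ G.edgeSet)
    {s : (ℝ × ℝ) × (ℝ × ℝ)} (hs : s ∈ polySteps (D.arc e)) : s ∈ D.steps := by
  obtain ⟨d, rfl⟩ : ∃ d : G.Dart, d.edge = e := by
    induction e using Sym2.ind with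
    | _ a b => exact ⟨⟨(a, b), he⟩, rfl⟩
  have hs := mem_polySteps_iff.1 hs
  rcases D.path_eq_or d with h | h
  · exact ⟨d, by rw [h]; exact hs⟩
  · exact ⟨d.symm, by rw [path_symm, h, List.reverse_reverse]; exact hs⟩

/-- The number, modulo two, of crossings of the upward ray from a point with the edges in a set
given by its indicator function. -/
noncomputable def parity [Fintype G.edgeSet] (c : G.edgeSet → ZMod 2) (x : ℝ × ℝ) : ZMod 2 :=
  ∑ e : G.edgeSet, c e * crossings (D.arc e) x

-- Regrouped by vertices, the corrections at the ends of the arcs are weighted by the sums in `hc`,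
-- which vanish because `c` is a cycle.
open Finset in
theorem locallyConstantOff_parity [Fintype V] [DecidableEq V] [Fintype G.edgeSet]
    (hv : ∀ a b, (a, b) ∈ D.steps → a.1 ≠ b.1) {c : G.edgeSet → ZMod 2}
    (hc : ∀ v, ∑ e : G.edgeSet, (if v ∈ (e : Sym2 V) then c e else 0) = 0) :
    LocallyConstantOff (D.parity c) D.steps := by
  intro x₀ hx₀
  have h1 : ∀ e : G.edgeSet, ∀ᶠ x in 𝓝 x₀, crossings (D.arc e) x = crossings (D.arc e) x₀ +
      if x.1 < x₀.1 then ∑ v : V, (if v ∈ (e : Sym2 V) then isAbove x₀ (D.point v) else 0)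
        else 0 := by
    intro e
    obtain ⟨u, v, he, hu, hv'⟩ := D.arc_ends e e.2
    have huv : u ≠ v := by
      have := e.2
      rw [he] at this
      exact G.ne_of_adj this
    have hsum : ∑ v : V, (if v ∈ (e : Sym2 V) then isAbove x₀ (D.point v) else 0) =
        isAbove x₀ (D.point u) + isAbove x₀ (D.point v) := by
      rw [he, ← sum_filter]
      have : (univ.filter fun z => z ∈ s(u, v)) = {u, v} := by ext z; simp
      rw [this, sum_pair huv]
    rw [hsum]
    refine eventually_crossings x₀ _ (fun s hs => ?_) _ _ hu hv'
    have := D.mem_steps_of_mem_polySteps e.2 hs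
    exact ⟨hv _ _ this, hx₀ _ _ this⟩
  filter_upwards [eventually_all.2 h1] with x hx
  unfold parity
  simp only [hx, mul_add, sum_add_distrib, add_eq_left]
  split_ifs
  · simp only [mul_sum]
    rw [sum_comm]
    refine sum_eq_zero fun v _ => ?_
    have : ∀ e : G.edgeSet, c e * (if v ∈ (e : Sym2 V) then isAbove x₀ (D.point v) else 0) =
        (if v ∈ (e : Sym2 V) then c e else 0) * isAbove x₀ (D.point v) := by
      intro e; split_ifs <;> simp
    rw [sum_congr rfl fun e _ => this e, ← sum_mul, hc v, zero_mul]
  · simp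

-- Just above and just below the midpoint of a step of `e` lie in its two side strips, and between
-- them only the crossing count of `e` changes.
open Finset in
theorem isLeftValue_add_isLeftValue [Fintype G.edgeSet]
    (hv : ∀ a b, (a, b) ∈ D.steps → a.1 ≠ b.1) (c : G.edgeSet → ZMod 2) (e : G.edgeSet)
    {a b : ℝ × ℝ} (hab : (a, b) ∈ polySteps (D.arc e) ∨ (b, a) ∈ polySteps (D.arc e))
    {z z' : ZMod 2} (hz : IsLeftValue (D.parity c) a b z)
    (hz' : IsLeftValue (D.parity c) b a z') : z + z' = c e := by
  classical
  wlog hlt : a.1 < b.1 generalizing a b z z'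
  · have hne : b.1 ≠ a.1 := by
      rcases hab with h | h
      · exact (hv _ _ (D.mem_steps_of_mem_polySteps e.2 h)).symm
      · exact hv _ _ (D.mem_steps_of_mem_polySteps e.2 h)
    rw [add_comm]
    exact this hab.symm hz' hz (lt_of_le_of_ne (not_lt.1 hlt) hne)
  obtain ⟨δ, hδ, H⟩ := hz
  obtain ⟨δ', hδ', H'⟩ := hz'
  set m : ℝ × ℝ := ((a.1 + b.1) / 2, (a.2 + b.2) / 2) with hm
  have hma : m ≠ a := fun h => by
    have : (a.1 + b.1) / 2 = a.1 := congrArg Prod.fst h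
    linarith
  have hmb : m ≠ b := fun h => by
    have : (a.1 + b.1) / 2 = b.1 := congrArg Prod.fst h
    linarith
  have hmem : m ∈ segment ℝ a b := mem_segment_iff_exists_coord.2
    ⟨1 / 2, by norm_num, by norm_num, by simp only [hm]; ring, by simp only [hm]; ring⟩
  have hmem' : m ∈ segment ℝ b a := segment_symm ℝ a b ▸ hmem
  have hsimple := D.arc_simple e e.2
  have hvert : ∀ f : G.edgeSet, ∀ s ∈ polySteps (D.arc f), s.1.1 ≠ s.2.1 := fun f s hs =>
    hv _ _ (D.mem_steps_of_mem_polySteps f.2 hs)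
  have hcr : ∀ f : G.edgeSet, ∀ᶠ t in 𝓝[>] (0 : ℝ), crossings (D.arc f) (m.1, m.2 + t) +
      crossings (D.arc f) (m.1, m.2 - t) = if f = e then 1 else 0 := by
    intro f
    split_ifs with hfe
    · subst hfe
      rcases hab with h | h
      · refine hsimple.crossings_add_crossings_eq_one hmem hma hmb ?_ h (hvert f)
        filter_upwards [self_mem_nhdsWithin] with t ht
        exact crossing_add_crossing_midpoint hlt.ne ht
      · refine hsimple.crossings_add_crossings_eq_one hmem' hmb hma ?_ h (hvert f)
        filter_upwards [self_mem_nhdsWithin] with t ht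
        rw [crossing_comm b a, crossing_comm b a]
        exact crossing_add_crossing_midpoint hlt.ne ht
    · refine crossings_add_crossings_eq_zero fun s hs => ⟨hvert f s hs, fun hms => ?_⟩
      have hme : m ∈ polyline (D.arc e) := by
        rcases hab with h | h
        · exact segment_subset_polyline h hmem
        · exact segment_subset_polyline h hmem'
      obtain ⟨v, hv1, -, hmv⟩ := D.arc_inter_arc e e.2 f f.2 (fun h => hfe (Subtype.ext h.symm)) m
        ⟨hme, segment_subset_polyline hs hms⟩
      have hml : m ∈ D.arc e := by
        obtain ⟨u, v', he, hu, hv'⟩ := D.arc_ends e e.2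
        rw [he] at hv1
        rcases Sym2.mem_iff.1 hv1 with rfl | rfl
        · rw [hmv]; exact List.mem_of_head? hu
        · rw [hmv]; exact List.mem_of_getLast? hv'
      rcases hab with h | h
      · rcases hsimple.eq_of_mem_segment hml h hmem with h | h
        · exact hma h
        · exact hmb h
      · rcases hsimple.eq_of_mem_segment hml h hmem' with h | h
        · exact hmb h
        · exact hma h
  obtain ⟨t, h1, h2, h3⟩ := ((eventually_all.2 hcr).and
    ((eventually_mem_leftStrip_midpoint hlt hδ).and
      (eventually_mem_leftStrip_midpoint hlt hδ'))).exists
  rw [← H _ h2.1, ← H' _ h3.2]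
  unfold parity
  rw [← sum_add_distrib]
  calc _ = ∑ f : G.edgeSet, c f * (if f = e then 1 else 0) :=
        sum_congr rfl fun f _ => by rw [← mul_add]; exact congrArg _ (h1 f)
    _ = c e := by simp

/-- Only two steps leave a bend, so the rotation there, having no fixed point, exchanges them. -/
theorem isLeftValue_bend [Finite V] (hv : ∀ a b, (a, b) ∈ D.steps → a.1 ≠ b.1)
    {w : ℝ × ℝ → ZMod 2} (hw : LocallyConstantOff w D.steps) {d : G.Dart} {a b c : ℝ × ℝ}
    (h : [a, b, c] <:+: D.path d) {ζ : ZMod 2} (hζ : IsLeftValue w a b ζ) :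
    IsLeftValue w b c ζ := by
  have hS := D.planeSegments hv
  have hab : (b, a) ∈ D.steps := hS.symm _ _ ⟨d, List.IsInfix.trans ⟨[], [c], by simp⟩ h⟩
  have hbc : (b, c) ∈ D.steps := ⟨d, List.IsInfix.trans ⟨[a], [], by simp⟩ h⟩
  have hac : a ≠ c := by
    have := (D.nodup_path d).sublist h.sublist
    simp only [List.nodup_cons, List.mem_cons, List.not_mem_nil] at this
    tauto
  obtain ⟨σ, h1, -, h3⟩ := hS.exists_rotation b
  obtain ⟨ζ', hζ'⟩ := hS.exists_isLeftValue hw hbc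
  have hne := h1 ⟨c, hbc⟩ ⟨a, hab⟩ (fun h => hac (congrArg Subtype.val h))
  have hσ : (σ ⟨c, hbc⟩).1 = a := by
    rcases D.neighbor_of_bend h (σ ⟨c, hbc⟩).2 with h' | h'
    · exact h'
    · exact absurd (Subtype.ext h') hne
  rw [h3 w hw ⟨c, hbc⟩ ζ ζ' (by rw [hσ]; exact hζ) hζ']
  exact hζ'

theorem isLeftValue_last [Finite V] (hv : ∀ a b, (a, b) ∈ D.steps → a.1 ≠ b.1)
    {w : ℝ × ℝ → ZMod 2} (hw : LocallyConstantOff w D.steps) (d : G.Dart) {ζ : ZMod 2}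
    (hζ : IsLeftValue w (D.point d.fst) (D.first d) ζ) :
    IsLeftValue w (D.first d.symm) (D.point d.snd) ζ := by
  obtain ⟨t, ht⟩ := D.exists_path_eq d
  refine isLeftValue_of_suffix t _ _ (fun x y z hxyz h => ?_) hζ _ _ ?_
  · rw [← ht] at hxyz
    exact D.isLeftValue_bend hv hw hxyz h
  · rw [← ht]
    obtain ⟨t', ht'⟩ := D.exists_path_eq d.symm
    rw [path_symm] at ht'
    have := congrArg List.reverse ht'
    rw [List.reverse_reverse] at this
    rw [this]
    exact ⟨t'.reverse, by simp⟩

/-- The points following the point of `v` on the arcs at `v` correspond to the darts at `v`. -/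
noncomputable def dartEquiv (v : V) :
    {d : G.Dart // d.fst = v} ≃ {q // (D.point v, q) ∈ D.steps} :=
  Equiv.ofBijective (fun d => ⟨D.first d.1, by
      have := D.first_mem_steps d.1; rw [d.2] at this; exact this⟩)
    ⟨fun d d' h => Subtype.ext (D.first_injective (d.2.trans d'.2.symm)
        (congrArg Subtype.val h)),
      fun q => by
        obtain ⟨d, h1, h2⟩ := D.exists_dart_of_mem_steps q.2
        exact ⟨⟨d, h1⟩, Subtype.ext h2⟩⟩

theorem dartEquiv_coe (v : V) (d : {d : G.Dart // d.fst = v}) :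
    (D.dartEquiv v d : ℝ × ℝ) = D.first d.1 := rfl

theorem exists_rotationSystem [Fintype V] [DecidableEq V] [DecidableRel G.Adj]
    (hv : ∀ a b, (a, b) ∈ D.steps → a.1 ≠ b.1) (hδ : ∀ v, 3 ≤ G.degree v) :
    ∃ σ : Equiv.Perm G.Dart, (∀ d, (σ d).fst = d.fst) ∧ (∀ d, σ d ≠ d) ∧
      (∀ d, σ (σ d) ≠ d) ∧ ∀ c : G.edgeSet → ZMod 2,
        (∀ v, ∑ e : G.edgeSet, (if v ∈ (e : Sym2 V) then c e else 0) = 0) →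
          ∃ w : G.Dart → ZMod 2, (∀ d, w (facePerm σ d) = w d) ∧
            ∀ d, w d + w d.symm = c ⟨d.edge, d.edge_mem⟩ := by
  have hS := D.planeSegments hv
  choose ρ h1 h2 h3 using fun v => hS.exists_rotation (D.point v)
  -- The rotation of segments at each vertex is transported to the darts at it; `σ` glues these over
  -- all vertices.
  let ρ' : ∀ v, Equiv.Perm {d : G.Dart // d.fst = v} := fun v =>
    ((D.dartEquiv v).trans (ρ v)).trans (D.dartEquiv v).symm
  have hρ' : ∀ v x, D.dartEquiv v (ρ' v x) = ρ v (D.dartEquiv v x) := fun v x => by simp [ρ']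
  let F := Equiv.sigmaFiberEquiv (fun d : G.Dart => d.fst)
  let σ : Equiv.Perm G.Dart := (F.symm.trans (Equiv.sigmaCongrRight ρ')).trans F
  have hσ : ∀ d, σ d = (ρ' d.fst ⟨d, rfl⟩).1 := fun d => rfl
  have hfst : ∀ d, (σ d).fst = d.fst := fun d => (ρ' d.fst ⟨d, rfl⟩).2
  have hσ' : ∀ v (x : {d : G.Dart // d.fst = v}), σ x.1 = (ρ' v x).1 := by
    rintro v ⟨d, rfl⟩; rfl
  have hfib : ∀ d : G.Dart, ∃ x y : {d' : G.Dart // d'.fst = d.fst},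
      x ≠ ⟨d, rfl⟩ ∧ y ≠ ⟨d, rfl⟩ ∧ y ≠ x := by
    intro d
    have hcard : 2 < Fintype.card {d' : G.Dart // d'.fst = d.fst} := by
      rw [Fintype.card_subtype, G.dart_fst_fiber_card_eq_degree]
      exact hδ _
    obtain ⟨x, hx⟩ := Fintype.exists_ne_of_one_lt_card (by omega)
      (⟨d, rfl⟩ : {d' : G.Dart // d'.fst = d.fst})
    obtain ⟨y, hy⟩ := Finset.exists_mem_notMem_of_card_lt_card
      (s := {⟨d, rfl⟩, x}) (t := (Finset.univ : Finset {d' : G.Dart // d'.fst = d.fst}))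
      (lt_of_le_of_lt Finset.card_le_two hcard)
    simp only [Finset.mem_insert, Finset.mem_singleton, not_or] at hy
    exact ⟨x, y, hx, hy.2.1, hy.2.2⟩
  refine ⟨σ, hfst, ?_, ?_, ?_⟩
  · intro d h
    obtain ⟨x, y, hx, -, -⟩ := hfib d
    rw [hσ] at h
    refine h1 d.fst (D.dartEquiv _ ⟨d, rfl⟩) (D.dartEquiv _ x) (by simpa using hx) ?_
    rw [← hρ', show ρ' d.fst ⟨d, rfl⟩ = ⟨d, rfl⟩ from Subtype.ext h]
  · intro d h
    obtain ⟨x, y, hx, hy, hyx⟩ := hfib d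
    have e : σ (σ d) = (ρ' d.fst (ρ' d.fst ⟨d, rfl⟩)).1 := by rw [hσ d, hσ']
    rw [e] at h
    refine h2 d.fst (D.dartEquiv _ ⟨d, rfl⟩) (D.dartEquiv _ x) (D.dartEquiv _ y) (by simpa using hx)
      (by simpa using hy) (by simpa using hyx) ?_
    rw [← hρ', ← hρ', show ρ' d.fst (ρ' d.fst ⟨d, rfl⟩) = ⟨d, rfl⟩ from Subtype.ext h]
  · intro c hc
    have hw := D.locallyConstantOff_parity hv hc
    choose w hw' using fun d : G.Dart => hS.exists_isLeftValue hw (D.first_mem_steps d)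
    have hne : ∀ d, D.point d.fst ≠ D.first d := fun d h =>
      hS.ne _ _ (D.first_mem_steps d) (by rw [h])
    refine ⟨w, fun d => ?_, fun d => ?_⟩
    -- The value `w d` on the left of the first step of `d` is carried to its last step. Since `σ g
    -- = d.symm`, the sector at the arrival vertex carries it on to the first step of `g`.
    · set g := facePerm σ d with hg
      have hgf : g.fst = d.snd := fst_facePerm hfst d
      have hσg : σ g = d.symm := apply_facePerm d
      have e1 : (ρ g.fst (D.dartEquiv g.fst ⟨g, rfl⟩)).1 = D.first d.symm := by
        rw [← hρ', dartEquiv_coe, ← hσ, hσg]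
      have hlast := D.isLeftValue_last hv hw d (hw' d)
      refine (h3 g.fst _ hw (D.dartEquiv g.fst ⟨g, rfl⟩) (w d) (w g) ?_ (hw' g)).symm
      rw [e1, hgf]
      exact hlast
    · refine D.isLeftValue_add_isLeftValue hv c ⟨d.edge, d.edge_mem⟩
        (D.pair_infix_arc (D.first_infix d)) (hw' d) ?_
      have hlast := D.isLeftValue_last hv hw d.symm (hw' d.symm)
      rwa [SimpleGraph.Dart.symm_symm] at hlast

end PlaneDrawing

/-! ### Linear images of drawings and removal of vertical segments -/

theorem image_segment_linearMap (f : ℝ × ℝ →ₗ[ℝ] ℝ × ℝ) (a b : ℝ × ℝ) :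
    f '' segment ℝ a b = segment ℝ (f a) (f b) :=
  image_segment ℝ f.toAffineMap a b

theorem polyline_map (f : ℝ × ℝ →ₗ[ℝ] ℝ × ℝ) : ∀ l : List (ℝ × ℝ),
    polyline (l.map f) = f '' polyline l
  | [] => by simp [polyline]
  | [a] => by simp [polyline]
  | a :: b :: l => by
    have ih := polyline_map f (b :: l)
    simp only [List.map_cons] at ih
    simp only [List.map_cons, polyline, image_union, ih]
    rw [image_segment_linearMap]

theorem IsSimplePolyline.map {f : ℝ × ℝ →ₗ[ℝ] ℝ × ℝ} (hf : Function.Injective f) :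
    ∀ {l : List (ℝ × ℝ)}, IsSimplePolyline l → IsSimplePolyline (l.map f)
  | [], _ => trivial
  | [_], _ => trivial
  | a :: b :: l, h => by
    refine ⟨hf.ne h.1, ?_, IsSimplePolyline.map hf h.2.2⟩
    have := polyline_map f (b :: l)
    simp only [List.map_cons] at this
    rw [this, ← image_segment_linearMap, ← image_inter hf, h.2.1, image_singleton]

theorem polySteps_map (f : ℝ × ℝ → ℝ × ℝ) : ∀ l : List (ℝ × ℝ),
    polySteps (l.map f) = (polySteps l).map fun s => (f s.1, f s.2)
  | [] => rfl
  | [_] => rfl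
  | a :: b :: l => by
    have ih := polySteps_map f (b :: l)
    simp only [List.map_cons] at ih
    simp only [List.map_cons, polySteps, ih]

namespace PlaneDrawing

variable {V : Type*} {G : SimpleGraph V}

/-- The image of a drawing under an injective linear map. -/
def map (D : PlaneDrawing G) (f : ℝ × ℝ →ₗ[ℝ] ℝ × ℝ) (hf : Function.Injective f) :
    PlaneDrawing G where
  point v := f (D.point v)
  arc e := (D.arc e).map f
  point_injective := hf.comp D.point_injective
  arc_simple e he := (D.arc_simple e he).map hf
  arc_ends e he := by
    obtain ⟨u, v, h, h1, h2⟩ := D.arc_ends e he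
    exact ⟨u, v, h, by simp [h1], by simp [h2]⟩
  vertex_on_arc e he v hv := by
    rw [polyline_map] at hv
    exact D.vertex_on_arc e he v (hf.mem_set_image.1 hv)
  arc_inter_arc e he e' he' hne x hx := by
    rw [polyline_map, polyline_map, ← image_inter hf] at hx
    obtain ⟨y, hy, rfl⟩ := hx
    obtain ⟨v, h1, h2, rfl⟩ := D.arc_inter_arc e he e' he' hne y hy
    exact ⟨v, h1, h2, rfl⟩

/-- A horizontal shear with parameter `m` makes a given segment vertical for at most one `m`, and
there are finitely many segments. -/
theorem exists_nonvertical [Finite V] (D : PlaneDrawing G) :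
    ∃ D' : PlaneDrawing G, ∀ a b, (a, b) ∈ D'.steps → a.1 ≠ b.1 := by
  have hfin : D.steps.Finite := D.finite_steps
  have hbad : ∀ s ∈ D.steps,
      {m : ℝ | s.1.1 + m * s.1.2 = s.2.1 + m * s.2.2}.Finite := by
    rintro ⟨a, b⟩ ⟨d, hd⟩
    have hne : a ≠ b := by
      have := (D.nodup_path d).sublist hd.sublist
      simpa using this
    refine Set.Subsingleton.finite ?_
    intro m hm m' hm'
    have hm : a.1 + m * a.2 = b.1 + m * b.2 := hm
    have hm' : a.1 + m' * a.2 = b.1 + m' * b.2 := hm'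
    have h2 : a.2 ≠ b.2 := fun h => hne (Prod.ext (by rw [h] at hm; linarith) h)
    have : (m - m') * (a.2 - b.2) = 0 := by linear_combination hm - hm'
    rcases mul_eq_zero.1 this with h | h
    · linarith
    · exact absurd (by linarith) h2
  obtain ⟨m, hm⟩ := (hfin.biUnion hbad).infinite_compl.nonempty
  simp only [mem_compl_iff, mem_iUnion, not_exists] at hm
  let f : ℝ × ℝ →ₗ[ℝ] ℝ × ℝ :=
    { toFun := fun x => (x.1 + m * x.2, x.2)
      map_add' := fun x y => Prod.ext (by simp only [Prod.fst_add, Prod.snd_add]; ring) rfl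
      map_smul' := fun r x => Prod.ext (by simp; ring) rfl }
  have hf : Function.Injective f := by
    intro x y h
    have h1 : x.1 + m * x.2 = y.1 + m * y.2 := by
      have := congrArg Prod.fst h; exact this
    have h2 : x.2 = y.2 := by
      have := congrArg Prod.snd h; exact this
    exact Prod.ext (by rw [h2] at h1; linarith) h2
  refine ⟨D.map f hf, ?_⟩
  have main : ∀ (d : G.Dart) a b, (a, b) ∈ polySteps ((D.map f hf).arc d.edge) → a.1 ≠ b.1 := by
    intro d a b h
    rw [show (D.map f hf).arc d.edge = (D.arc d.edge).map f from rfl, polySteps_map] at h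
    obtain ⟨s, hs, hse⟩ := List.mem_map.1 h
    obtain ⟨rfl, rfl⟩ := Prod.mk.inj hse
    exact hm s (D.mem_steps_of_mem_polySteps d.edge_mem hs)
  rintro a b ⟨d, hd⟩
  rcases (D.map f hf).pair_infix_arc hd with h | h
  · exact main d a b h
  · exact (main d b a h).symm

end PlaneDrawing

/-- The upper bound for the number of edges. -/
theorem SimpleGraph.IsPlanar.five_mul_card_edgeFinset_add_twenty_le {V : Type*} [Fintype V]
    {G : SimpleGraph V} [DecidableRel G.Adj] (hP : G.IsPlanar) (hG : G.CliqueFree 3)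
    (hC : (SimpleGraph.cycleGraph 6).Free G) (hδ : 3 ≤ G.minDegree) :
    5 * G.edgeFinset.card + 20 ≤ 9 * Fintype.card V := by
  classical
  obtain ⟨D⟩ := hP
  obtain ⟨D, hv⟩ := D.exists_nonvertical
  -- Without vertices the minimum degree is 0 by convention.
  have : Nonempty V := by
    by_contra h
    rw [not_nonempty_iff] at h
    simp [SimpleGraph.minDegree] at hδ
  have hdeg : ∀ v, 3 ≤ G.degree v := fun v => hδ.trans (G.minDegree_le_degree v)
  exact _root_.five_mul_card_edgeFinset_add_twenty_le hG hC hdeg (D.exists_rotationSystem hv hdeg)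

/-! ### Straight-line drawings and integer tests for segments -/

/-- A straight-line drawing. -/
theorem SimpleGraph.isPlanar_of_segments {V : Type*} {G : SimpleGraph V} (p : V → ℝ × ℝ)
    (hp : Function.Injective p)
    (h : ∀ u v x y, G.Adj u v → G.Adj x y → s(u, v) ≠ s(x, y) →
      ∀ z ∈ segment ℝ (p u) (p v), z ∈ segment ℝ (p x) (p y) →
        (z = p u ∨ z = p v) ∧ (z = p x ∨ z = p y))
    (hdeg : ∀ v w, ∃ u, u ≠ w ∧ G.Adj v u) : G.IsPlanar := by
  let arc : Sym2 V → List (ℝ × ℝ) := fun e => [p (Quot.out e).1, p (Quot.out e).2]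
  have hout : ∀ e : Sym2 V, s((Quot.out e).1, (Quot.out e).2) = e := fun e => Quot.out_eq e
  have hadj : ∀ e ∈ G.edgeSet, G.Adj (Quot.out e).1 (Quot.out e).2 := fun e he => by
    rw [← SimpleGraph.mem_edgeSet, hout]; exact he
  have hpoly : ∀ e, polyline (arc e) = segment ℝ (p (Quot.out e).1) (p (Quot.out e).2) := by
    intro e
    change segment ℝ _ _ ∪ {p (Quot.out e).2} = _
    rw [union_eq_left, singleton_subset_iff]
    exact right_mem_segment ..
  have hinter : ∀ e ∈ G.edgeSet, ∀ f ∈ G.edgeSet, e ≠ f →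
      ∀ x ∈ polyline (arc e) ∩ polyline (arc f), ∃ v : V, v ∈ e ∧ v ∈ f ∧ x = p v := by
    rintro e he f hf hef x ⟨hx, hx'⟩
    rw [hpoly] at hx hx'
    obtain ⟨h1, h2⟩ := h _ _ _ _ (hadj e he) (hadj f hf) (by rwa [hout, hout]) x hx hx'
    have m1 : ∃ v ∈ e, x = p v := by
      rcases h1 with h1 | h1
      · exact ⟨_, Sym2.out_fst_mem e, h1⟩
      · exact ⟨_, Sym2.out_snd_mem e, h1⟩
    have m2 : ∃ v ∈ f, x = p v := by
      rcases h2 with h2 | h2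
      · exact ⟨_, Sym2.out_fst_mem f, h2⟩
      · exact ⟨_, Sym2.out_snd_mem f, h2⟩
    obtain ⟨v, hv, rfl⟩ := m1
    obtain ⟨v', hv', hvv⟩ := m2
    exact ⟨v, hv, by rwa [hp hvv], rfl⟩
  refine ⟨⟨p, arc, hp, ?_, ?_, ?_, hinter⟩⟩
  · intro e he
    refine ⟨hp.ne (hadj e he).ne, ?_, trivial⟩
    change segment ℝ _ _ ∩ {p (Quot.out e).2} = _
    rw [inter_eq_right, singleton_subset_iff]
    exact right_mem_segment ..
  · intro e _
    exact ⟨(Quot.out e).1, (Quot.out e).2, (hout e).symm, rfl, rfl⟩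
  · intro e he v hv
    rw [hpoly] at hv
    by_contra hve
    -- An edge at `v` turns a vertex lying on a foreign arc into a forbidden meeting of two
    -- segments.
    obtain ⟨u, -, hu⟩ := hdeg v v
    have hne : e ≠ s(v, u) := fun h => hve (by rw [h]; exact Sym2.mem_mk_left _ _)
    obtain ⟨h1, -⟩ := h _ _ _ _ (hadj e he) hu (by rwa [hout]) (p v) hv (left_mem_segment ..)
    rcases h1 with h1 | h1
    · rw [hp h1] at hve; exact hve (Sym2.out_fst_mem e)
    · rw [hp h1] at hve; exact hve (Sym2.out_snd_mem e)

/-- The real point with given integer coordinates. -/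
def intPoint (a : ℤ × ℤ) : ℝ × ℝ := (a.1, a.2)

/-- The inner product of integer vectors. -/
def intDot (u a : ℤ × ℤ) : ℤ := u.1 * a.1 + u.2 * a.2

/-- The functional `u` strictly separates the segment `a b` from the segment `c d`. -/
def intSeparates (u a b c d : ℤ × ℤ) : Bool :=
  decide (intDot u a < intDot u c) && decide (intDot u a < intDot u d) &&
    decide (intDot u b < intDot u c) && decide (intDot u b < intDot u d)

/-- The segments `a b` and `a d` leave `a` in different directions. -/
def intDiverge (a b d : ℤ × ℤ) : Bool :=
  decide ((b.1 - a.1) * (d.2 - a.2) - (b.2 - a.2) * (d.1 - a.1) ≠ 0) ||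
    decide ((b.1 - a.1) * (d.1 - a.1) + (b.2 - a.2) * (d.2 - a.2) < 0)

/-- A test for two segments with integer end points to meet only in common end points. -/
def intMeetAtEnds (a b c d : ℤ × ℤ) : Bool :=
  -- The candidates are normals of the two segments and, for collinear segments, the direction of
  -- the first.
  [(b.2 - a.2, a.1 - b.1), (d.2 - c.2, c.1 - d.1), (b.1 - a.1, b.2 - a.2)].any
      (fun u => intSeparates u a b c d || intSeparates u c d a b) ||
    (a == c && intDiverge a b d) || (a == d && intDiverge a b c) ||
    (b == c && intDiverge b a d) || (b == d && intDiverge b a c)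

theorem intSeparates_sound {u a b c d : ℤ × ℤ} (h : intSeparates u a b c d) (z : ℝ × ℝ)
    (h1 : z ∈ segment ℝ (intPoint a) (intPoint b)) (h2 : z ∈ segment ℝ (intPoint c) (intPoint d)) :
    False := by
  simp only [intSeparates, Bool.and_eq_true, decide_eq_true_eq] at h
  obtain ⟨⟨⟨h3, h4⟩, h5⟩, h6⟩ := h
  obtain ⟨s, s0, s1, e1, e2⟩ := mem_segment_iff_exists_coord.1 h1
  obtain ⟨t, t0, t1, e3, e4⟩ := mem_segment_iff_exists_coord.1 h2
  simp only [intPoint] at e1 e2 e3 e4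
  set A : ℝ := (intDot u a : ℝ) with hA
  set B : ℝ := (intDot u b : ℝ) with hB
  set C : ℝ := (intDot u c : ℝ) with hC
  set D : ℝ := (intDot u d : ℝ) with hD
  have h3 : A < C := by simp only [hA, hC]; exact_mod_cast h3
  have h4 : A < D := by simp only [hA, hD]; exact_mod_cast h4
  have h5 : B < C := by simp only [hB, hC]; exact_mod_cast h5
  have h6 : B < D := by simp only [hB, hD]; exact_mod_cast h6
  have k1 : u.1 * z.1 + u.2 * z.2 = A + s * (B - A) := by
    simp only [hA, hB, intDot]; push_cast; rw [e1, e2]; ring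
  have k2 : u.1 * z.1 + u.2 * z.2 = C + t * (D - C) := by
    simp only [hC, hD, intDot]; push_cast; rw [e3, e4]; ring
  have l1 : A + s * (B - A) ≤ max A B := by
    have := mul_le_mul_of_nonneg_left (le_max_right A B) s0
    have := mul_le_mul_of_nonneg_left (le_max_left A B) (sub_nonneg.2 s1)
    nlinarith
  have l2 : min C D ≤ C + t * (D - C) := by
    have := mul_le_mul_of_nonneg_left (min_le_right C D) t0
    have := mul_le_mul_of_nonneg_left (min_le_left C D) (sub_nonneg.2 t1)
    nlinarith
  have l3 : max A B < min C D := max_lt (lt_min h3 h4) (lt_min h5 h6)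
  linarith

theorem intDiverge_sound {a b d : ℤ × ℤ} (h : intDiverge a b d) (z : ℝ × ℝ)
    (h1 : z ∈ segment ℝ (intPoint a) (intPoint b)) (h2 : z ∈ segment ℝ (intPoint a) (intPoint d)) :
    z = intPoint a := by
  simp only [intDiverge, Bool.or_eq_true, decide_eq_true_eq] at h
  obtain ⟨s, s0, s1, e1, e2⟩ := mem_segment_iff_exists_coord.1 h1
  obtain ⟨t, t0, t1, e3, e4⟩ := mem_segment_iff_exists_coord.1 h2
  simp only [intPoint] at e1 e2 e3 e4
  have f1 : s * ((b.1 : ℝ) - a.1) = t * ((d.1 : ℝ) - a.1) := by linarith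
  have f2 : s * ((b.2 : ℝ) - a.2) = t * ((d.2 : ℝ) - a.2) := by linarith
  have hs : s * ((b.1 : ℝ) - a.1) = 0 ∧ s * ((b.2 : ℝ) - a.2) = 0 := by
    rcases h with h | h
    · have h : ((b.1 : ℝ) - a.1) * (d.2 - a.2) - (b.2 - a.2) * (d.1 - a.1) ≠ 0 := by
        exact_mod_cast h
      have : s * (((b.1 : ℝ) - a.1) * (d.2 - a.2) - (b.2 - a.2) * (d.1 - a.1)) = 0 := by
        linear_combination ((d.2 : ℝ) - a.2) * f1 - ((d.1 : ℝ) - a.1) * f2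
      have := (mul_eq_zero.1 this).resolve_right h
      simp [this]
    · have h : ((b.1 : ℝ) - a.1) * (d.1 - a.1) + (b.2 - a.2) * (d.2 - a.2) < 0 := by
        exact_mod_cast h
      -- For opposite directions the squared length of the displacement is a nonnegative multiple of
      -- a negative inner product, hence zero.
      have k : (s * ((b.1 : ℝ) - a.1)) ^ 2 + (s * ((b.2 : ℝ) - a.2)) ^ 2 =
          (s * t) * (((b.1 : ℝ) - a.1) * (d.1 - a.1) + (b.2 - a.2) * (d.2 - a.2)) := by
        linear_combination s * ((b.1 : ℝ) - a.1) * f1 + s * ((b.2 : ℝ) - a.2) * f2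
      have k2 : (s * t) * (((b.1 : ℝ) - a.1) * (d.1 - a.1) + (b.2 - a.2) * (d.2 - a.2)) ≤ 0 :=
        mul_nonpos_of_nonneg_of_nonpos (mul_nonneg s0 t0) h.le
      rw [← k] at k2
      constructor <;> nlinarith [sq_nonneg (s * ((b.1 : ℝ) - a.1)),
        sq_nonneg (s * ((b.2 : ℝ) - a.2))]
  exact Prod.ext (by simp only [intPoint]; linarith [hs.1]) (by simp only [intPoint]; linarith [hs.2])

theorem intMeetAtEnds_sound {a b c d : ℤ × ℤ} (h : intMeetAtEnds a b c d) (z : ℝ × ℝ)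
    (h1 : z ∈ segment ℝ (intPoint a) (intPoint b)) (h2 : z ∈ segment ℝ (intPoint c) (intPoint d)) :
    (z = intPoint a ∨ z = intPoint b) ∧ (z = intPoint c ∨ z = intPoint d) := by
  simp only [intMeetAtEnds, Bool.or_eq_true, Bool.and_eq_true, beq_iff_eq] at h
  rcases h with (((h | ⟨rfl, h⟩) | ⟨rfl, h⟩) | ⟨rfl, h⟩) | ⟨rfl, h⟩
  · obtain ⟨u, -, hu⟩ := List.any_eq_true.1 h
    simp only [Bool.or_eq_true] at hu
    rcases hu with h | h
    · exact (intSeparates_sound h z h1 h2).elim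
    · exact (intSeparates_sound h z h2 h1).elim
  · have := intDiverge_sound h z h1 h2
    tauto
  · rw [segment_symm] at h2
    have := intDiverge_sound h z h1 h2
    tauto
  · rw [segment_symm] at h1
    have := intDiverge_sound h z h1 h2
    tauto
  · rw [segment_symm] at h1 h2
    have := intDiverge_sound h z h1 h2
    tauto

/-! ### The family of nested rings

Ring `r` has the kind `1` (innermost), `2` (middle) or `3` (outermost). The positions `0, …, 3` of a
ring are the midpoints of the sides of a square, `4, …, 7` its corners, and `8, 9` are two points
inside the square. The square of each ring is the image of the preceding one under rotation by a
right angle and scaling by three. -/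

/-- The kind of ring `r` when there are `K` middle rings; `0` means that there is no such ring. -/
def ringKind (K r : ℕ) : ℕ :=
  if r = 0 then 0 else if r = 1 then 1 else if r ≤ K + 1 then 2 else if r = K + 2 then 3 else 0

/-- The positions that occur in a ring. -/
def ringMembers (t : ℕ) : List ℕ :=
  [[], [0, 1, 2, 3], [0, 1, 2, 3, 4, 5, 6, 7, 8, 9], [0, 1, 2, 3, 8, 9]].getD t []

/-- Neighbours in the same ring. -/
def sameNbrs (t j : ℕ) : List ℕ :=
  ([[], [[1, 3], [0, 2], [1, 3], [0, 2]],
    [[4, 7], [4, 5], [5, 6], [6, 7], [0, 1, 8], [1, 2, 9], [2, 3, 9], [3, 0, 8], [4, 7], [5, 6]],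
    [[1, 3, 8], [0, 2], [1, 3, 9], [0, 2], [], [], [], [], [0], [2]]].getD t []).getD j []

/-- Neighbours in the next ring. -/
def upNbrs (t j : ℕ) : List ℕ :=
  ([[], [[3], [8], [1], [9]], [[3], [], [1], [], [8], [8], [9], [9]]].getD t []).getD j []

/-- Neighbours in the preceding ring, of kind `t`. -/
def downNbrs (t j : ℕ) : List ℕ :=
  ([[], [[], [2], [], [0], [], [], [], [], [1], [3]],
    [[], [2], [], [0], [], [], [], [], [4, 5], [6, 7]]].getD t []).getD j []

theorem ringKind_lt (K r : ℕ) : ringKind K r < 4 := by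
  unfold ringKind; split_ifs <;> omega

/-- Reduces local statements about all rings and all `K` to a finite list that `decide` can treat.
-/
theorem ringKind_pair (K r : ℕ) (hK : 1 ≤ K) :
    (ringKind K r, ringKind K (r + 1)) ∈
      [(0, 1), (1, 2), (2, 2), (2, 3), (3, 0), (0, 0)] := by
  unfold ringKind
  split_ifs <;> first | omega | contradiction | simp

theorem mem_sameNbrs_comm {t j j' : ℕ} (h : j' ∈ sameNbrs t j) : j ∈ sameNbrs t j' := by
  have key : ∀ t < 4, ∀ j < 10, ∀ j' ∈ sameNbrs t j, j ∈ sameNbrs t j' := by decide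
  by_cases ht : t < 4
  · by_cases hj : j < 10
    · exact key t ht j hj j' h
    · have : ∀ t < 4, ∀ j, 10 ≤ j → sameNbrs t j = [] := by
        intro t ht j hj
        obtain ⟨i, rfl⟩ := Nat.exists_eq_add_of_le' hj
        interval_cases t <;> rfl
      rw [this t ht j (by omega)] at h
      simp at h
  · obtain ⟨i, rfl⟩ := Nat.exists_eq_add_of_le' (not_lt.1 ht)
    have : sameNbrs (i + 4) j = [] := rfl
    simp [this] at h

theorem not_mem_sameNbrs_self {t j : ℕ} (ht : t < 4) (hj : j < 10) : j ∉ sameNbrs t j := by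
  have key : ∀ t < 4, ∀ j < 10, j ∉ sameNbrs t j := by decide
  exact key t ht j hj

/-- Adjacency between two positions of rings. -/
def RingAdj (K : ℕ) (p q : ℕ × ℕ) : Prop :=
  (q.1 = p.1 ∧ q.2 ∈ sameNbrs (ringKind K p.1) p.2) ∨
  (q.1 = p.1 + 1 ∧ q.2 ∈ upNbrs (ringKind K p.1) p.2) ∨
  (p.1 = q.1 + 1 ∧ p.2 ∈ upNbrs (ringKind K q.1) q.2)

instance (K : ℕ) (p q : ℕ × ℕ) : Decidable (RingAdj K p q) := by
  unfold RingAdj; infer_instance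

theorem RingAdj.symm {K : ℕ} {p q : ℕ × ℕ} (h : RingAdj K p q) : RingAdj K q p := by
  rcases h with ⟨h1, h2⟩ | h | h
  · exact Or.inl ⟨h1.symm, by rw [h1]; exact mem_sameNbrs_comm h2⟩
  · exact Or.inr (Or.inr h)
  · exact Or.inr (Or.inl h)

/-- The positions that occur. -/
def ringVertices (K : ℕ) : Finset (ℕ × ℕ) :=
  (Finset.range (K + 4) ×ˢ Finset.range 10).filter fun p => p.2 ∈ ringMembers (ringKind K p.1)

theorem lt_of_mem_ringMembers {t j : ℕ} (ht : t < 4) (h : j ∈ ringMembers t) : j < 10 := by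
  have key : ∀ t < 4, ∀ j ∈ ringMembers t, j < 10 := by decide
  exact key t ht j h

theorem mem_ringVertices {K : ℕ} {p : ℕ × ℕ} :
    p ∈ ringVertices K ↔ p.2 ∈ ringMembers (ringKind K p.1) := by
  simp only [ringVertices, Finset.mem_filter, Finset.mem_product, Finset.mem_range,
    and_iff_right_iff_imp]
  intro h
  refine ⟨?_, lt_of_mem_ringMembers (ringKind_lt _ _) h⟩
  by_contra hc
  have : ringKind K p.1 = 0 := by unfold ringKind; split_ifs <;> omega
  rw [this] at h
  simp [ringMembers] at h

theorem ringKind_ne_zero_of_mem {K : ℕ} {p : ℕ × ℕ} (hp : p ∈ ringVertices K) :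
    ringKind K p.1 ≠ 0 := by
  intro h
  rw [mem_ringVertices, h] at hp
  simp [ringMembers] at hp

/-- The number of neighbours of position `j` in a ring of kind `t` that follows a ring of
kind `t'`. -/
def ringDegree (t' t j : ℕ) : ℕ :=
  (sameNbrs t j).length + (upNbrs t j).length + (downNbrs t' j).length

section Graph

variable {W : Type*} (K : ℕ) (pos : W → ℕ × ℕ)

/-- The graph of nested rings, on vertices labelled by positions. -/
def ringGraph (hpos : ∀ w, pos w ∈ ringVertices K) : SimpleGraph W where
  Adj u v := RingAdj K (pos u) (pos v)
  symm := ⟨fun _ _ h => h.symm⟩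
  loopless := ⟨fun u h => by
    have hj := lt_of_mem_ringMembers (ringKind_lt _ _) (mem_ringVertices.1 (hpos u))
    rcases h with h | h | h
    · exact not_mem_sameNbrs_self (ringKind_lt _ _) hj h.2
    · omega
    · omega⟩

instance (hpos : ∀ w, pos w ∈ ringVertices K) : DecidableRel (ringGraph K pos hpos).Adj :=
  fun u v => inferInstanceAs (Decidable (RingAdj K (pos u) (pos v)))

variable {K pos}

/-- A lower bound on degrees suffices, since the edge bound for planar graphs supplies the other
inequality. -/
theorem ringDegree_le_degree [Fintype W] (hK : 1 ≤ K) (hpos : ∀ w, pos w ∈ ringVertices K)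
    (hsurj : ∀ p ∈ ringVertices K, ∃ w, pos w = p) (v : W) :
    ringDegree (ringKind K ((pos v).1 - 1)) (ringKind K (pos v).1) (pos v).2 ≤
      (ringGraph K pos hpos).degree v := by
  classical
  rcases hv : pos v with ⟨r, j⟩
  have hmem := hpos v
  rw [hv] at hmem
  have hr0 := ringKind_ne_zero_of_mem hmem
  have hr : r ≠ 0 := by
    rintro rfl
    exact hr0 rfl
  obtain ⟨s, rfl⟩ := Nat.exists_eq_succ_of_ne_zero hr
  simp only [Nat.succ_eq_add_one, Nat.add_sub_cancel] at *
  have hp1 := ringKind_pair K s hK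
  have hp2 := ringKind_pair K (s + 1) hK
  have hjm := mem_ringVertices.1 hmem
  simp only at hjm
  -- The three parts lie in different rings, so the list has no repetitions.
  let L : List (ℕ × ℕ) := (sameNbrs (ringKind K (s + 1)) j).map (fun x => (s + 1, x)) ++
    (upNbrs (ringKind K (s + 1)) j).map (fun x => (s + 2, x)) ++
    (downNbrs (ringKind K s) j).map (fun x => (s, x))
  have hnodup : L.Nodup := by
    have key : ∀ t < 4, ∀ j < 10, (sameNbrs t j).Nodup ∧ (upNbrs t j).Nodup ∧
        (downNbrs t j).Nodup := by decide
    have hj := lt_of_mem_ringMembers (ringKind_lt _ _) hjm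
    have inj : ∀ a : ℕ, Function.Injective (fun x : ℕ => (a, x)) := fun a x y h => by
      simpa using h
    refine List.nodup_append.2 ⟨List.nodup_append.2
      ⟨(key _ (ringKind_lt _ _) j hj).1.map (inj _), (key _ (ringKind_lt _ _) j hj).2.1.map (inj _),
        ?_⟩, (key _ (ringKind_lt _ _) j hj).2.2.map (inj _), ?_⟩
    · rintro a ha b hb rfl
      obtain ⟨x, -, rfl⟩ := List.mem_map.1 ha
      obtain ⟨y, -, hy⟩ := List.mem_map.1 hb
      simp at hy
    · rintro a ha b hb rfl
      obtain ⟨y, -, rfl⟩ := List.mem_map.1 hb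
      rcases List.mem_append.1 ha with ha | ha
      · obtain ⟨x, -, hx⟩ := List.mem_map.1 ha
        simp at hx
      · obtain ⟨x, -, hx⟩ := List.mem_map.1 ha
        simp at hx
  have hlen : L.length = ringDegree (ringKind K s) (ringKind K (s + 1)) j := by
    simp [L, ringDegree, add_assoc]
  have hL : ∀ q ∈ L, q ∈ ringVertices K ∧ RingAdj K (s + 1, j) q := by
    intro q hq
    rw [mem_ringVertices]
    rcases List.mem_append.1 hq with hq | hq
    · rcases List.mem_append.1 hq with hq | hq
      · obtain ⟨x, hx, rfl⟩ := List.mem_map.1 hq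
        refine ⟨?_, Or.inl ⟨rfl, hx⟩⟩
        have key : ∀ t < 4, ∀ j ∈ ringMembers t, ∀ x ∈ sameNbrs t j, x ∈ ringMembers t := by decide
        exact key _ (ringKind_lt _ _) _ hjm _ hx
      · obtain ⟨x, hx, rfl⟩ := List.mem_map.1 hq
        refine ⟨?_, Or.inr (Or.inl ⟨rfl, hx⟩)⟩
        have key : ∀ tt ∈ [(0, 1), (1, 2), (2, 2), (2, 3), (3, 0), (0, 0)],
            ∀ j ∈ ringMembers tt.1, ∀ x ∈ upNbrs tt.1 j, x ∈ ringMembers tt.2 := by decide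
        exact key _ hp2 _ hjm _ hx
    · obtain ⟨x, hx, rfl⟩ := List.mem_map.1 hq
      have key : ∀ tt ∈ [(0, 1), (1, 2), (2, 2), (2, 3), (3, 0), (0, 0)],
          ∀ j ∈ ringMembers tt.2, ∀ x ∈ downNbrs tt.1 j, x ∈ ringMembers tt.1 ∧
            j ∈ upNbrs tt.1 x := by decide
      obtain ⟨k1, k2⟩ := key _ hp1 _ hjm _ hx
      exact ⟨k1, Or.inr (Or.inr ⟨rfl, k2⟩)⟩
  rw [← hlen, ← List.toFinset_card_of_nodup hnodup]
  have hsub : L.toFinset ⊆ ((ringGraph K pos hpos).neighborFinset v).image pos := by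
    intro q hq
    obtain ⟨h1, h2⟩ := hL q (List.mem_toFinset.1 hq)
    obtain ⟨w, hw⟩ := hsurj q h1
    refine Finset.mem_image.2 ⟨w, ?_, hw⟩
    rw [SimpleGraph.mem_neighborFinset]
    change RingAdj K (pos v) (pos w)
    rw [hv, hw]
    exact h2
  exact (Finset.card_le_card hsub).trans Finset.card_image_le

theorem three_le_ringDegree {K : ℕ} (hK : 1 ≤ K) {p : ℕ × ℕ} (hp : p ∈ ringVertices K) :
    3 ≤ ringDegree (ringKind K (p.1 - 1)) (ringKind K p.1) p.2 := by
  obtain ⟨r, j⟩ := p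
  have hr : r ≠ 0 := by
    rintro rfl
    exact ringKind_ne_zero_of_mem hp rfl
  obtain ⟨s, rfl⟩ := Nat.exists_eq_succ_of_ne_zero hr
  have key : ∀ tt ∈ [(0, 1), (1, 2), (2, 2), (2, 3), (3, 0), (0, 0)],
    ∀ j ∈ ringMembers tt.2, 3 ≤ ringDegree tt.1 tt.2 j := by decide
  exact key _ (ringKind_pair K s hK) j (mem_ringVertices.1 hp)

-- Of the `K + 3` middle rings the first follows a ring of kind 1 and the other `K + 2` follow a
-- ring of kind 2.
open Finset in
theorem sum_ringVertices (K : ℕ) (f : ℕ → ℕ → ℕ → ℕ) :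
    ∑ p ∈ ringVertices (K + 3), f (ringKind (K + 3) (p.1 - 1)) (ringKind (K + 3) p.1) p.2 =
      (∑ j ∈ range 10, if j ∈ ringMembers 1 then f 0 1 j else 0) +
      (∑ j ∈ range 10, if j ∈ ringMembers 2 then f 1 2 j else 0) +
      (K + 2) * (∑ j ∈ range 10, if j ∈ ringMembers 2 then f 2 2 j else 0) +
      (∑ j ∈ range 10, if j ∈ ringMembers 3 then f 2 3 j else 0) := by
  unfold ringVertices
  rw [sum_filter, sum_product]
  have e0 : ∀ j, j ∉ ringMembers 0 := by simp [ringMembers]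
  have k0 : ringKind (K + 3) 0 = 0 := rfl
  have k1 : ringKind (K + 3) 1 = 1 := rfl
  have k2 : ∀ r, 2 ≤ r → r ≤ K + 4 → ringKind (K + 3) r = 2 := by
    intro r h1 h2; unfold ringKind; split_ifs <;> omega
  have k3 : ringKind (K + 3) (K + 5) = 3 := by unfold ringKind; split_ifs <;> omega
  have k4 : ringKind (K + 3) (K + 6) = 0 := by unfold ringKind; split_ifs <;> omega
  -- Rings `K + 6` and `K + 5` are split off at the top and rings 0, 1, 2 at the bottom.
  rw [show K + 3 + 4 = (K + 2) + 1 + 1 + 1 + 1 + 1 by ring, sum_range_succ, sum_range_succ,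
    sum_range_succ', sum_range_succ', sum_range_succ']
  have hmid : ∀ r ∈ range (K + 2), (∑ j ∈ range 10,
      if j ∈ ringMembers (ringKind (K + 3) (r + 1 + 1 + 1)) then
        f (ringKind (K + 3) (r + 1 + 1 + 1 - 1)) (ringKind (K + 3) (r + 1 + 1 + 1)) j else 0) =
      ∑ j ∈ range 10, if j ∈ ringMembers 2 then f 2 2 j else 0 := by
    intro r hr
    have := mem_range.1 hr
    rw [k2 (r + 1 + 1 + 1) (by omega) (by omega), k2 (r + 1 + 1 + 1 - 1) (by omega) (by omega)]
  rw [sum_congr rfl hmid, sum_const, card_range, smul_eq_mul]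
  have a3 : K + 5 - 1 = K + 4 := rfl
  have a4 : K + 6 - 1 = K + 5 := rfl
  simp only [a3, a4, zero_add, k4, k3, k2 (K + 4) (by omega) le_rfl, k0, k1, e0, if_false,
    sum_const_zero, add_zero, Nat.reduceAdd, Nat.reduceSub,
    k2 2 le_rfl (by omega), Nat.zero_sub]
  ring

theorem card_ringVertices (K : ℕ) : (ringVertices (K + 3)).card = 10 * (K + 4) := by
  have h := sum_ringVertices K (fun _ _ _ => 1)
  rw [← Finset.card_eq_sum_ones] at h
  have e1 : (∑ j ∈ Finset.range 10, if j ∈ ringMembers 1 then 1 else 0) = 4 := by decide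
  have e2 : (∑ j ∈ Finset.range 10, if j ∈ ringMembers 2 then 1 else 0) = 10 := by decide
  have e3 : (∑ j ∈ Finset.range 10, if j ∈ ringMembers 3 then 1 else 0) = 6 := by decide
  rw [h, e1, e2, e3]
  ring

theorem sum_ringDegree (K : ℕ) : ∑ p ∈ ringVertices (K + 3),
    ringDegree (ringKind (K + 3) (p.1 - 1)) (ringKind (K + 3) p.1) p.2 = 36 * (K + 3) + 28 := by
  rw [sum_ringVertices K ringDegree]
  have e1 : (∑ j ∈ Finset.range 10, if j ∈ ringMembers 1 then ringDegree 0 1 j else 0) = 12 := by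
    decide
  have e2 : (∑ j ∈ Finset.range 10, if j ∈ ringMembers 2 then ringDegree 1 2 j else 0) = 34 := by
    decide
  have e3 : (∑ j ∈ Finset.range 10, if j ∈ ringMembers 2 then ringDegree 2 2 j else 0) = 36 := by
    decide
  have e4 : (∑ j ∈ Finset.range 10, if j ∈ ringMembers 3 then ringDegree 2 3 j else 0) = 18 := by
    decide
  rw [e1, e2, e3, e4]
  ring

end Graph

/-! ### Short cycles in nested rings -/

/-- Neighbours in a window of consecutive rings of the given kinds, where `10 * k + j` stands for
position `j` of the ring with number `k` in the window. -/
def windowNbrs (τ : List ℕ) (x : ℕ) : List ℕ :=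
  (sameNbrs (τ.getD (x / 10) 0) (x % 10)).map (fun j => 10 * (x / 10) + j) ++
    (upNbrs (τ.getD (x / 10) 0) (x % 10)).map (fun j => 10 * (x / 10 + 1) + j) ++
    if x / 10 = 0 then [] else
      (downNbrs (τ.getD (x / 10 - 1) 0) (x % 10)).map (fun j => 10 * (x / 10 - 1) + j)

/-- A window of four rings has no cycles of length three. -/
def windowNoThreeCycle (τ : List ℕ) : Bool :=
  (List.range 40).all fun a => (windowNbrs τ a).all fun b => (windowNbrs τ b).all fun c =>
    !(windowNbrs τ c).contains a

/-- A window of four rings has no cycles of length six. -/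
def windowNoSixCycle (τ : List ℕ) : Bool :=
  (List.range 40).all fun a => (windowNbrs τ a).all fun b => (windowNbrs τ b).all fun c =>
    c == a || (windowNbrs τ c).all fun d =>
      d == a || d == b || (windowNbrs τ d).all fun e =>
        e == a || e == b || e == c || (windowNbrs τ e).all fun f =>
          f == a || f == b || f == c || f == d || !(windowNbrs τ f).contains a

theorem windowNoThreeCycle_true :
    ∀ τ ∈ [[1, 2, 2, 2], [2, 2, 2, 2], [2, 2, 2, 3]], windowNoThreeCycle τ = true := by
  decide +kernel

theorem windowNoSixCycle_true :
    ∀ τ ∈ [[1, 2, 2, 2], [2, 2, 2, 2], [2, 2, 2, 3]], windowNoSixCycle τ = true := by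
  decide +kernel

/-- The kinds of four consecutive rings. -/
def ringWindow (K b : ℕ) : List ℕ :=
  [ringKind K b, ringKind K (b + 1), ringKind K (b + 2), ringKind K (b + 3)]

theorem ringWindow_getD (K b : ℕ) {i : ℕ} (hi : i < 4) :
    (ringWindow K b).getD i 0 = ringKind K (b + i) := by
  interval_cases i <;> rfl

theorem mem_downNbrs_of_mem_upNbrs {t j x : ℕ} (ht : t < 4) (hj : j < 10) (h : x ∈ upNbrs t j) :
    j ∈ downNbrs t x := by
  have key : ∀ t < 4, ∀ j < 10, ∀ x ∈ upNbrs t j, j ∈ downNbrs t x := by decide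
  exact key t ht j hj x h

theorem mem_windowNbrs {K b : ℕ} {p q : ℕ × ℕ} (hp : p ∈ ringVertices K) (hq : q ∈ ringVertices K)
    (hpb : b ≤ p.1) (hpb' : p.1 ≤ b + 3) (hqb : b ≤ q.1)
    (h : RingAdj K p q) :
    10 * (q.1 - b) + q.2 ∈ windowNbrs (ringWindow K b) (10 * (p.1 - b) + p.2) := by
  obtain ⟨r, j⟩ := p
  obtain ⟨r', j'⟩ := q
  have hj := lt_of_mem_ringMembers (ringKind_lt _ _) (mem_ringVertices.1 hp)
  have hj' := lt_of_mem_ringMembers (ringKind_lt _ _) (mem_ringVertices.1 hq)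
  simp only at *
  have hd : (10 * (r - b) + j) / 10 = r - b := by omega
  have hm : (10 * (r - b) + j) % 10 = j := by omega
  unfold windowNbrs
  rw [hd, hm, ringWindow_getD K b (by omega : r - b < 4), show b + (r - b) = r by omega,
    List.mem_append, List.mem_append]
  rcases h with ⟨h1, h2⟩ | ⟨h1, h2⟩ | ⟨h1, h2⟩
  · simp only at h1 h2
    subst h1
    exact Or.inl (Or.inl (List.mem_map.2 ⟨j', h2, rfl⟩))
  · simp only at h1 h2
    subst h1
    refine Or.inl (Or.inr (List.mem_map.2 ⟨j', h2, ?_⟩))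
    rw [show r + 1 - b = r - b + 1 by omega]
  · simp only at h1 h2
    subst h1
    rw [if_neg (by omega)]
    refine Or.inr (List.mem_map.2 ⟨j', ?_, ?_⟩)
    · rw [show r' + 1 - b - 1 = r' - b by omega, ringWindow_getD K b (by omega : r' - b < 4),
        show b + (r' - b) = r' by omega]
      exact mem_downNbrs_of_mem_upNbrs (ringKind_lt _ _) hj' h2
    · rw [show r' + 1 - b - 1 = r' - b by omega]

theorem RingAdj.level {K : ℕ} {p q : ℕ × ℕ} (h : RingAdj K p q) :
    p.1 ≤ q.1 + 1 ∧ q.1 ≤ p.1 + 1 := by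
  rcases h with h | h | h <;> omega

theorem level_of_mem_ringVertices {K : ℕ} {p : ℕ × ℕ} (hp : p ∈ ringVertices K) :
    1 ≤ p.1 ∧ p.1 ≤ K + 2 := by
  have := ringKind_ne_zero_of_mem hp
  unfold ringKind at this
  split_ifs at this <;> omega

/-- A window that would pass the outermost ring is slid down to start at `K - 1`. With at least
three middle rings, no window then contains both extreme kinds. -/
theorem exists_ringWindow {K b : ℕ} (hK : 3 ≤ K) (hb : 1 ≤ b) :
    ∃ b' ≤ b, (∀ r, r ≤ b + 3 → r ≤ K + 2 → r ≤ b' + 3) ∧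
      ringWindow K b' ∈ [[1, 2, 2, 2], [2, 2, 2, 2], [2, 2, 2, 3]] := by
  refine ⟨min b (K - 1), min_le_left _ _, fun r h1 h2 => by omega, ?_⟩
  have k1 : ringKind K 1 = 1 := rfl
  have k2 : ∀ r, 2 ≤ r → r ≤ K + 1 → ringKind K r = 2 := by
    intro r h1 h2; unfold ringKind; split_ifs <;> omega
  have k3 : ringKind K (K + 2) = 3 := by unfold ringKind; split_ifs <;> omega
  set b' := min b (K - 1) with hb'
  unfold ringWindow
  rw [k2 (b' + 1) (by omega) (by omega), k2 (b' + 2) (by omega) (by omega)]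
  by_cases h1 : b' = 1
  · rw [h1, k1, k2 _ (by omega) (by omega)]; simp
  · rw [k2 b' (by omega) (by omega)]
    by_cases h2 : b' = K - 1
    · rw [show b' + 3 = K + 2 by omega, k3]; simp
    · rw [k2 _ (by omega) (by omega)]; simp

section Graph

variable {W : Type*} {K : ℕ} {pos : W → ℕ × ℕ}

theorem ringGraph_cliqueFree (hK : 3 ≤ K) (hpos : ∀ w, pos w ∈ ringVertices K) :
    (ringGraph K pos hpos).CliqueFree 3 := by
  classical
  intro s hs
  obtain ⟨u, v, w, huv, huw, hvw, -⟩ := SimpleGraph.is3Clique_iff.1 hs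
  have huv : RingAdj K (pos u) (pos v) := huv
  have hvw : RingAdj K (pos v) (pos w) := hvw
  have hwu : RingAdj K (pos w) (pos u) := RingAdj.symm huw
  have lu := level_of_mem_ringVertices (hpos u)
  have lv := level_of_mem_ringVertices (hpos v)
  have lw := level_of_mem_ringVertices (hpos w)
  have l1 := huv.level
  have l2 := hvw.level
  have l3 := hwu.level
  obtain ⟨b, hb, hb', hτ⟩ := exists_ringWindow (b := min (pos u).1 (min (pos v).1 (pos w).1)) hK
    (by omega)
  have bu := hb' (pos u).1 (by omega) lu.2
  have bv := hb' (pos v).1 (by omega) lv.2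
  have bw := hb' (pos w).1 (by omega) lw.2
  have m1 := mem_windowNbrs (hpos u) (hpos v) (b := b) (by omega) bu (by omega) huv
  have m2 := mem_windowNbrs (hpos v) (hpos w) (b := b) (by omega) bv (by omega) hvw
  have m3 := mem_windowNbrs (hpos w) (hpos u) (b := b) (by omega) bw (by omega) hwu
  have hj := lt_of_mem_ringMembers (ringKind_lt _ _) (mem_ringVertices.1 (hpos u))
  have key := windowNoThreeCycle_true _ hτ
  simp only [windowNoThreeCycle, List.all_eq_true] at key
  have := key _ (List.mem_range.2 (by omega)) _ m1 _ m2
  simp only [Bool.not_eq_true', List.contains_eq_mem, decide_eq_false_iff_not] at this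
  exact this m3

/-- Along an edge the ring number changes by at most one, so two vertices of a 6-cycle are at most
three rings apart and the cycle fits in a window of four. -/
theorem ringGraph_free_cycleGraph_six (hK : 3 ≤ K) (hpos : ∀ w, pos w ∈ ringVertices K)
    (hinj : Function.Injective pos) :
    (SimpleGraph.cycleGraph 6).Free (ringGraph K pos hpos) := by
  intro h
  obtain ⟨p, hp, hadj⟩ := cycleGraph_six_isContained_iff.1 h
  have ha : ∀ i, RingAdj K (pos (p i)) (pos (p (i + 1))) := hadj
  have l0 := (ha 0).level
  have l1 := (ha 1).level
  have l2 := (ha 2).level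
  have l3 := (ha 3).level
  have l4 := (ha 4).level
  have l5 := (ha 5).level
  simp only [Fin.isValue, Fin.reduceAdd] at l0 l1 l2 l3 l4 l5
  have lv := fun i => level_of_mem_ringVertices (hpos (p i))
  have lv0 := lv 0
  have lv1 := lv 1
  have lv2 := lv 2
  have lv3 := lv 3
  have lv4 := lv 4
  have lv5 := lv 5
  obtain ⟨b, hb, hb', hτ⟩ := exists_ringWindow
    (b := min (pos (p 0)).1 (min (pos (p 1)).1 (min (pos (p 2)).1 (min (pos (p 3)).1
      (min (pos (p 4)).1 (pos (p 5)).1))))) hK (by omega)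
  have hlow : ∀ i, b ≤ (pos (p i)).1 := by
    intro i; fin_cases i <;> simp only [Fin.reduceFinMk, Fin.zero_eta, Fin.mk_one] <;> omega
  have hhigh : ∀ i, (pos (p i)).1 ≤ b + 3 := by
    intro i
    refine hb' _ ?_ (lv i).2
    fin_cases i <;> simp only [Fin.reduceFinMk, Fin.zero_eta, Fin.mk_one] <;> omega
  -- Positions are below 10, so this code determines the ring and the position.
  let c : Fin 6 → ℕ := fun i => 10 * ((pos (p i)).1 - b) + (pos (p i)).2
  have hj := fun i => lt_of_mem_ringMembers (ringKind_lt _ _) (mem_ringVertices.1 (hpos (p i)))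
  have hc : ∀ i, c (i + 1) ∈ windowNbrs (ringWindow K b) (c i) := fun i =>
    mem_windowNbrs (hpos _) (hpos _) (hlow i) (hhigh i) (hlow _) (ha i)
  have hci : Function.Injective c := by
    intro i i' hii
    simp only [c] at hii
    have h1 := hlow i
    have h2 := hlow i'
    have h3 := hj i
    have h4 := hj i'
    exact hp (hinj (Prod.ext (by omega) (by omega)))
  have hc40 : c 0 < 40 := by
    have := hj 0
    have := hhigh 0
    simp only [c]
    omega
  have key := windowNoSixCycle_true _ hτ
  simp only [windowNoSixCycle, List.all_eq_true, Bool.or_eq_true, beq_iff_eq] at key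
  have n : ∀ i i', i ≠ i' → c i ≠ c i' := fun i i' h => hci.ne h
  have k1 := (key _ (List.mem_range.2 hc40) _ (hc 0) _ (hc 1)).resolve_left (n _ _ (by decide))
  have k2 := (k1 _ (hc 2)).resolve_left (not_or.2 ⟨n _ _ (by decide), n _ _ (by decide)⟩)
  have k3 := (k2 _ (hc 3)).resolve_left
    (not_or.2 ⟨not_or.2 ⟨n _ _ (by decide), n _ _ (by decide)⟩, n _ _ (by decide)⟩)
  have k4 := (k3 _ (hc 4)).resolve_left (not_or.2 ⟨not_or.2 ⟨not_or.2
    ⟨n _ _ (by decide), n _ _ (by decide)⟩, n _ _ (by decide)⟩, n _ _ (by decide)⟩)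
  simp only [Bool.not_eq_true', List.contains_eq_mem, decide_eq_false_iff_not] at k4
  exact k4 (hc 5)

end Graph

/-! ### A drawing of the nested rings -/

/-- Coordinates of a position in the frame of its ring. -/
def ringPos (j : ℕ) : ℤ × ℤ :=
  [(3, 0), (0, 3), (-3, 0), (0, -3), (3, 3), (-3, 3), (-3, -3), (3, -3), (2, 0), (-2, 0)].getD j
    (0, 0)

/-- Coordinates of a position in the frame of the next ring. -/
def ringPosPrev (j : ℕ) : ℤ × ℤ :=
  [(0, -1), (1, 0), (0, 1), (-1, 0), (1, -1), (1, 1), (-1, 1), (-1, -1)].getD j (0, 0)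

/-- Rotation by a right angle and scaling by three. -/
def intStep (a : ℤ × ℤ) : ℤ × ℤ := (-3 * a.2, 3 * a.1)

/-- Rotation by a right angle and scaling by three. -/
def ringStep : ℝ × ℝ →ₗ[ℝ] ℝ × ℝ where
  toFun x := (-3 * x.2, 3 * x.1)
  map_add' x y := Prod.ext (by simp only [Prod.fst_add, Prod.snd_add]; ring)
    (by simp only [Prod.fst_add, Prod.snd_add]; ring)
  map_smul' r x := Prod.ext (by simp; ring) (by simp; ring)

theorem ringStep_intPoint (a : ℤ × ℤ) : ringStep (intPoint a) = intPoint (intStep a) := by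
  simp [ringStep, intPoint, intStep]

theorem norm_ringStep (z : ℝ × ℝ) : ‖ringStep z‖ = 3 * ‖z‖ := by
  change ‖((-3 * z.2, 3 * z.1) : ℝ × ℝ)‖ = _
  rw [Prod.norm_def, Prod.norm_def, mul_max_of_nonneg _ _ (by norm_num : (0 : ℝ) ≤ 3), max_comm]
  simp

theorem norm_ringStep_pow (n : ℕ) (z : ℝ × ℝ) : ‖(ringStep ^ n) z‖ = 3 ^ n * ‖z‖ := by
  induction n with
  | zero => simp
  | succ n ih => rw [pow_succ', Module.End.mul_apply, norm_ringStep, ih]; ring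

theorem ringStep_pow_injective (n : ℕ) : Function.Injective (ringStep ^ n) := by
  rw [injective_iff_map_eq_zero]
  intro z hz
  have := norm_ringStep_pow n z
  rw [hz, norm_zero] at this
  have h3 : (3 : ℝ) ^ n ≠ 0 := by positivity
  exact norm_eq_zero.1 ((mul_eq_zero.1 this.symm).resolve_left h3)

/-- The point of the plane that represents a position. -/
noncomputable def ringPoint (p : ℕ × ℕ) : ℝ × ℝ := (ringStep ^ p.1) (intPoint (ringPos p.2))

/-- Positions 8 and 9 have no integer coordinates in the next frame, but they have no neighbours in
the next ring either. -/
theorem ringPoint_eq_prev (r : ℕ) {j : ℕ} (hj : j < 8) :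
    ringPoint (r, j) = (ringStep ^ (r + 1)) (intPoint (ringPosPrev j)) := by
  have key : ∀ j < 8, ringPos j = intStep (ringPosPrev j) := by decide
  rw [pow_succ, Module.End.mul_apply, ringStep_intPoint, ← key j hj]
  rfl

theorem norm_intPoint_le {a : ℤ × ℤ} {m : ℤ} (h : |a.1| ≤ m ∧ |a.2| ≤ m) : ‖intPoint a‖ ≤ m := by
  rw [Prod.norm_def]
  simp only [intPoint, Real.norm_eq_abs]
  exact max_le (by exact_mod_cast h.1) (by exact_mod_cast h.2)

theorem le_norm_intPoint {a : ℤ × ℤ} {m : ℤ} (h : m ≤ |a.1| ∨ m ≤ |a.2|) : m ≤ ‖intPoint a‖ := by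
  rw [Prod.norm_def]
  simp only [intPoint, Real.norm_eq_abs]
  rcases h with h | h
  · exact le_max_of_le_left (by exact_mod_cast h)
  · exact le_max_of_le_right (by exact_mod_cast h)

/-- In the sup norm, the points of ring `r` have norm between 2 · 3 ^ r and 3 · 3 ^ r, so different
rings are disjoint. -/
theorem ringPoint_injOn {p q : ℕ × ℕ} (hp : p.2 < 10) (hq : q.2 < 10)
    (h : ringPoint p = ringPoint q) : p = q := by
  wlog hle : p.1 ≤ q.1 generalizing p q
  · exact (this hq hp h.symm (le_of_not_ge hle)).symm
  obtain ⟨r, j⟩ := p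
  obtain ⟨r', j'⟩ := q
  simp only at hp hq hle
  obtain ⟨d, rfl⟩ := Nat.exists_eq_add_of_le hle
  simp only [ringPoint, pow_add, Module.End.mul_apply] at h
  have h := ringStep_pow_injective r h
  have key1 : ∀ j < 10, |(ringPos j).1| ≤ 3 ∧ |(ringPos j).2| ≤ 3 := by decide
  have key2 : ∀ j < 10, 2 ≤ |(ringPos j).1| ∨ 2 ≤ |(ringPos j).2| := by decide
  have h1 := norm_intPoint_le (key1 j hp)
  have h2 := le_norm_intPoint (key2 j' hq)
  push_cast at h1 h2
  have hd : d = 0 := by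
    by_contra hd
    have hn := congrArg norm h
    rw [norm_ringStep_pow] at hn
    have : (3 : ℝ) ^ 1 ≤ 3 ^ d := pow_le_pow_right₀ (by norm_num) (by omega)
    nlinarith
  subst hd
  simp only [pow_zero, Module.End.one_apply, intPoint, Prod.mk.injEq, Int.cast_inj] at h
  have key3 : ∀ j < 10, ∀ j' < 10, (ringPos j).1 = (ringPos j').1 →
    (ringPos j).2 = (ringPos j').2 → j = j' := by decide
  rw [key3 j hp j' hq h.1 h.2]
  simp

/-- The segments between a ring of kind `t'` and the next ring, of kind `t`, and within the latter,
in the frame of the latter. -/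
def frameEdges (t' t : ℕ) : List ((ℤ × ℤ) × (ℤ × ℤ)) :=
  ((List.range 10).flatMap fun j =>
    ((sameNbrs t j).filter (j < ·)).map fun j' => (ringPos j, ringPos j')) ++
  (List.range 8).flatMap fun j => (upNbrs t' j).map fun j' => (ringPosPrev j, ringPos j')

theorem frameEdges_meet : ∀ tt ∈ [(0, 1), (1, 2), (2, 2), (2, 3)],
    ∀ e ∈ frameEdges tt.1 tt.2, ∀ f ∈ frameEdges tt.1 tt.2,
      e = f ∨ intMeetAtEnds e.1 e.2 f.1 f.2 = true := by
  decide +kernel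

theorem frameEdges_meet_next : ∀ tt ∈ [(0, 1, 2), (1, 2, 2), (2, 2, 2), (2, 2, 3)],
    ∀ e ∈ frameEdges tt.1 tt.2.1, ∀ f ∈ frameEdges tt.2.1 tt.2.2,
      intMeetAtEnds e.1 e.2 (intStep f.1) (intStep f.2) = true := by
  decide +kernel

theorem frameEdges_le : ∀ tt ∈ [(0, 1), (1, 2), (2, 2), (2, 3)],
    ∀ e ∈ frameEdges tt.1 tt.2, (|e.1.1| ≤ 3 ∧ |e.1.2| ≤ 3) ∧ |e.2.1| ≤ 3 ∧ |e.2.2| ≤ 3 := by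
  decide +kernel

/-- The functional `u` certifies, through `one_le_norm_of_mem_segment`, that the edge avoids the
open unit ball of the sup norm. -/
theorem le_frameEdges : ∀ tt ∈ [(2, 2), (2, 3)], ∀ e ∈ frameEdges tt.1 tt.2,
    ∃ u ∈ [(1, 0), (0, 1), (-1, 0), (0, -1), (1, 1), (1, -1), (-1, 1), (-1, -1)],
      |u.1| + |u.2| ≤ intDot u e.1 ∧ |u.1| + |u.2| ≤ intDot u e.2 ∧ 0 < |u.1| + |u.2| := by
  decide +kernel

theorem norm_le_of_mem_segment {a b : ℤ × ℤ} {m : ℤ} (ha : |a.1| ≤ m ∧ |a.2| ≤ m)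
    (hb : |b.1| ≤ m ∧ |b.2| ≤ m) {z : ℝ × ℝ} (hz : z ∈ segment ℝ (intPoint a) (intPoint b)) :
    ‖z‖ ≤ m := by
  have h := (convex_closedBall (0 : ℝ × ℝ) (m : ℝ)).segment_subset
    (mem_closedBall_zero_iff.2 (norm_intPoint_le ha))
    (mem_closedBall_zero_iff.2 (norm_intPoint_le hb)) hz
  exact mem_closedBall_zero_iff.1 h

theorem one_le_norm_of_mem_segment {a b u : ℤ × ℤ} (ha : |u.1| + |u.2| ≤ intDot u a)
    (hb : |u.1| + |u.2| ≤ intDot u b) (hu : 0 < |u.1| + |u.2|) {z : ℝ × ℝ}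
    (hz : z ∈ segment ℝ (intPoint a) (intPoint b)) : 1 ≤ ‖z‖ := by
  obtain ⟨t, t0, t1, e1, e2⟩ := mem_segment_iff_exists_coord.1 hz
  simp only [intPoint] at e1 e2
  have hN : 0 < |(u.1 : ℝ)| + |(u.2 : ℝ)| := by exact_mod_cast hu
  set N := |(u.1 : ℝ)| + |(u.2 : ℝ)| with hN'
  have ha : N ≤ (u.1 : ℝ) * a.1 + u.2 * a.2 := by
    simp only [hN', intDot] at *; exact_mod_cast ha
  have hb : N ≤ (u.1 : ℝ) * b.1 + u.2 * b.2 := by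
    simp only [hN', intDot] at *; exact_mod_cast hb
  have h1 : N ≤ u.1 * z.1 + u.2 * z.2 := by
    have := mul_le_mul_of_nonneg_left ha (sub_nonneg.2 t1)
    have := mul_le_mul_of_nonneg_left hb t0
    rw [e1, e2]
    linarith
  have h2 : u.1 * z.1 + u.2 * z.2 ≤ N * ‖z‖ := by
    have a1 : (u.1 : ℝ) * z.1 ≤ |(u.1 : ℝ)| * ‖z‖ := by
      refine (le_abs_self _).trans ?_
      rw [abs_mul]
      exact mul_le_mul_of_nonneg_left (norm_fst_le z) (abs_nonneg _)
    have a2 : (u.2 : ℝ) * z.2 ≤ |(u.2 : ℝ)| * ‖z‖ := by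
      refine (le_abs_self _).trans ?_
      rw [abs_mul]
      exact mul_le_mul_of_nonneg_left (norm_snd_le z) (abs_nonneg _)
    rw [hN']
    linarith
  nlinarith

/-- The segment of a frame edge in ring `r`. -/
noncomputable def frameSegment (r : ℕ) (e : (ℤ × ℤ) × (ℤ × ℤ)) : Set (ℝ × ℝ) :=
  segment ℝ ((ringStep ^ r) (intPoint e.1)) ((ringStep ^ r) (intPoint e.2))

theorem ringKind_triple {K r : ℕ} (hK : 2 ≤ K) (hr : ringKind K (r + 1 + 1) ≠ 0) :
    (ringKind K r, ringKind K (r + 1), ringKind K (r + 1 + 1)) ∈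
      [(0, 1, 2), (1, 2, 2), (2, 2, 2), (2, 2, 3)] := by
  simp only [List.mem_cons, List.not_mem_nil, Prod.mk.injEq, or_false]
  unfold ringKind at hr ⊢
  have hr' : r ≤ K := by by_contra hc; split_ifs at hr <;> omega
  clear hr
  split_ifs <;> first | omega | contradiction

theorem ringKind_pair_of_two_le {K r : ℕ} (h2 : 2 ≤ r) (hr : ringKind K (r + 1) ≠ 0) :
    (ringKind K r, ringKind K (r + 1)) ∈ [(2, 2), (2, 3)] := by
  simp only [List.mem_cons, List.not_mem_nil, Prod.mk.injEq, or_false]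
  unfold ringKind at hr ⊢
  have hr' : r ≤ K + 1 := by by_contra hc; split_ifs at hr <;> omega
  clear hr
  split_ifs <;> first | omega | contradiction

/-- After dividing by a power of `ringStep`, edges of the same or of adjacent frames are covered by
the integer tests. -/
theorem frameSegment_inter {K r r' : ℕ} (hK : 2 ≤ K) (hrr : r ≤ r')
    (hr : ringKind K (r + 1) ≠ 0) (hr' : ringKind K (r' + 1) ≠ 0)
    {e f : (ℤ × ℤ) × (ℤ × ℤ)} (he : e ∈ frameEdges (ringKind K r) (ringKind K (r + 1)))
    (hf : f ∈ frameEdges (ringKind K r') (ringKind K (r' + 1))) {z : ℝ × ℝ}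
    (hz : z ∈ frameSegment (r + 1) e) (hz' : z ∈ frameSegment (r' + 1) f) :
    (r = r' ∧ e = f) ∨
      ((z = (ringStep ^ (r + 1)) (intPoint e.1) ∨ z = (ringStep ^ (r + 1)) (intPoint e.2)) ∧
      (z = (ringStep ^ (r' + 1)) (intPoint f.1) ∨ z = (ringStep ^ (r' + 1)) (intPoint f.2))) := by
  obtain ⟨d, rfl⟩ := Nat.exists_eq_add_of_le hrr
  have hpair : ∀ s, ringKind K (s + 1) ≠ 0 →
      (ringKind K s, ringKind K (s + 1)) ∈ [(0, 1), (1, 2), (2, 2), (2, 3)] := by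
    intro s hs
    have := ringKind_pair K s (by omega)
    simp only [List.mem_cons, List.not_mem_nil, Prod.mk.injEq, or_false] at this ⊢
    omega
  unfold frameSegment at hz hz'
  rw [← image_segment_linearMap] at hz hz'
  obtain ⟨y, hy, rfl⟩ := hz
  obtain ⟨y', hy', hyy⟩ := hz'
  have hpow : ringStep ^ (r + d + 1) = ringStep ^ (r + 1) * ringStep ^ d := by
    rw [← pow_add, add_right_comm]
  simp only [hpow, Module.End.mul_apply] at hyy ⊢
  have hyy := ringStep_pow_injective _ hyy
  simp only [(ringStep_pow_injective (r + 1)).eq_iff]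
  rcases d with _ | _ | d
  · simp only [pow_zero, Module.End.one_apply, add_zero] at hf hyy ⊢
    subst hyy
    rcases frameEdges_meet _ (hpair r hr) e he f hf with h | h
    · exact Or.inl ⟨trivial, h⟩
    · exact Or.inr (intMeetAtEnds_sound h _ hy hy')
  · right
    simp only [zero_add, pow_one, ringStep_intPoint] at hf hyy hr' ⊢
    have h := frameEdges_meet_next _ (ringKind_triple hK hr') e he f hf
    have hmem : y ∈ segment ℝ (intPoint (intStep f.1)) (intPoint (intStep f.2)) := by
      rw [← ringStep_intPoint, ← ringStep_intPoint, ← image_segment_linearMap]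
      exact ⟨y', hy', hyy⟩
    exact intMeetAtEnds_sound h _ hy hmem
  -- Frames at least two apart are separated by the norm: at most 3 on the inner edge, at least 9 on
  -- the outer one.
  · exfalso
    have hb := frameEdges_le _ (hpair r hr) e he
    have h1 := norm_le_of_mem_segment hb.1 hb.2 hy
    obtain ⟨u, -, hu1, hu2, hu3⟩ := le_frameEdges _
      (ringKind_pair_of_two_le (by omega : 2 ≤ r + (d + 1 + 1)) hr') f hf
    have h2 := one_le_norm_of_mem_segment hu1 hu2 hu3 hy'
    rw [← hyy, norm_ringStep_pow] at h1
    have : (3 : ℝ) ^ 2 ≤ 3 ^ (d + 1 + 1) := pow_le_pow_right₀ (by norm_num) (by omega)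
    push_cast at h1
    nlinarith

/-- Each edge belongs to the frame of its outer ring, where it is listed in one orientation only;
hence the two cases. -/
theorem RingAdj.exists_frameEdge {K : ℕ} {p q : ℕ × ℕ} (hp : p ∈ ringVertices K)
    (hq : q ∈ ringVertices K) (h : RingAdj K p q) :
    ∃ r, ringKind K (r + 1) ≠ 0 ∧ ∃ e ∈ frameEdges (ringKind K r) (ringKind K (r + 1)),
      (ringPoint p = (ringStep ^ (r + 1)) (intPoint e.1) ∧
        ringPoint q = (ringStep ^ (r + 1)) (intPoint e.2)) ∨
      (ringPoint q = (ringStep ^ (r + 1)) (intPoint e.1) ∧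
        ringPoint p = (ringStep ^ (r + 1)) (intPoint e.2)) := by
  have same : ∀ {r j j' : ℕ}, (r, j) ∈ ringVertices K → (r, j') ∈ ringVertices K →
      j' ∈ sameNbrs (ringKind K r) j → j < j' →
      ∃ s, ringKind K (s + 1) ≠ 0 ∧ ∃ e ∈ frameEdges (ringKind K s) (ringKind K (s + 1)),
        ringPoint (r, j) = (ringStep ^ (s + 1)) (intPoint e.1) ∧
          ringPoint (r, j') = (ringStep ^ (s + 1)) (intPoint e.2) := by
    intro r j j' h1 h2 hj hlt
    have hr : r ≠ 0 := by
      rintro rfl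
      exact ringKind_ne_zero_of_mem h1 rfl
    obtain ⟨s, rfl⟩ := Nat.exists_eq_succ_of_ne_zero hr
    refine ⟨s, ringKind_ne_zero_of_mem h1, (ringPos j, ringPos j'), ?_, rfl, rfl⟩
    refine List.mem_append_left _ (List.mem_flatMap.2 ⟨j, ?_, List.mem_map.2 ⟨j', ?_, rfl⟩⟩)
    · exact List.mem_range.2 (lt_of_mem_ringMembers (ringKind_lt _ _) (mem_ringVertices.1 h1))
    · exact List.mem_filter.2 ⟨hj, by simpa using hlt⟩
  have up : ∀ {r j j' : ℕ}, (r, j) ∈ ringVertices K → (r + 1, j') ∈ ringVertices K →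
      j' ∈ upNbrs (ringKind K r) j →
      ∃ s, ringKind K (s + 1) ≠ 0 ∧ ∃ e ∈ frameEdges (ringKind K s) (ringKind K (s + 1)),
        ringPoint (r, j) = (ringStep ^ (s + 1)) (intPoint e.1) ∧
          ringPoint (r + 1, j') = (ringStep ^ (s + 1)) (intPoint e.2) := by
    intro r j j' h1 h2 hj
    have hj10 := lt_of_mem_ringMembers (ringKind_lt _ _) (mem_ringVertices.1 h1)
    have key : ∀ t < 4, ∀ j < 10, ∀ j' ∈ upNbrs t j, j < 8 := by decide
    have hj8 := key _ (ringKind_lt K r) j hj10 j' hj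
    refine ⟨r, ringKind_ne_zero_of_mem h2, (ringPosPrev j, ringPos j'), ?_,
      ringPoint_eq_prev r hj8, rfl⟩
    exact List.mem_append_right _ (List.mem_flatMap.2 ⟨j, List.mem_range.2 hj8,
      List.mem_map.2 ⟨j', hj, rfl⟩⟩)
  obtain ⟨r, j⟩ := p
  obtain ⟨r', j'⟩ := q
  rcases h with ⟨h1, h2⟩ | ⟨h1, h2⟩ | ⟨h1, h2⟩ <;> simp only at h1 h2 <;> subst h1
  · rcases lt_trichotomy j j' with hlt | rfl | hlt
    · obtain ⟨s, hs, e, he, h⟩ := same hp hq h2 hlt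
      exact ⟨s, hs, e, he, Or.inl h⟩
    · exact absurd h2 (not_mem_sameNbrs_self (ringKind_lt _ _)
        (lt_of_mem_ringMembers (ringKind_lt _ _) (mem_ringVertices.1 hp)))
    · obtain ⟨s, hs, e, he, h⟩ := same hq hp (mem_sameNbrs_comm h2) hlt
      exact ⟨s, hs, e, he, Or.inr h⟩
  · obtain ⟨s, hs, e, he, h⟩ := up hp hq h2
    exact ⟨s, hs, e, he, Or.inl h⟩
  · obtain ⟨s, hs, e, he, h⟩ := up hq hp h2
    exact ⟨s, hs, e, he, Or.inr h⟩

theorem ringGraph_isPlanar {W : Type*} [Fintype W] {K : ℕ} {pos : W → ℕ × ℕ} (hK : 2 ≤ K)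
    (hpos : ∀ w, pos w ∈ ringVertices K) (hinj : Function.Injective pos)
    (hdeg : ∀ v, 3 ≤ (ringGraph K pos hpos).degree v) : (ringGraph K pos hpos).IsPlanar := by
  classical
  have hlt : ∀ w, (pos w).2 < 10 := fun w =>
    lt_of_mem_ringMembers (ringKind_lt _ _) (mem_ringVertices.1 (hpos w))
  have hpinj : Function.Injective fun w => ringPoint (pos w) := fun v w h =>
    hinj (ringPoint_injOn (hlt v) (hlt w) h)
  refine SimpleGraph.isPlanar_of_segments (fun w => ringPoint (pos w)) hpinj ?_ ?_
  · intro u v x y huv hxy hne z hz hz'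
    obtain ⟨r, hr, e, he, h1⟩ := RingAdj.exists_frameEdge (hpos u) (hpos v) huv
    obtain ⟨r', hr', f, hf, h2⟩ := RingAdj.exists_frameEdge (hpos x) (hpos y) hxy
    have m1 : z ∈ frameSegment (r + 1) e := by
      unfold frameSegment
      rcases h1 with ⟨a, b⟩ | ⟨a, b⟩ <;> rw [← a, ← b]
      · exact hz
      · rw [segment_symm]; exact hz
    have m2 : z ∈ frameSegment (r' + 1) f := by
      unfold frameSegment
      rcases h2 with ⟨a, b⟩ | ⟨a, b⟩ <;> rw [← a, ← b]
      · exact hz'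
      · rw [segment_symm]; exact hz'
    have main : (r = r' ∧ e = f) ∨
        ((z = (ringStep ^ (r + 1)) (intPoint e.1) ∨ z = (ringStep ^ (r + 1)) (intPoint e.2)) ∧
        (z = (ringStep ^ (r' + 1)) (intPoint f.1) ∨
          z = (ringStep ^ (r' + 1)) (intPoint f.2))) := by
      rcases le_total r r' with h | h
      · exact frameSegment_inter hK h hr hr' he hf m1 m2
      · rcases frameSegment_inter hK h hr' hr hf he m2 m1 with h | h
        · exact Or.inl ⟨h.1.symm, h.2.symm⟩
        · exact Or.inr h.symm
    rcases main with ⟨rfl, rfl⟩ | ⟨k1, k2⟩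
    · exfalso
      refine hne ?_
      rcases h1 with ⟨a, b⟩ | ⟨a, b⟩ <;> rcases h2 with ⟨a', b'⟩ | ⟨a', b'⟩
      · rw [hpinj (a.trans a'.symm), hpinj (b.trans b'.symm)]
      · rw [hpinj (a.trans a'.symm), hpinj (b.trans b'.symm), Sym2.eq_swap]
      · rw [hpinj (a.trans a'.symm), hpinj (b.trans b'.symm), Sym2.eq_swap]
      · rw [hpinj (a.trans a'.symm), hpinj (b.trans b'.symm)]
    · constructor
      · rcases h1 with ⟨a, b⟩ | ⟨a, b⟩ <;> rw [← a, ← b] at k1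
        · exact k1
        · exact k1.symm
      · rcases h2 with ⟨a, b⟩ | ⟨a, b⟩ <;> rw [← a, ← b] at k2
        · exact k2
        · exact k2.symm
  · intro v w
    obtain ⟨u, hu, huw⟩ := Finset.exists_mem_ne
      (s := (ringGraph K pos hpos).neighborFinset v)
      (by rw [SimpleGraph.card_neighborFinset_eq_degree]; have := hdeg v; omega) w
    exact ⟨u, huw, (SimpleGraph.mem_neighborFinset ..).1 hu⟩

/-! ### Sharpness of the bound -/

/-- The degree sum is at least 36(K + 3) + 28, so there are at least 18(K + 4) - 4 edges, and the
upper bound with 10(K + 4) vertices allows no more. -/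
theorem exists_sharp_isPlanar (K : ℕ) :
    ∃ (G : SimpleGraph (Fin (10 * (K + 4)))) (_ : DecidableRel G.Adj),
      G.IsPlanar ∧ G.CliqueFree 3 ∧ (SimpleGraph.cycleGraph 6).Free G ∧ 3 ≤ G.minDegree ∧
        G.edgeFinset.card = 18 * (K + 4) - 4 := by
  let φ := (ringVertices (K + 3)).equivFinOfCardEq (card_ringVertices K)
  let pos : Fin (10 * (K + 4)) → ℕ × ℕ := fun i => φ.symm i
  have hpos : ∀ w, pos w ∈ ringVertices (K + 3) := fun w => (φ.symm w).2
  have hinj : Function.Injective pos := Subtype.val_injective.comp φ.symm.injective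
  have hsurj : ∀ p ∈ ringVertices (K + 3), ∃ w, pos w = p := fun p hp =>
    ⟨φ ⟨p, hp⟩, by simp [pos]⟩
  have hle := ringDegree_le_degree (by omega) hpos hsurj
  have hdeg : ∀ v, 3 ≤ (ringGraph (K + 3) pos hpos).degree v := fun v =>
    (three_le_ringDegree (by omega) (hpos v)).trans (hle v)
  have : Nonempty (Fin (10 * (K + 4))) := ⟨⟨0, by omega⟩⟩
  have hP := ringGraph_isPlanar (by omega) hpos hinj hdeg
  have h3 := ringGraph_cliqueFree (by omega) hpos
  have h6 := ringGraph_free_cycleGraph_six (by omega) hpos hinj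
  have hmin := SimpleGraph.le_minDegree_of_forall_le_degree _ 3 hdeg
  refine ⟨ringGraph (K + 3) pos hpos, inferInstance, hP, h3, h6, hmin, ?_⟩
  have hub := hP.five_mul_card_edgeFinset_add_twenty_le h3 h6 hmin
  have hsum := (ringGraph (K + 3) pos hpos).sum_degrees_eq_twice_card_edges
  have hlb := Finset.sum_le_sum fun v (_ : v ∈ Finset.univ) => hle v
  have htot : ∑ v, ringDegree (ringKind (K + 3) ((pos v).1 - 1)) (ringKind (K + 3) (pos v).1)
      (pos v).2 = 36 * (K + 3) + 28 := by
    rw [← sum_ringDegree K, ← Finset.sum_coe_sort (ringVertices (K + 3))]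
    exact Equiv.sum_comp φ.symm fun p : ringVertices (K + 3) =>
      ringDegree (ringKind (K + 3) (p.1.1 - 1)) (ringKind (K + 3) p.1.1) p.1.2
  rw [htot, hsum] at hlb
  rw [Fintype.card_fin] at hub
  omega

theorem mainTheorem4 :
    (∀ (V : Type*) [Fintype V] (G : SimpleGraph V) [DecidableRel G.Adj],
      G.IsPlanar → G.CliqueFree 3 → (SimpleGraph.cycleGraph 6).Free G → 3 ≤ G.minDegree →
        (G.edgeFinset.card : ℤ) ≤ ⌊(9 / 5 : ℝ) * (Fintype.card V : ℝ) - 4⌋) ∧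
    {n : ℕ | ∃ (G : SimpleGraph (Fin n)) (_ : DecidableRel G.Adj),
      G.IsPlanar ∧ G.CliqueFree 3 ∧ (SimpleGraph.cycleGraph 6).Free G ∧ 3 ≤ G.minDegree ∧
        (G.edgeFinset.card : ℤ) = ⌊(9 / 5 : ℝ) * (n : ℝ) - 4⌋}.Infinite := by
  constructor
  · intro V _ G _ hP hG hC hδ
    have h := hP.five_mul_card_edgeFinset_add_twenty_le hG hC hδ
    have h' : (5 : ℝ) * G.edgeFinset.card + 20 ≤ 9 * Fintype.card V := by exact_mod_cast h
    rw [Int.le_floor]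
    push_cast
    linarith
  · refine Set.infinite_of_injective_forall_mem (f := fun K : ℕ => 10 * (K + 4))
      (fun a b h => by simp only at h; omega) fun K => ?_
    obtain ⟨G, hG, hP, h3, h6, hmin, hcard⟩ := exists_sharp_isPlanar K
    refine ⟨G, hG, hP, h3, h6, hmin, ?_⟩
    -- As the number of vertices is a multiple of 10, the bound is an integer and the floor changes
    -- nothing.
    have hval : (9 / 5 : ℝ) * ((10 * (K + 4) : ℕ) : ℝ) - 4 = ((18 * (K + 4) - 4 : ℤ) : ℝ) := by
      push_cast; ring
    rw [hval, Int.floor_intCast, hcard]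
    omega
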